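/- **Notation.** For a finite group $G$ and $n\ge 0$ let $S_n[G]=S_n\ltimes G^n$, where $S_n$ permutes the indices, and let $R(G)=\bigoplus_{n\ge 0}R_n(G)$, where $R_n(G)$ is the Grothendieck group of finite-dimensional complex representations of $S_n[G]$ (so $R_0(G)=\mathbb Z$ via the dimension). The classes of irreducible representations form a $\mathbb Z$-basis, called the irreducible elements. For a subgroup $H\subseteq G$ and $k+l=n$, regard $S_k[H]\times S_l[G]$ as a subgroup of $S_n[G]$ (block-diagonal monomial matrices), and identify $R_k(H)\otimes R_l(G)$ with the Grothendieck group of $S_k[H]\times S_l[G]$ by external tensor product. Let $\alpha\colon R(H)\otimes R(G)\to R(G)$ be the map given on $R_k(H)\otimes R_l(G)$ by $\mathrm{Ind}_{S_k[H]\times S_l[G]}^{S_{k+l}[G]}$, and let $\alpha^*\colon R(G)\to R(H)\otimes R(G)$ be the map given on $R_n(G)$ by $\sum_{k+l=n}\mathrm{Res}^{S_n[G]}_{S_k[H]\times S_l[G]}$. Let $\mu,\mu^*$ be these maps for $R(H)$ itself (that is, with $H$ in place of $G$), let $e\colon\mathbb Z\to R_0(H)$ send $1$ to the class of the trivial representation,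 and let $e^*\colon R(H)\to\mathbb Z$ be the projection to $R_0(H)=\mathbb Z$. **Definitions.** A T-group is a free abelian group with a specified $\mathbb Z$-basis (the irreducible elements); it carries the bilinear form for which this basis is orthonormal, and $x$ is positive if $\langle x,\omega\rangle\ge 0$ for all irreducible $\omega$. Tensor products of T-groups have the tensor products of irreducible elements as irreducible elements, and $\mathbb Z$ has the irreducible element $1$ (in degree $0$). A graded T-group is one with a grading by $n\ge 0$ for which irreducible elements are homogeneous. Positive maps preserve positive elements, and $f,g$ are adjoint if $\langle f(m),n\rangle=\langle m,g(n)\rangle$. A PSH-algebra is a graded Hopf algebra $(A,\mu,\mu^*,e,e^*,T)$ over $\mathbb Z$ (all these maps being graded) that is connected ($e$ and $e^*$ are mutually inverse between $\mathbb Z$ and $A_0$) and a graded T-group, such that $\mu,\mu^*,e,e^*$ are positive, and $(\mu,\mu^*)$ and $(e,e^*)$ are adjoint pairs. Put $\Psi^0=e\circ e^*$ and, for $k\ge 1$, $\Psi^k=\mu^{(k)}\circ\mu^{*(k)}\colon A\to A^{\otimes k}\to A$, the composite of iterated comultiplication and iterated multiplication. A $k$-PSH module over $A$ is a graded T-group $M$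 with graded, positive, mutually adjoint maps $\alpha\colon A\otimes M\to M$ and $\alpha^*\colon M\to A\otimes M$ that satisfy associativity, coassociativity, the unit and counit axioms, and $$\alpha^*\circ\alpha=(\mu\otimes\alpha)\circ(\Psi^k\otimes\tau\otimes 1)\circ(\mu^*\otimes\alpha^*),\qquad \tau(x\otimes y)=y\otimes x.$$ **Theorem.** Let $G$ be a finite group and $H\trianglelefteq G$ a normal subgroup such that every inner automorphism of $G$ restricts to an inner automorphism of $H$. Then $(R(H),\mu,\mu^*,e,e^*)$ is a PSH-algebra, and $(R(G),\alpha,\alpha^*)$ is a $[G:H]$-PSH module over it. In particular $$\alpha^*\circ\alpha=(\mu\otimes\alpha)\circ(\Psi^{[G:H]}\otimes\tau\otimes 1)\circ(\mu^*\otimes\alpha^*).$$ -/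

import Mathlib

open scoped TensorProduct DirectSum

universe u v

/- Over `ℤ`, prefer these module structures to the one that every abelian group carries. -/
attribute [instance 2000] TensorProduct.instModule DirectSum.instModule

noncomputable section

/-- A finite-dimensional complex representation of a group `G`. -/
structure FinRep (G : Type u) [Group G] : Type (u + 1) where
  V : Type u
  [addCommGroup : AddCommGroup V]
  [module : Module ℂ V]
  [finite : Module.Finite ℂ V]
  ρ : Representation ℂ G V

attribute [instance] FinRep.addCommGroup FinRep.module FinRep.finite

namespace FinRep

variable {G : Type u} [Group G] {G' : Type u} [Group G']

/-- The sequence `0 → A → B → C → 0` of equivariant maps `f`, `g` is exact. -/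
def IsShortExact {A B C : FinRep G} (f : A.ρ.IntertwiningMap B.ρ) (g : B.ρ.IntertwiningMap C.ρ) :
    Prop :=
  Function.Injective f ∧ Function.Exact f g ∧ Function.Surjective g

/-- The restriction `Res A` along a group homomorphism. -/
def res (φ : G' →* G) (A : FinRep G) : FinRep G' := ⟨A.V, A.ρ.comp φ⟩

/-- The induced representation `Ind A = (ℂ[G] ⊗ A)_{G'}` along a group homomorphism. -/
def ind [Finite G] (φ : G' →* G) (A : FinRep G') : FinRep G :=
  haveI : Module.Finite ℂ (MonoidAlgebra ℂ G) :=
    Module.Finite.equiv (MonoidAlgebra.coeffLinearEquiv (S := ℂ) (M := G) ℂ).symm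
  ⟨Representation.IndV φ A.ρ, Representation.ind φ A.ρ⟩

/-- The action of `G × G'` on `A ⊗ B`. -/
abbrev boxtimesρ (A : FinRep G) (B : FinRep G') : Representation ℂ (G × G') (A.V ⊗[ℂ] B.V) :=
  Representation.tprod (A.ρ.comp (MonoidHom.fst G G')) (B.ρ.comp (MonoidHom.snd G G'))

/-- The external tensor product `A ⊗ B`, a representation of `G × G'`. -/
def boxtimes (A : FinRep G) (B : FinRep G') : FinRep (G × G') :=
  ⟨A.V ⊗[ℂ] B.V, boxtimesρ A B⟩

/-- Over a finite group every short exact sequence splits. -/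
theorem IsShortExact.split [Finite G] {A B C : FinRep G} {f : A.ρ.IntertwiningMap B.ρ}
    {g : B.ρ.IntertwiningMap C.ρ} (h : IsShortExact f g) :
    ∃ (r : B.ρ.IntertwiningMap A.ρ) (s : C.ρ.IntertwiningMap B.ρ),
      (∀ a, r (f a) = a) ∧ (∀ c, g (s c) = c) ∧ ∀ b, f (r b) + s (g b) = b := by
  obtain ⟨hf, hfg, hg⟩ := h
  obtain ⟨r', hr'⟩ := MonoidAlgebra.exists_leftInverse_of_injective
    (Representation.IntertwiningMap.equivLinearMapAsModule A.ρ B.ρ f) (by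
      rw [LinearMap.ker_eq_bot]; exact hf)
  let r := (Representation.IntertwiningMap.equivLinearMapAsModule B.ρ A.ρ).symm r'
  have hr : ∀ a, r (f a) = a := fun a => LinearMap.congr_fun hr' a
  obtain ⟨s0, hs0⟩ := g.toLinearMap.exists_rightInverse_of_surjective
    (LinearMap.range_eq_top.2 hg)
  have hs0 : ∀ c, g (s0 c) = c := fun c => LinearMap.congr_fun hs0 c
  have key : ∀ b, g b = 0 → f (r b) = b := by
    intro b hb
    obtain ⟨a, rfl⟩ := (hfg b).1 hb
    rw [hr]
  have hgf : ∀ a, g (f a) = 0 := fun a => (hfg _).2 ⟨a, rfl⟩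
  let s : C.ρ.IntertwiningMap B.ρ := LinearMap.intertwiningMap_of_isIntertwiningMap _ _
    (s0 - f.toLinearMap ∘ₗ r.toLinearMap ∘ₗ s0) (by
      intro x c
      have h1 := key (s0 (C.ρ x c) - B.ρ x (s0 c)) (by
        rw [map_sub, g.isIntertwining, hs0, hs0, sub_self])
      rw [map_sub, map_sub, r.isIntertwining, f.isIntertwining] at h1
      simp only [LinearMap.sub_apply, LinearMap.comp_apply,
        Representation.IntertwiningMap.toLinearMap_apply, map_sub]
      rw [← sub_eq_zero] at h1 ⊢
      rw [← neg_eq_zero, ← h1]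
      abel)
  have hs : ∀ c, s c = s0 c - f (r (s0 c)) := fun c => rfl
  refine ⟨r, s, hr, fun c => ?_, fun b => ?_⟩
  · rw [hs, map_sub, hs0, hgf, sub_zero]
  · have h1 := key (s0 (g b) - b) (by rw [map_sub, hs0, sub_self])
    rw [map_sub, map_sub] at h1
    rw [hs]
    rw [← sub_eq_zero] at h1 ⊢
    rw [← neg_eq_zero, ← h1]
    abel

theorem isShortExact_of_split {A B C : FinRep G} {f : A.ρ.IntertwiningMap B.ρ}
    {g : B.ρ.IntertwiningMap C.ρ} (r : B.ρ.IntertwiningMap A.ρ) (s : C.ρ.IntertwiningMap B.ρ)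
    (hr : ∀ a, r (f a) = a) (hs : ∀ c, g (s c) = c) (hgf : ∀ a, g (f a) = 0)
    (hb : ∀ b, f (r b) + s (g b) = b) : IsShortExact f g := by
  refine ⟨Function.LeftInverse.injective hr, fun b => ⟨fun h => ⟨r b, ?_⟩, ?_⟩,
    Function.RightInverse.surjective hs⟩
  · have := hb b
    rwa [h, map_zero, add_zero] at this
  · rintro ⟨a, rfl⟩; exact hgf a

/-- The map of induced representations defined by an equivariant map. -/
def indMap (φ : G' →* G) {A B : FinRep G'} (f : A.ρ.IntertwiningMap B.ρ) :
    (Representation.ind φ A.ρ).IntertwiningMap (Representation.ind φ B.ρ) :=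
  ⟨Representation.Coinvariants.map _ _ ⟨f.toLinearMap.lTensor _, by
    simp [LinearMap.lTensor_comp_map, f.2, LinearMap.map_comp_lTensor]⟩,
    fun g ↦ by ext; simp⟩

theorem indMap_mk (φ : G' →* G) {A B : FinRep G'} (f : A.ρ.IntertwiningMap B.ρ) (x) :
    indMap φ f (Representation.Coinvariants.mk _ x) =
      Representation.Coinvariants.mk _ (f.toLinearMap.lTensor _ x) := rfl

theorem indMap_comp (φ : G' →* G) {A B C : FinRep G'} (f : A.ρ.IntertwiningMap B.ρ)
    (g : B.ρ.IntertwiningMap C.ρ) (x) : indMap φ g (indMap φ f x) = indMap φ (g.comp f) x := by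
  obtain ⟨x, rfl⟩ := Representation.Coinvariants.mk_surjective _ x
  simp only [indMap_mk]
  rw [Representation.IntertwiningMap.comp_toLinearMap, LinearMap.lTensor_comp]
  rfl

theorem indMap_eq_self (φ : G' →* G) {A : FinRep G'} (f : A.ρ.IntertwiningMap A.ρ)
    (hf : ∀ a, f a = a) (x) : indMap φ f x = x := by
  obtain ⟨x, rfl⟩ := Representation.Coinvariants.mk_surjective _ x
  rw [indMap_mk]
  have : f.toLinearMap = LinearMap.id := LinearMap.ext hf
  rw [this, LinearMap.lTensor_id]; rfl

theorem indMap_add (φ : G' →* G) {A B : FinRep G'} (f g : A.ρ.IntertwiningMap B.ρ) (x) :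
    indMap φ f x + indMap φ g x = indMap φ (f + g) x := by
  obtain ⟨x, rfl⟩ := Representation.Coinvariants.mk_surjective _ x
  simp only [indMap_mk, ← map_add, Representation.IntertwiningMap.add_toLinearMap,
    LinearMap.lTensor_add, LinearMap.add_apply]

theorem IsShortExact.ind [Finite G] [Finite G'] (φ : G' →* G) {A B C : FinRep G'}
    {f : A.ρ.IntertwiningMap B.ρ} {g : B.ρ.IntertwiningMap C.ρ} (h : IsShortExact f g) :
    IsShortExact (A := A.ind φ) (B := B.ind φ) (C := C.ind φ) (indMap φ f) (indMap φ g) := by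
  obtain ⟨r, s, hr, hs, hb⟩ := h.split
  refine isShortExact_of_split (A := A.ind φ) (B := B.ind φ) (C := C.ind φ)
    (indMap φ r) (indMap φ s) (fun a => ?_) (fun a => ?_) (fun a => ?_) (fun b => ?_)
  · exact (indMap_comp φ f r a).trans (indMap_eq_self _ _ hr _)
  · exact (indMap_comp φ s g a).trans (indMap_eq_self _ _ hs _)
  · refine (indMap_comp φ f g a).trans ?_
    obtain ⟨x, rfl⟩ := Representation.Coinvariants.mk_surjective _ a
    rw [indMap_mk]
    have : (g.comp f).toLinearMap = 0 := LinearMap.ext fun a => (h.2.1 _).2 ⟨a, rfl⟩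
    rw [this, LinearMap.lTensor_zero]; rfl
  · refine (congrArg₂ (· + ·) (indMap_comp φ r f b) (indMap_comp φ g s b)).trans ?_
    exact (indMap_add φ _ _ b).trans (indMap_eq_self φ _ hb b)

/-- `f ⊗ 1` -/
def boxtimesLeft (B : FinRep G') {A A' : FinRep G} (f : A.ρ.IntertwiningMap A'.ρ) :
    (boxtimesρ A B).IntertwiningMap (boxtimesρ A' B) :=
  ⟨f.toLinearMap.rTensor B.V, fun x => TensorProduct.ext' fun a b => by simp [f.isIntertwining]⟩

/-- `1 ⊗ f` -/
def boxtimesRight (A : FinRep G) {B B' : FinRep G'} (f : B.ρ.IntertwiningMap B'.ρ) :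
    (boxtimesρ A B).IntertwiningMap (boxtimesρ A B') :=
  ⟨f.toLinearMap.lTensor A.V, fun x => TensorProduct.ext' fun a b => by simp [f.isIntertwining]⟩

theorem IsShortExact.boxtimesLeft (D : FinRep G') {A B C : FinRep G}
    {f : A.ρ.IntertwiningMap B.ρ} {g : B.ρ.IntertwiningMap C.ρ} (h : IsShortExact f g) :
    IsShortExact (A := A.boxtimes D) (B := B.boxtimes D) (C := C.boxtimes D)
      (FinRep.boxtimesLeft D f) (FinRep.boxtimesLeft D g) :=
  ⟨Module.Flat.rTensor_preserves_injective_linearMap f.toLinearMap h.1,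
    rTensor_exact D.V (f := f.toLinearMap) (g := g.toLinearMap) h.2.1 h.2.2,
    LinearMap.rTensor_surjective D.V (g := g.toLinearMap) h.2.2⟩

theorem IsShortExact.boxtimesRight (D : FinRep G) {A B C : FinRep G'}
    {f : A.ρ.IntertwiningMap B.ρ} {g : B.ρ.IntertwiningMap C.ρ} (h : IsShortExact f g) :
    IsShortExact (A := D.boxtimes A) (B := D.boxtimes B) (C := D.boxtimes C)
      (FinRep.boxtimesRight D f) (FinRep.boxtimesRight D g) :=
  ⟨Module.Flat.lTensor_preserves_injective_linearMap f.toLinearMap h.1,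
    lTensor_exact D.V (f := f.toLinearMap) (g := g.toLinearMap) h.2.1 h.2.2,
    LinearMap.lTensor_surjective D.V (g := g.toLinearMap) h.2.2⟩

theorem IsShortExact.res (φ : G' →* G) {A B C : FinRep G}
    {f : A.ρ.IntertwiningMap B.ρ} {g : B.ρ.IntertwiningMap C.ρ} (h : IsShortExact f g) :
    IsShortExact (A := A.res φ) (B := B.res φ) (C := C.res φ)
      ⟨f.toLinearMap, fun x => f.isIntertwining' (φ x)⟩
      ⟨g.toLinearMap, fun x => g.isIntertwining' (φ x)⟩ := h

end FinRep

/-- The relations `[B] = [A] + [C]`, one for each short exact sequence `0 → A → B → C → 0`. -/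
def K0.relations (G : Type u) [Group G] : AddSubgroup (FreeAbelianGroup (FinRep G)) :=
  AddSubgroup.closure {x | ∃ (A B C : FinRep G) (f : A.ρ.IntertwiningMap B.ρ)
    (g : B.ρ.IntertwiningMap C.ρ), FinRep.IsShortExact f g ∧
      x = FreeAbelianGroup.of B - (FreeAbelianGroup.of A + FreeAbelianGroup.of C)}

/-- The Grothendieck group of the category of finite-dimensional complex representations. -/
def K0 (G : Type u) [Group G] : Type (u + 1) :=
  FreeAbelianGroup (FinRep G) ⧸ K0.relations G

namespace K0

variable {G : Type u} [Group G] {G' : Type u} [Group G']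

instance : AddCommGroup (K0 G) :=
  inferInstanceAs (AddCommGroup (FreeAbelianGroup (FinRep G) ⧸ K0.relations G))

/-- The class `[A]` of a representation. -/
def mk (A : FinRep G) : K0 G := QuotientAddGroup.mk (FreeAbelianGroup.of A)

theorem mk_eq_add {A B C : FinRep G} {f : A.ρ.IntertwiningMap B.ρ}
    {g : B.ρ.IntertwiningMap C.ρ} (h : FinRep.IsShortExact f g) : mk B = mk A + mk C := by
  rw [← sub_eq_zero]
  exact (QuotientAddGroup.eq_zero_iff (N := K0.relations G) _).2
    (AddSubgroup.subset_closure ⟨A, B, C, f, g, h, rfl⟩)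

/-- An additive invariant of representations defines a map on the Grothendieck group. -/
def lift {M : Type v} [AddCommGroup M] [Module ℤ M] (F : FinRep G → M)
    (hF : ∀ (A B C : FinRep G) (f : A.ρ.IntertwiningMap B.ρ) (g : B.ρ.IntertwiningMap C.ρ),
      FinRep.IsShortExact f g → F B = F A + F C) : K0 G →ₗ[ℤ] M where
  __ := QuotientAddGroup.lift (K0.relations G) (FreeAbelianGroup.lift F) (by
    refine (AddSubgroup.closure_le _).2 ?_
    rintro _ ⟨A, B, C, f, g, h, rfl⟩
    simp [AddMonoidHom.mem_ker, hF A B C f g h])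
  map_smul' c x := by
    simpa using! map_intCast_smul (QuotientAddGroup.lift (K0.relations G) (FreeAbelianGroup.lift F)
      (_ : K0.relations G ≤ _)) ℤ ℤ c x

@[simp]
theorem lift_mk {M : Type v} [AddCommGroup M] [Module ℤ M] (F : FinRep G → M) (hF) (A : FinRep G) :
    lift F hF (mk A) = F A :=
  FreeAbelianGroup.lift_apply_of F A

theorem induction {p : K0 G → Prop} (h0 : p 0) (hmk : ∀ A, p (mk A))
    (hneg : ∀ x, p x → p (-x)) (hadd : ∀ x y, p x → p y → p (x + y)) (x : K0 G) : p x := by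
  obtain ⟨x, rfl⟩ := QuotientAddGroup.mk_surjective x
  induction x using FreeAbelianGroup.induction_on with
  | zero => exact h0
  | of A => exact hmk A
  | neg A h => exact hneg _ h
  | add x y hx hy => exact hadd _ _ hx hy

theorem hom_ext {M : Type v} [AddCommGroup M] [Module ℤ M] {f g : K0 G →ₗ[ℤ] M}
    (h : ∀ A, f (mk A) = g (mk A)) : f = g :=
  LinearMap.ext fun x => induction (p := fun x => f x = g x) (by rw [map_zero, map_zero]) h
    (fun x h => by rw [map_neg, map_neg, h])
    (fun x y hx hy => by rw [map_add, map_add, hx, hy]) x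

/-- `[A] ↦ [Res A]` -/
def res (φ : G' →* G) : K0 G →ₗ[ℤ] K0 G' :=
  lift (fun A => mk (A.res φ)) fun _ _ _ _ _ h => mk_eq_add (h.res φ)

/-- `[A] ↦ [Ind A]` -/
def ind [Finite G] [Finite G'] (φ : G' →* G) : K0 G' →ₗ[ℤ] K0 G :=
  lift (fun A => mk (A.ind φ)) fun _ _ _ _ _ h => mk_eq_add (h.ind φ)

/-- `[A] ⊗ [B] ↦ [A ⊗ B]`, the class of the external tensor product. -/
def boxtimes (G G' : Type u) [Group G] [Group G'] : K0 G ⊗[ℤ] K0 G' →ₗ[ℤ] K0 (G × G') :=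
  TensorProduct.lift (lift (fun A => lift (fun B => mk (A.boxtimes B))
    fun _ _ _ _ _ h => mk_eq_add (h.boxtimesRight A))
    fun _ _ _ _ _ h => hom_ext fun B => by simpa using mk_eq_add (h.boxtimesLeft B))

@[simp]
theorem boxtimes_mk (A : FinRep G) (B : FinRep G') :
    boxtimes G G' (mk A ⊗ₜ mk B) = mk (A.boxtimes B) := by
  unfold boxtimes
  rw [TensorProduct.lift.tmul]
  rw [lift_mk, lift_mk]

/-- `[A] ↦ dim A` -/
def dim : K0 G →ₗ[ℤ] ℤ :=
  lift (fun A => (Module.finrank ℂ A.V : ℤ)) fun A B C f g h => by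
    have h1 := LinearMap.finrank_range_add_finrank_ker g.toLinearMap
    rw [LinearMap.range_eq_top.2 h.2.2, finrank_top,
      (LinearMap.exact_iff (f := f.toLinearMap) (g := g.toLinearMap)).1 h.2.1,
      LinearMap.finrank_range_of_inj h.1] at h1
    omega

end K0

namespace K0

open Module

variable {G : Type u} [Group G] {G' : Type u} [Group G']

/-- `[A] ↦ χ_A` -/
def char [Finite G] : K0 G →ₗ[ℤ] (G → ℂ) :=
  lift (fun A => A.ρ.character) fun A B C f g h => by
    obtain ⟨r, s, hr, hs, hb⟩ := h.split
    ext x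
    have h1 : B.ρ x = f.toLinearMap ∘ₗ (r.toLinearMap ∘ₗ B.ρ x) +
        s.toLinearMap ∘ₗ (g.toLinearMap ∘ₗ B.ρ x) := LinearMap.ext fun b => (hb (B.ρ x b)).symm
    have h2 : (r.toLinearMap ∘ₗ B.ρ x) ∘ₗ f.toLinearMap = A.ρ x := LinearMap.ext fun a =>
      (Representation.IntertwiningMap.isIntertwining B.ρ A.ρ r x (f a)).trans (by rw [hr])
    have h3 : (g.toLinearMap ∘ₗ B.ρ x) ∘ₗ s.toLinearMap = C.ρ x := LinearMap.ext fun a =>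
      (Representation.IntertwiningMap.isIntertwining B.ρ C.ρ g x (s a)).trans (by rw [hs])
    rw [Representation.character, h1, map_add, LinearMap.trace_comp_comm', h2,
      LinearMap.trace_comp_comm', h3]
    rfl

@[simp]
theorem char_mk [Finite G] (A : FinRep G) : char (mk A) = A.ρ.character := lift_mk _ _ A

theorem char_boxtimes [Finite G] [Finite G'] (x : K0 G) (y : K0 G') (g : G × G') :
    char (boxtimes G G' (x ⊗ₜ y)) g = char x g.1 * char y g.2 := by
  refine induction (p := fun x => char (boxtimes G G' (x ⊗ₜ y)) g = char x g.1 * char y g.2)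
    ?_ (fun A => ?_) (fun x h => ?_) (fun x x' h h' => ?_) x
  · simp
  · refine induction (p := fun y => char (boxtimes G G' (mk A ⊗ₜ y)) g =
      char (mk A) g.1 * char y g.2) ?_ (fun B => ?_) (fun x h => ?_) (fun x x' h h' => ?_) y
    · simp
    · rw [boxtimes_mk, char_mk, char_mk, char_mk]
      exact LinearMap.trace_tensorProduct' (A.ρ g.1) (B.ρ g.2)
    · simp [TensorProduct.tmul_neg, h]
    · simp [TensorProduct.tmul_add, h, h', mul_add]
  · simp [TensorProduct.neg_tmul, h]
  · simp [TensorProduct.add_tmul, h, h', add_mul]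

/-- The inner product of characters. -/
def charPair [Finite G] (x y : K0 G) : ℂ :=
  letI := Fintype.ofFinite G
  (Nat.card G : ℂ)⁻¹ * ∑ g : G, char x g * char y g⁻¹

theorem charPair_boxtimes [Finite G] [Finite G'] (x y : K0 G) (x' y' : K0 G') :
    charPair (boxtimes G G' (x ⊗ₜ x')) (boxtimes G G' (y ⊗ₜ y')) =
      charPair x y * charPair x' y' := by
  let := Fintype.ofFinite G
  let := Fintype.ofFinite G'
  simp only [charPair, char_boxtimes, Nat.card_prod]
  have : ∀ (i j : Fintype (G × G')) (F : G × G' → ℂ), @Finset.sum _ _ _ (@Finset.univ _ i) F =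
    @Finset.sum _ _ _ (@Finset.univ _ j) F := by
    intro i j F; congr; exact Subsingleton.elim _ _
  rw [this _ inferInstance, Fintype.sum_prod_type, mul_mul_mul_comm, Finset.sum_mul_sum,
    Nat.cast_mul, mul_inv]
  congr 1
  refine Finset.sum_congr rfl fun i _ => Finset.sum_congr rfl fun j _ => ?_
  simp only [Prod.fst_inv, Prod.snd_inv]
  ring

/-- The pairing of characters as a bilinear map. -/
def charForm [Finite G] : K0 G →ₗ[ℤ] K0 G →ₗ[ℤ] ℂ :=
  LinearMap.mk₂ ℤ charPair
    (fun x x' y => by simp [charPair, add_mul, Finset.sum_add_distrib, mul_add])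
    (fun c x y => by
      simp only [charPair, map_smul, Pi.smul_apply, zsmul_eq_mul, Finset.mul_sum]
      refine Finset.sum_congr rfl fun i _ => by ring)
    (fun x x' y => by simp [charPair, mul_add, Finset.sum_add_distrib])
    (fun c x y => by
      simp only [charPair, map_smul, Pi.smul_apply, zsmul_eq_mul, Finset.mul_sum]
      refine Finset.sum_congr rfl fun i _ => by ring)

theorem charForm_apply [Finite G] (x y : K0 G) : charForm x y = charPair x y := rfl

theorem mk_eq_zero {Z : FinRep G} [Subsingleton Z.V] : mk Z = 0 := by
  have h := mk_eq_add (A := Z) (B := Z) (C := Z) (f := 0) (g := 0)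
    ⟨Function.injective_of_subsingleton _,
      fun b => ⟨fun _ => ⟨b, Subsingleton.elim _ _⟩, fun _ => Subsingleton.elim _ _⟩,
      fun b => ⟨b, Subsingleton.elim _ _⟩⟩
  simpa using h

theorem mk_eq_of_equiv {A B : FinRep G} (e : A.ρ.Equiv B.ρ) : mk A = mk B := by
  let Z : FinRep G := ⟨PUnit.{u + 1}, Representation.trivial ℂ G PUnit.{u + 1}⟩
  have : Subsingleton Z.V := inferInstanceAs (Subsingleton PUnit)
  have h := mk_eq_add (A := A) (B := B) (C := Z) (f := e.toIntertwiningMap) (g := 0)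
    ⟨e.toLinearEquiv.injective,
      fun b => ⟨fun _ => e.toLinearEquiv.surjective b, fun _ => Subsingleton.elim _ _⟩,
      fun b => ⟨0, Subsingleton.elim _ _⟩⟩
  rw [h, mk_eq_zero (Z := Z), add_zero]

/-- The classes of the irreducible representations. -/
def Irr (G : Type u) [Group G] : Type (u + 1) :=
  {x : K0 G // ∃ A : FinRep G, A.ρ.IsIrreducible ∧ mk A = x}

open scoped Classical in
theorem charPair_irr [Finite G] (x y : Irr G) :
    charPair x.1 y.1 = if x = y then 1 else 0 := by
  let := Fintype.ofFinite G
  let : Invertible (Nat.card G : ℂ) := invertibleOfNonzero (by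
    rw [Nat.cast_ne_zero]; exact Nat.card_pos.ne')
  obtain ⟨_, A, hA, rfl⟩ := x
  obtain ⟨_, B, hB, rfl⟩ := y
  have key : ∀ (A B : FinRep G) (_ : A.ρ.IsIrreducible) (_ : B.ρ.IsIrreducible),
      charPair (mk A) (mk B) = if Nonempty (B.ρ.Equiv A.ρ) then 1 else 0 := by
    intro A B hA hB
    simp only [charPair, char_mk]
    exact Representation.char_orthonormal A.ρ B.ρ
  split_ifs with h
  · have h' : mk A = mk B := congrArg Subtype.val h
    simp only [h']
    rw [key B B hB hB, if_pos ⟨Representation.Equiv.refl _⟩]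
  · simp only [key A B hA hB]
    rw [if_neg]
    rintro ⟨e⟩
    exact h (Subtype.ext (mk_eq_of_equiv e).symm)

theorem linearIndependent_irr [Finite G] :
    LinearIndependent ℤ (fun x : Irr G => x.1) := by
  classical
  rw [linearIndependent_iff]
  intro l hl
  ext j
  have h := congrArg (fun z => charForm z j.1) hl
  simp only [Finsupp.linearCombination_apply, Finsupp.sum, map_sum, LinearMap.sum_apply,
    map_smul, LinearMap.smul_apply, charForm_apply, charPair_irr, map_zero,
    LinearMap.zero_apply] at h
  rw [Finset.sum_eq_single j (fun i _ hi => by simp [hi])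
    (fun hj => by simp [Finsupp.notMem_support_iff.1 hj])] at h
  simpa using h

theorem span_irr [Finite G] : ⊤ ≤ Submodule.span ℤ (Set.range fun x : Irr G => x.1) := by
  have key : ∀ (n : ℕ) (A : FinRep G), finrank ℂ A.V = n →
      mk A ∈ Submodule.span ℤ (Set.range fun x : Irr G => x.1) := by
    intro n
    induction n using Nat.strong_induction_on with
    | _ n ih =>
    intro A hn
    by_cases hA : A.ρ.IsIrreducible
    · exact Submodule.subset_span ⟨⟨mk A, A, hA, rfl⟩, rfl⟩
    by_cases h0 : Subsingleton A.V
    · rw [mk_eq_zero]; exact Submodule.zero_mem _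
    rw [not_subsingleton_iff_nontrivial] at h0
    have hnt : Nontrivial (Subrepresentation A.ρ) := ⟨⊥, ⊤, fun h => bot_ne_top
      (α := Submodule ℂ A.V) (congrArg Subrepresentation.toSubmodule h)⟩
    obtain ⟨S, hS⟩ : ∃ S : Subrepresentation A.ρ, S ≠ ⊥ ∧ S ≠ ⊤ := by
      by_contra! hc
      exact hA ⟨fun S => or_iff_not_imp_left.2 (hc S)⟩
    have hS1 : S.toSubmodule ≠ ⊥ := fun h => hS.1 (Subrepresentation.toSubmodule_injective h)
    have hS2 : S.toSubmodule ≠ ⊤ := fun h => hS.2 (Subrepresentation.toSubmodule_injective h)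
    let B : FinRep G := ⟨S.toSubmodule, S.toRepresentation⟩
    let C : FinRep G := ⟨A.V ⧸ S.toSubmodule, A.ρ.quotient S.toSubmodule S.apply_mem_toSubmodule⟩
    have hex : mk A = mk B + mk C := mk_eq_add
      (f := (⟨S.toSubmodule.subtype, fun g => rfl⟩ : B.ρ.IntertwiningMap A.ρ))
      (g := (⟨S.toSubmodule.mkQ, fun g => rfl⟩ : A.ρ.IntertwiningMap C.ρ))
      ⟨S.toSubmodule.injective_subtype, LinearMap.exact_subtype_mkQ _, S.toSubmodule.mkQ_surjective⟩
    have hd := S.toSubmodule.finrank_quotient_add_finrank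
    have hd1 : 0 < finrank ℂ S.toSubmodule := Nat.pos_of_ne_zero fun h =>
      hS1 (Submodule.finrank_eq_zero.1 h)
    have hd2 : finrank ℂ S.toSubmodule < finrank ℂ A.V := Submodule.finrank_lt hS2
    rw [hex]
    exact Submodule.add_mem _ (ih (finrank ℂ S.toSubmodule) (by omega) B rfl)
      (ih (finrank ℂ (A.V ⧸ S.toSubmodule)) (by omega) C rfl)
  intro x _
  exact induction (Submodule.zero_mem _) (fun A => key _ A rfl) (fun x h => Submodule.neg_mem _ h)
    (fun x y h h' => Submodule.add_mem _ h h') x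

/-- The classes of the irreducible representations form a basis. -/
def basis (G : Type u) [Group G] [Finite G] : Basis (Irr G) ℤ (K0 G) :=
  Basis.mk linearIndependent_irr span_irr

@[simp]
theorem basis_apply [Finite G] (x : Irr G) : basis G x = x.1 := Basis.mk_apply _ _ x

theorem charForm_basis_left [Finite G] (x : Irr G) (y : K0 G) :
    charForm x.1 y = ((basis G).repr y x : ℂ) := by
  classical
  conv_lhs => rw [← (basis G).linearCombination_repr y]
  simp only [Finsupp.linearCombination_apply, Finsupp.sum, map_sum, map_smul, basis_apply,
    charForm_apply, charPair_irr]
  rw [Finset.sum_eq_single x (fun i _ hi => by simp [Ne.symm hi])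
    (fun hj => by simp [Finsupp.notMem_support_iff.1 hj])]
  simp

theorem charForm_self [Finite G] (y : K0 G) :
    charForm y y = ((∑ i ∈ ((basis G).repr y).support, (basis G).repr y i ^ 2 : ℤ) : ℂ) := by
  have h : y = ∑ i ∈ ((basis G).repr y).support, (basis G).repr y i • i.1 := by
    conv_lhs => rw [← (basis G).linearCombination_repr y]
    simp [Finsupp.linearCombination_apply, Finsupp.sum]
  have h2 : charForm y y =
      charForm (∑ i ∈ ((basis G).repr y).support, (basis G).repr y i • i.1) y := by rw [← h]
  rw [h2]
  simp only [map_sum, map_smul, LinearMap.sum_apply, LinearMap.smul_apply, charForm_basis_left]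
  push_cast
  simp [sq]

/-- The regular representation. -/
def regular (G : Type u) [Group G] [Finite G] : FinRep G :=
  ⟨G → ℂ, {
    toFun := fun x => LinearMap.funLeft ℂ ℂ fun g => x⁻¹ * g
    map_one' := by ext; simp [LinearMap.funLeft]
    map_mul' := fun x y => by ext; simp [LinearMap.funLeft, mul_assoc] }⟩

theorem char_regular [Finite G] (x : G) (hx : x ≠ 1) : char (mk (regular G)) x = 0 := by
  classical
  let := Fintype.ofFinite G
  rw [char_mk]
  change LinearMap.trace ℂ (G → ℂ) (LinearMap.funLeft ℂ ℂ fun g => x⁻¹ * g) = 0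
  rw [LinearMap.trace_eq_matrix_trace ℂ (Pi.basisFun ℂ G), Matrix.trace]
  refine Finset.sum_eq_zero fun g _ => ?_
  simp [LinearMap.funLeft, hx]

theorem charForm_regular_ne_zero [Finite G] [Finite G'] (x : Irr (G × G')) :
    charForm x.1 (boxtimes G G' (mk (regular G) ⊗ₜ mk (regular G'))) ≠ 0 := by
  classical
  obtain ⟨_, A, hA, rfl⟩ := x
  rw [charForm_apply, charPair]
  refine mul_ne_zero (inv_ne_zero (Nat.cast_ne_zero.2 Nat.card_pos.ne')) ?_
  rw [Finset.sum_eq_single 1]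
  · have hr : ∀ (G : Type u) [Group G] [Finite G], char (mk (regular G)) 1 ≠ 0 := by
      intro G _ _
      let := Fintype.ofFinite G
      rw [char_mk, Representation.char_one, Nat.cast_ne_zero]
      change finrank ℂ (G → ℂ) ≠ 0
      rw [finrank_fintype_fun_eq_card]
      exact Fintype.card_ne_zero
    rw [inv_one, char_boxtimes, Prod.fst_one, Prod.snd_one]
    refine mul_ne_zero ?_ (mul_ne_zero (hr G) (hr G'))
    rw [char_mk, Representation.char_one, Nat.cast_ne_zero]
    intro h0
    have : Subsingleton A.V := finrank_zero_iff.1 h0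
    exact bot_ne_top (α := Subrepresentation A.ρ)
      (Subrepresentation.toSubmodule_injective (Subsingleton.elim _ _))
  · intro g _ hg
    rw [char_boxtimes]
    by_cases h1 : g.1 = 1
    · have h2 : g⁻¹.2 ≠ 1 := fun h => hg (Prod.ext h1 (by simpa using h))
      rw [char_regular _ h2, mul_zero, mul_zero]
    · have h2 : g⁻¹.1 ≠ 1 := by simpa using h1
      rw [char_regular _ h2, zero_mul, mul_zero]
  · intro h; exact absurd (@Finset.mem_univ _ (_) _) h

theorem boxtimes_bijective [Finite G] [Finite G'] : Function.Bijective (boxtimes G G') := by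
  classical
  let b := (basis G).tensorProduct (basis G')
  have hb : ∀ i j, charForm (boxtimes G G' (b i)) (boxtimes G G' (b j)) = if i = j then 1 else 0 := by
    rintro ⟨i, i'⟩ ⟨j, j'⟩
    simp only [b, Basis.tensorProduct_apply, basis_apply, charForm_apply, charPair_boxtimes,
      charPair_irr, Prod.mk.injEq]
    split_ifs <;> simp_all
  constructor
  · rw [injective_iff_map_eq_zero]
    intro z hz
    refine b.ext_elem_iff.2 fun j => ?_
    have h : (charForm.flip (boxtimes G G' (b j))) ∘ₗ boxtimes G G' =
        (Algebra.linearMap ℤ ℂ) ∘ₗ b.coord j := b.ext fun i => by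
      rw [LinearMap.comp_apply, LinearMap.flip_apply, hb]
      simp [Finsupp.single_apply, apply_ite]
    have h2 := LinearMap.congr_fun h z
    rw [LinearMap.comp_apply, hz, map_zero] at h2
    simpa using h2.symm
  · rw [← LinearMap.range_eq_top, eq_top_iff]
    refine span_irr.trans (Submodule.span_le.2 ?_)
    rintro _ ⟨x, rfl⟩
    obtain ⟨j, hj⟩ : ∃ j, charForm x.1 (boxtimes G G' (b j)) ≠ 0 := by
      by_contra! hc
      refine charForm_regular_ne_zero x ?_
      have : (charForm x.1) ∘ₗ (boxtimes G G') = 0 := b.ext fun j => hc j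
      exact LinearMap.congr_fun this _
    set y := boxtimes G G' (b j) with hy
    have h1 : charForm y y = 1 := by rw [hy, hb, if_pos rfl]
    rw [charForm_self] at h1
    have h1' : ∑ i ∈ ((basis (G × G')).repr y).support, (basis (G × G')).repr y i ^ 2 = 1 := by
      exact_mod_cast h1
    rw [charForm_basis_left] at hj
    have hj' : (basis (G × G')).repr y x ≠ 0 := by exact_mod_cast hj
    have hx : x ∈ ((basis (G × G')).repr y).support := Finsupp.mem_support_iff.2 hj'
    have hle : ((basis (G × G')).repr y x) ^ 2 ≤ 1 := h1' ▸ Finset.single_le_sum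
      (f := fun i => (basis (G × G')).repr y i ^ 2) (fun i _ => sq_nonneg _) hx
    have hx1 : ((basis (G × G')).repr y x) ^ 2 = 1 :=
      le_antisymm hle (by have := sq_pos_of_ne_zero hj'; omega)
    have hoth : ∀ i, i ≠ x → (basis (G × G')).repr y i = 0 := by
      intro i hi
      by_contra hne
      rw [← Finset.add_sum_erase _ _ hx, hx1] at h1'
      have h3 : ∑ i ∈ ((basis (G × G')).repr y).support.erase x,
        (basis (G × G')).repr y i ^ 2 = 0 := by omega
      have := (Finset.sum_eq_zero_iff_of_nonneg (fun i _ => sq_nonneg _)).1 h3 i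
        (Finset.mem_erase.2 ⟨hi, Finsupp.mem_support_iff.2 hne⟩)
      exact hne (pow_eq_zero_iff two_ne_zero |>.1 this)
    have hyx : y = (basis (G × G')).repr y x • x.1 := by
      conv_lhs => rw [← (basis (G × G')).linearCombination_repr y]
      rw [Finsupp.linearCombination_apply, Finsupp.sum,
        Finset.sum_eq_single x (fun i _ hi => by simp [hoth i hi]) (fun h => absurd hx h)]
      simp
    refine ⟨(basis (G × G')).repr y x • b j, ?_⟩
    rw [map_smul, ← hy]
    generalize (basis (G × G')).repr y x = c at hyx hx1
    rw [hyx, smul_smul, ← sq, hx1, one_smul]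

/-- The identification `K₀(G) ⊗ K₀(G') = K₀(G × G')` by external tensor products. -/
def boxtimesEquiv (G G' : Type u) [Group G] [Group G'] [Finite G] [Finite G'] :
    K0 G ⊗[ℤ] K0 G' ≃ₗ[ℤ] K0 (G × G') :=
  LinearEquiv.ofBijective (boxtimes G G') boxtimes_bijective

end K0

/-! ### Trivialized groups -/

/-- The tensor products of the members of two bases form a basis. -/
def tensorBasis {A M N ι κ : Type*} [CommRing A] [AddCommGroup M] [Module A M] [AddCommGroup N]
    [Module A N] (b : Module.Basis ι A M) (c : Module.Basis κ A N) :
    Module.Basis (ι × κ) A (M ⊗[A] N) := b.tensorProduct c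

@[simp]
theorem tensorBasis_apply {A M N ι κ : Type*} [CommRing A] [AddCommGroup M] [Module A M]
    [AddCommGroup N] [Module A N] (b : Module.Basis ι A M) (c : Module.Basis κ A N) (i : ι × κ) :
    tensorBasis b c i = b i.1 ⊗ₜ c i.2 := b.tensorProduct_apply' c i

/-- A T-group: a free abelian group with a specified `ℤ`-basis, whose members are called the
irreducible elements. -/
class TGroup (M : Type u) [AddCommGroup M] [Module ℤ M] where
  Irr : Type u
  basis : Module.Basis Irr ℤ M

/-- A T-group with a family of subgroups `M_n`, the homogeneous components. That they form a
grading with homogeneous irreducible elements is `IsGradedTGroup`. -/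
class GradedTGroup (M : Type u) [AddCommGroup M] [Module ℤ M] extends TGroup M where
  grade : ℕ → Submodule ℤ M

namespace TGroup

section

variable {M : Type u} [AddCommGroup M] [Module ℤ M] [TGroup M]
variable {N : Type v} [AddCommGroup N] [Module ℤ N] [TGroup N]

/-- The bilinear form for which the irreducible elements are orthonormal. -/
def form : M →ₗ[ℤ] M →ₗ[ℤ] ℤ := (basis (M := M)).constr ℤ fun i => (basis (M := M)).coord i

variable (M) in
theorem form_basis [DecidableEq (Irr M)] (i j : Irr M) :
    form (basis (M := M) i) (basis j) = if i = j then 1 else 0 := by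
  simp [form, Finsupp.single_apply, eq_comm]

/-- `x` is positive: `⟨x, ω⟩ ≥ 0` for every irreducible `ω`. -/
def IsPositive (x : M) : Prop := ∀ ω : Irr M, 0 ≤ form x (basis ω)

/-- Positive maps send positive elements to positive elements. -/
def IsPositiveMap (f : M →ₗ[ℤ] N) : Prop := ∀ x, IsPositive x → IsPositive (f x)

/-- `⟨f m, n⟩ = ⟨m, g n⟩`. -/
def IsAdjoint (f : M →ₗ[ℤ] N) (g : N →ₗ[ℤ] M) : Prop := ∀ m n, form (f m) n = form m (g n)

end

section

variable {M : Type u} [AddCommGroup M] [Module ℤ M] [GradedTGroup M]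
variable {N : Type v} [AddCommGroup N] [Module ℤ N] [GradedTGroup N]

/-- Degree-preserving maps. -/
def IsGradedMap (f : M →ₗ[ℤ] N) : Prop :=
  ∀ n, ∀ x ∈ GradedTGroup.grade (M := M) n, f x ∈ GradedTGroup.grade (M := N) n

variable (M) in
/-- `M` is the direct sum of its homogeneous components, and irreducible elements are
homogeneous. -/
def IsGradedTGroup : Prop :=
  DirectSum.IsInternal (GradedTGroup.grade (M := M)) ∧
    ∀ ω : Irr M, ∃ n, basis ω ∈ GradedTGroup.grade (M := M) n

/-- The irreducible elements of `M ⊗ N` are the tensor products of irreducible elements, and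
`(M ⊗ N)_n = ⨁_{k + l = n} M_k ⊗ N_l`. -/
instance : GradedTGroup (M ⊗[ℤ] N) where
  Irr := Irr M × Irr N
  basis := tensorBasis basis basis
  grade n := ⨆ p ∈ Finset.HasAntidiagonal.antidiagonal n, Submodule.map₂ (TensorProduct.mk ℤ M N)
    (GradedTGroup.grade p.1) (GradedTGroup.grade p.2)

/-- `ℤ` has the irreducible element `1` and is concentrated in degree `0`. -/
instance : GradedTGroup ℤ where
  Irr := Unit
  basis := Module.Basis.singleton Unit ℤ
  grade n := if n = 0 then ⊤ else ⊥

end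

end TGroup

/-! ### Hopf algebras, PSH-algebras and their modules -/

section Hopf

variable {A : Type*} [CommRing A] {H : Type u} [AddCommGroup H] [Module A H]
  {M : Type v} [AddCommGroup M] [Module A M]

open TensorProduct (map lid rid assoc tensorTensorTensorComm)

/-- The axioms of a Hopf algebra with multiplication `μ`, comultiplication `μ'`, unit `e`,
counit `e'` and antipode `T`. -/
structure IsHopfAlgebra (μ : H ⊗[A] H →ₗ[A] H) (μ' : H →ₗ[A] H ⊗[A] H) (e : A →ₗ[A] H)
    (e' : H →ₗ[A] A) (T : H →ₗ[A] H) : Prop where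
  mul_assoc : μ ∘ₗ map μ .id = μ ∘ₗ map .id μ ∘ₗ (assoc A H H H).toLinearMap
  one_mul : μ ∘ₗ map e .id = (lid A H).toLinearMap
  mul_one : μ ∘ₗ map .id e = (rid A H).toLinearMap
  coassoc : (assoc A H H H).toLinearMap ∘ₗ map μ' .id ∘ₗ μ' = map .id μ' ∘ₗ μ'
  counit_comul : (lid A H).toLinearMap ∘ₗ map e' .id ∘ₗ μ' = .id
  comul_counit : (rid A H).toLinearMap ∘ₗ map .id e' ∘ₗ μ' = .id
  comul_mul : μ' ∘ₗ μ =
    map μ μ ∘ₗ (tensorTensorTensorComm A H H H H).toLinearMap ∘ₗ map μ' μ'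
  comul_one : μ' (e 1) = e 1 ⊗ₜ e 1
  counit_mul : e' ∘ₗ μ = (lid A A).toLinearMap ∘ₗ map e' e'
  counit_one : e' (e 1) = 1
  antipode_left : μ ∘ₗ map T .id ∘ₗ μ' = e ∘ₗ e'
  antipode_right : μ ∘ₗ map .id T ∘ₗ μ' = e ∘ₗ e'

/-- The Hopf power map `Ψ^k = μ^(k) ∘ μ'^(k)`, the composite of iterated comultiplication
`H → H^{⊗ k}` and iterated multiplication `H^{⊗ k} → H`, with `Ψ^0 = e ∘ e'`. Iterations are
bracketed to the left: `μ^(k+1) = μ ∘ (μ^(k) ⊗ 1)` and `μ'^(k+1) = (μ'^(k) ⊗ 1) ∘ μ'`. -/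
def hopfPower (μ : H ⊗[A] H →ₗ[A] H) (μ' : H →ₗ[A] H ⊗[A] H) (e : A →ₗ[A] H)
    (e' : H →ₗ[A] A) : ℕ → (H →ₗ[A] H)
  | 0 => e ∘ₗ e'
  | 1 => .id
  | k + 2 => μ ∘ₗ map (hopfPower μ μ' e e' (k + 1)) .id ∘ₗ μ'

/-- A Hopf module with action `α` and coaction `α'`. -/
structure IsHopfModule (μ : H ⊗[A] H →ₗ[A] H) (μ' : H →ₗ[A] H ⊗[A] H) (e : A →ₗ[A] H)
    (e' : H →ₗ[A] A) (α : H ⊗[A] M →ₗ[A] M) (α' : M →ₗ[A] H ⊗[A] M) : Prop where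
  assoc : α ∘ₗ map μ .id = α ∘ₗ map .id α ∘ₗ (assoc A H H M).toLinearMap
  coassoc : (TensorProduct.assoc A H H M).toLinearMap ∘ₗ map μ' .id ∘ₗ α' = map .id α' ∘ₗ α'
  unit : α ∘ₗ map e .id = (lid A M).toLinearMap
  counit : (lid A M).toLinearMap ∘ₗ map e' .id ∘ₗ α' = .id

/-- A `k`-Hopf module: `α' ∘ α = (μ ⊗ α) ∘ (Ψ^k ⊗ τ ⊗ 1) ∘ (μ' ⊗ α')`, where `τ` is the
transposition. Here `tensorTensorTensorComm` is `1 ⊗ τ ⊗ 1`. -/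
structure IsKHopfModule (k : ℕ) (μ : H ⊗[A] H →ₗ[A] H) (μ' : H →ₗ[A] H ⊗[A] H) (e : A →ₗ[A] H)
    (e' : H →ₗ[A] A) (α : H ⊗[A] M →ₗ[A] M) (α' : M →ₗ[A] H ⊗[A] M) : Prop
    extends IsHopfModule μ μ' e e' α α' where
  coact_act : α' ∘ₗ α = map μ α ∘ₗ map (map (hopfPower μ μ' e e' k) .id) .id ∘ₗ
    (tensorTensorTensorComm A H H H M).toLinearMap ∘ₗ map μ' α'

end Hopf

section PSH

open TGroup

variable {H : Type u} [AddCommGroup H] [Module ℤ H] [GradedTGroup H]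
  {M : Type v} [AddCommGroup M] [Module ℤ M] [GradedTGroup M]

/-- A positive self-adjoint Hopf algebra. -/
structure IsPSHAlgebra (μ : H ⊗[ℤ] H →ₗ[ℤ] H) (μ' : H →ₗ[ℤ] H ⊗[ℤ] H) (e : ℤ →ₗ[ℤ] H)
    (e' : H →ₗ[ℤ] ℤ) : Prop where
  hopf : ∃ T : H →ₗ[ℤ] H, IsHopfAlgebra μ μ' e e' T ∧ IsGradedMap T
  graded : IsGradedTGroup H
  graded_mul : IsGradedMap μ
  graded_comul : IsGradedMap μ'
  graded_unit : IsGradedMap e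
  graded_counit : IsGradedMap e'
  /-- Connectedness: `e` and `e'` are mutually inverse between `ℤ` and `H_0`. -/
  connected : (∀ a, e' (e a) = a) ∧ ∀ x ∈ GradedTGroup.grade (M := H) 0, e (e' x) = x
  positive_mul : IsPositiveMap μ
  positive_comul : IsPositiveMap μ'
  positive_unit : IsPositiveMap e
  positive_counit : IsPositiveMap e'
  adjoint_mul : IsAdjoint μ μ'
  adjoint_unit : IsAdjoint e e'

/-- A `k`-PSH module over a PSH-algebra: a graded, positive, self-adjoint `k`-Hopf module. -/
structure IsPSHModule (k : ℕ) (μ : H ⊗[ℤ] H →ₗ[ℤ] H) (μ' : H →ₗ[ℤ] H ⊗[ℤ] H) (e : ℤ →ₗ[ℤ] H)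
    (e' : H →ₗ[ℤ] ℤ) (α : H ⊗[ℤ] M →ₗ[ℤ] M) (α' : M →ₗ[ℤ] H ⊗[ℤ] M) : Prop where
  pshAlgebra : IsPSHAlgebra μ μ' e e'
  kHopf : IsKHopfModule k μ μ' e e' α α'
  graded : IsGradedTGroup M
  graded_act : IsGradedMap α
  graded_coact : IsGradedMap α'
  positive_act : IsPositiveMap α
  positive_coact : IsPositiveMap α'
  adjoint : IsAdjoint α α'

end PSH

/-! ### Wreath products -/

section Wreath

variable {H : Type u} [Group H] {G : Type u} [Group G]

/-- The action of `S_n` on `G^n` by permutation of the indices. -/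
def permAct (n : ℕ) (G : Type u) [Group G] : Equiv.Perm (Fin n) →* MulAut (Fin n → G) where
  toFun σ :=
    { toFun := fun f i => f (σ⁻¹ i)
      invFun := fun f i => f (σ i)
      left_inv := fun f => by simp
      right_inv := fun f => by simp
      map_mul' := fun f g => rfl }
  map_one' := rfl
  map_mul' σ τ := by ext f i; simp

/-- The wreath product `S_n[G] = S_n ⋉ G^n`. -/
abbrev Wreath (n : ℕ) (G : Type u) [Group G] : Type u :=
  (Fin n → G) ⋊[permAct n G] Equiv.Perm (Fin n)

instance [Finite G] (n : ℕ) : Finite (Wreath n G) :=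
  Finite.of_equiv _ (SemidirectProduct.equivProd (φ := permAct n G)).symm

/-- The decomposition of `{0, …, n - 1}` into its first `k` and its last `l` elements. -/
def splitEquiv {k l n : ℕ} (h : k + l = n) : Fin k ⊕ Fin l ≃ Fin n :=
  finSumFinEquiv.trans (finCongr h)

/-- The block diagonal homomorphism `S_k[H] × S_l[G] → S_n[G]`, for `k + l = n` and a homomorphism
`ι : H → G`, which for injective `ι` identifies `S_k[H] × S_l[G]` with a subgroup of `S_n[G]`. -/
def blockHom (ι : H →* G) {k l n : ℕ} (h : k + l = n) :
    Wreath k H × Wreath l G →* Wreath n G where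
  toFun x := ⟨fun i => Sum.elim (fun a => ι (x.1.left a)) x.2.left ((splitEquiv h).symm i),
    (splitEquiv h).permCongr (Equiv.Perm.sumCongr x.1.right x.2.right)⟩
  map_one' := by
    ext i
    · rcases hi : (splitEquiv h).symm i with a | a <;> simp [hi]
    · simp
  map_mul' x y := by
    refine SemidirectProduct.ext (funext fun i => ?_) (Equiv.ext fun i => ?_)
    · change _ = Sum.elim (fun a => ι (x.1.left a)) x.2.left ((splitEquiv h).symm i) *
        Sum.elim (fun a => ι (y.1.left a)) y.2.left ((splitEquiv h).symm
          (splitEquiv h ((Equiv.Perm.sumCongr x.1.right x.2.right).symm ((splitEquiv h).symm i))))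
      rcases hi : (splitEquiv h).symm i with a | a <;> simp [hi, permAct, Equiv.Perm.inv_def]
    · rcases hi : (splitEquiv h).symm i with a | a <;> simp [hi]

end Wreath

/-! ### The algebra `R(G)` -/

/-- `R(G) = ⨁_n K₀(S_n[G])`. As `S_0[G]` is the trivial group, its degree `0` component is `ℤ`,
by the dimension. -/
abbrev R (G : Type u) [Group G] : Type (u + 1) := ⨁ n : ℕ, K0 (Wreath n G)

namespace R

variable {H : Type u} [Group H] {G : Type u} [Group G]

variable (G) in
/-- The irreducible elements of `R(G)` are the classes of the irreducible representations of the
groups `S_n[G]`. -/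
instance [Finite G] : GradedTGroup (R G) where
  Irr := Σ n, K0.Irr (Wreath n G)
  basis := DFinsupp.basis fun n => K0.basis (Wreath n G)
  grade n := LinearMap.range (DirectSum.lof ℤ ℕ (fun n => K0 (Wreath n G)) n)

/-- `1 ∈ ℤ` goes to the class of the trivial representation of `S_0[G]`. -/
def unit (G : Type u) [Group G] : ℤ →ₗ[ℤ] R G :=
  LinearMap.toSpanSingleton ℤ _ (DirectSum.lof ℤ ℕ (fun n => K0 (Wreath n G)) 0
    (K0.mk ⟨ULift.{u} ℂ, Representation.trivial ℂ _ _⟩))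

/-- The projection to degree `0`, followed by the dimension. -/
def counit (G : Type u) [Group G] : R G →ₗ[ℤ] ℤ :=
  K0.dim ∘ₗ DirectSum.component ℤ ℕ (fun n => K0 (Wreath n G)) 0

variable [Finite H] [Finite G]

/-- `π ⊗ σ ↦ Ind (π ⊗ σ)`, from `S_k[H] × S_l[G]` to `S_{k+l}[G]`. -/
def act (ι : H →* G) : R H ⊗[ℤ] R G →ₗ[ℤ] R G :=
  TensorProduct.lift (DirectSum.toModule ℤ ℕ (R G →ₗ[ℤ] R G) fun k =>
    LinearMap.flip (DirectSum.toModule ℤ ℕ (K0 (Wreath k H) →ₗ[ℤ] R G) fun l =>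
      LinearMap.flip (TensorProduct.curry
        (DirectSum.lof ℤ ℕ (fun n => K0 (Wreath n G)) (k + l) ∘ₗ
          K0.ind (blockHom ι (rfl : k + l = k + l)) ∘ₗ
          K0.boxtimes (Wreath k H) (Wreath l G)))))

/-- `∑_{k + l = n} Res`, from `S_n[G]` to `S_k[H] × S_l[G]`, in degree `n`. -/
def coact (ι : H →* G) : R G →ₗ[ℤ] R H ⊗[ℤ] R G :=
  DirectSum.toModule ℤ ℕ _ fun n => ∑ p ∈ (Finset.HasAntidiagonal.antidiagonal n).attach,
    TensorProduct.map (DirectSum.lof ℤ ℕ (fun n => K0 (Wreath n H)) p.1.1)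
        (DirectSum.lof ℤ ℕ (fun n => K0 (Wreath n G)) p.1.2) ∘ₗ
      (K0.boxtimesEquiv (Wreath p.1.1 H) (Wreath p.1.2 G)).symm.toLinearMap ∘ₗ
      K0.res (blockHom ι (Finset.HasAntidiagonal.mem_antidiagonal.1 p.2))

/-- The multiplication of `R(G)`. -/
def mul (G : Type u) [Group G] [Finite G] : R G ⊗[ℤ] R G →ₗ[ℤ] R G := act (MonoidHom.id G)

/-- The comultiplication of `R(G)`. -/
def comul (G : Type u) [Group G] [Finite G] : R G →ₗ[ℤ] R G ⊗[ℤ] R G := coact (MonoidHom.id G)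

end R

end

/-! An element of `R G` is determined by its character values, and these are best indexed by pairs
(σ, a) with σ a permutation of an arbitrary finite set X and a : X → G. The functional `ev σ a`
depends neither on a numbering of X nor on the choice of a within its class under conjugation by
G^X. In these terms restriction to S_k[H] × S_l[G] is evaluation on a disjoint union
(`mulMap_ev_coact`), and the Frobenius formula turns an induction product into a sum over the
σ-invariant subsets of X, with an induced character `evInd` on the subset and a plain value on its
complement (`ev_comp_act`).

Consequently Ψ^k multiplies `ev σ a` by the number of σ-invariant functions X → Fin k, that is by
k^c if σ has c cycles (`ev_comp_hopfPower`). Now evaluate both sides of the formula for α* ∘ α at a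
pair (σ, a) over H and a pair (τ, b) over G. Invariant subsets of X ⊔ Y are pairs of invariant
subsets, so both sides are sums over the same pairs (`coact_act_of_evInd`), and all reduces to
`evInd_sumElim`: in a character induced from H, a block whose entries already lie in H contributes
its plain value times [G:H]^c. Indeed a conjugator b brings a back into H exactly when its cosets
are constant on cycles, by normality, which leaves [G:H]^c |H|^|X| conjugators
(`card_gaugeConj_eq`); the hypothesis on inner automorphisms makes the result conjugate to a already
over H (`exists_gaugeConj_eq`), so the character value does not change. The case H = G gives the
compatibility of multiplication and comultiplication.

Adjointness is Frobenius reciprocity (`isAdjoint_act`). Coassociativity, cocommutativity and the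
counit axiom are evident on disjoint unions; associativity, commutativity and the unit axioms follow
since adjoints are unique. The antipode is (-1)^n times the sign twist, with eigenvalue (-1)^c on
`ev σ a`; its axiom holds because toggling one cycle is a sign-reversing involution on invariant
subsets (`InvSet.sum_cycleSign`). -/

noncomputable section

/-! ### Traces on coinvariants and on group algebras -/

section Trace

open Representation

/-- Averaging over the group factors through the coinvariants and gives a section s of the quotient
map. The induced map is then mk ∘ τ ∘ s, and cyclicity of the trace moves mk to the right, where s ∘
mk is the averaging operator. -/
theorem Representation.trace_coinvariants_map {G V : Type*} [Group G] [Fintype G] [AddCommGroup V]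
    [Module ℂ V] [Module.Finite ℂ V] (ρ : Representation ℂ G V) (τ : IntertwiningMap ρ ρ) :
    LinearMap.trace ℂ _ (Coinvariants.map ρ ρ τ) =
      (Nat.card G : ℂ)⁻¹ * ∑ h, LinearMap.trace ℂ V (τ.toLinearMap ∘ₗ ρ h) := by
  have hc : (Nat.card G : ℂ) ≠ 0 := Nat.cast_ne_zero.2 Nat.card_pos.ne'
  let avg : V →ₗ[ℂ] V := (Nat.card G : ℂ)⁻¹ • ∑ h, ρ h
  have havg : ∀ x, avg ∘ₗ ρ x = avg := by
    intro x
    ext v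
    simp only [avg, LinearMap.comp_apply, LinearMap.smul_apply, LinearMap.sum_apply]
    congr 1
    exact Fintype.sum_equiv (Equiv.mulRight x) _ _ fun y => by simp
  let s : Coinvariants ρ →ₗ[ℂ] V := Coinvariants.lift ρ avg havg
  have h1 : Coinvariants.mk ρ ∘ₗ s = LinearMap.id := by
    refine Coinvariants.hom_ext (LinearMap.ext fun v => ?_)
    change Coinvariants.mk ρ (avg v) = Coinvariants.mk ρ v
    simp only [avg, LinearMap.smul_apply, LinearMap.sum_apply, map_smul, map_sum,
      Coinvariants.mk_self_apply]
    rw [Finset.sum_const, Finset.card_univ, ← Nat.card_eq_fintype_card, ← Nat.cast_smul_eq_nsmul ℂ,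
      smul_smul, inv_mul_cancel₀ hc, one_smul]
  have h2 : s ∘ₗ Coinvariants.mk ρ = avg := Coinvariants.lift_comp_mk ρ avg havg
  have h3 : Coinvariants.map ρ ρ τ = Coinvariants.mk ρ ∘ₗ (τ.toLinearMap ∘ₗ s) := by
    rw [← LinearMap.comp_id (Coinvariants.map ρ ρ τ), ← h1]; rfl
  rw [h3, LinearMap.trace_comp_comm', LinearMap.comp_assoc, h2]
  simp only [avg, LinearMap.comp_smul, map_smul, smul_eq_mul]
  congr 1
  rw [← map_sum (LinearMap.trace ℂ V)]
  congr 1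
  ext v
  simp

theorem MonoidAlgebra.trace_mapDomainLinearMap {G : Type*} [Fintype G] [DecidableEq G]
    (f : G → G) :
    LinearMap.trace ℂ _ (MonoidAlgebra.mapDomainLinearMap ℂ ℂ f) =
      ∑ x, if f x = x then (1 : ℂ) else 0 := by
  let b : Module.Basis G ℂ (MonoidAlgebra ℂ G) := .ofRepr (MonoidAlgebra.coeffLinearEquiv ℂ)
  rw [LinearMap.trace_eq_matrix_trace ℂ b, Matrix.trace]
  refine Finset.sum_congr rfl fun x _ => ?_
  rw [Matrix.diag_apply, LinearMap.toMatrix_apply]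
  simp [b, Finsupp.single_apply, Module.Basis.coe_ofRepr]

end Trace

/-! ### Characters of restricted and induced representations -/

namespace K0

variable {G : Type u} [Group G] {G' : Type u} [Group G']

theorem char_conj [Finite G] (x : K0 G) (g h : G) : char x (h * g * h⁻¹) = char x g := by
  refine induction (p := fun x => char x (h * g * h⁻¹) = char x g) (by simp) (fun A => ?_)
    (fun x hx => by simp [hx]) (fun x y hx hy => by simp [hx, hy]) x
  rw [char_mk]
  exact Representation.char_conj A.ρ g h

theorem char_res [Finite G] [Finite G'] (φ : G' →* G) (x : K0 G) (g : G') :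
    char (res φ x) g = char x (φ g) := by
  refine induction (p := fun x => char (res φ x) g = char x (φ g)) (by simp) (fun A => ?_)
    (fun x hx => by simp [hx]) (fun x y hx hy => by simp [hx, hy]) x
  rw [res, lift_mk, char_mk, char_mk]
  rfl

/-- The induced representation consists of the coinvariants of ℂ[G] ⊗ A, so its trace is an average
over h of traces on ℂ[G] ⊗ A. On ℂ[G] the operator in question permutes the basis by x ↦ φ(h) x g⁻¹,
whose fixed points are the x with φ(h) = x g x⁻¹. Injectivity of φ plays no role. -/
theorem char_mk_ind [Fintype G] [DecidableEq G] [Fintype G'] (φ : G' →* G) (A : FinRep G')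
    (g : G) : (A.ind φ).ρ.character g =
      (Nat.card G' : ℂ)⁻¹ * ∑ h, ∑ x, if φ h = x * g * x⁻¹ then A.ρ.character h else 0 := by
  have : Module.Finite ℂ (MonoidAlgebra ℂ G) :=
    Module.Finite.equiv (MonoidAlgebra.coeffLinearEquiv (S := ℂ) (M := G) ℂ).symm
  refine (Representation.trace_coinvariants_map _ _).trans ?_
  congr 1
  refine Finset.sum_congr rfl fun h _ => ?_
  have : (TensorProduct.map (MonoidAlgebra.mapDomainLinearMap ℂ ℂ fun x => φ h * x * g⁻¹)
      (A.ρ h)) = ((MonoidAlgebra.mapDomainLinearMap ℂ ℂ fun x => x * g⁻¹).rTensor A.V) ∘ₗ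
      (Representation.tprod ((Representation.leftRegular ℂ G).comp φ) A.ρ) h := by
    ext; simp
  refine (congrArg _ this.symm).trans ?_
  rw [LinearMap.trace_tensorProduct', MonoidAlgebra.trace_mapDomainLinearMap, Finset.sum_mul]
  refine Finset.sum_congr rfl fun x _ => ?_
  have : φ h * x * g⁻¹ = x ↔ φ h = x * g * x⁻¹ := by
    rw [mul_inv_eq_iff_eq_mul, eq_mul_inv_iff_mul_eq]
  simp [this, Representation.character]

theorem char_ind [Fintype G] [DecidableEq G] [Fintype G'] (φ : G' →* G) (x : K0 G') (g : G) :
    char (ind φ x) g =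
      (Nat.card G' : ℂ)⁻¹ * ∑ h, ∑ y, if φ h = y * g * y⁻¹ then char x h else 0 := by
  -- The case distinction is written as a 0-1 coefficient, so that linearity in x is visible.
  have h0 : ∀ x, (∑ h, ∑ y, if φ h = y * g * y⁻¹ then char x h else 0) =
    ∑ h, ∑ y, (if φ h = y * g * y⁻¹ then 1 else 0) * char x h := fun x =>
    Finset.sum_congr rfl fun h _ => Finset.sum_congr rfl fun y _ => by simp
  rw [h0]
  refine induction (p := fun x => char (ind φ x) g = (Nat.card G' : ℂ)⁻¹ *
    ∑ h, ∑ y, (if φ h = y * g * y⁻¹ then 1 else 0) * char x h) (by simp) (fun A => ?_)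
    (fun x hx => by simp [hx]) (fun x y hx hy => ?_) x
  · rw [ind, lift_mk, char_mk, char_mk, ← char_mk A, ← h0, char_mk]
    exact char_mk_ind φ A g
  · simp only [map_add, Pi.add_apply, hx, hy, mul_add, Finset.sum_add_distrib]

theorem charPair_eq_sum [Fintype G] (x y : K0 G) :
    charPair x y = (Nat.card G : ℂ)⁻¹ * ∑ g : G, char x g * char y g⁻¹ := by
  have h : Fintype.ofFinite G = ‹Fintype G› := Subsingleton.elim _ _
  change (Nat.card G : ℂ)⁻¹ * (@Finset.sum G ℂ _ (@Finset.univ G (Fintype.ofFinite G)) _) = _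
  rw [h]

/-- Frobenius reciprocity. -/
theorem charForm_ind [Finite G] [Finite G'] (φ : G' →* G) (x : K0 G') (y : K0 G) :
    charForm (ind φ x) y = charForm x (res φ y) := by
  classical
  let := Fintype.ofFinite G
  let := Fintype.ofFinite G'
  have hc : (Nat.card G : ℂ) ≠ 0 := Nat.cast_ne_zero.2 Nat.card_pos.ne'
  rw [charForm_apply, charForm_apply, charPair_eq_sum, charPair_eq_sum]
  simp only [char_ind, char_res, map_inv]
  -- For fixed h each z admits exactly one g, namely z⁻¹ φ(h) z, and the class function y takes the
  -- same value for all of them: the sum has |G| equal terms.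
  have h1 : ∀ h : G', (∑ g : G, ∑ z : G, (if φ h = z * g * z⁻¹ then char x h else 0) * char y g⁻¹)
      = Nat.card G * (char x h * char y (φ h)⁻¹) := by
    intro h
    rw [Finset.sum_comm]
    have : ∀ z : G, (∑ g : G, (if φ h = z * g * z⁻¹ then char x h else 0) * char y g⁻¹) =
        char x h * char y (φ h)⁻¹ := by
      intro z
      rw [Finset.sum_eq_single (z⁻¹ * φ h * z) (fun g _ hg => by
        rw [if_neg, zero_mul]; rintro h'; apply hg; rw [h']; group) (by simp)]
      rw [if_pos (by group)]
      congr 1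
      rw [← char_conj y (z⁻¹ * φ h * z)⁻¹ z]
      group
    rw [Finset.sum_congr rfl fun z _ => this z]
    simp [Nat.card_eq_fintype_card]
  calc _ = (Nat.card G : ℂ)⁻¹ * ((Nat.card G' : ℂ)⁻¹ * ∑ h : G', ∑ g : G, ∑ z : G,
        (if φ h = z * g * z⁻¹ then char x h else 0) * char y g⁻¹) := by
        refine congrArg _ ?_
        rw [Finset.sum_comm, Finset.mul_sum]
        refine Finset.sum_congr rfl fun g _ => ?_
        rw [mul_assoc, Finset.sum_mul]
        simp only [Finset.sum_mul]
    _ = _ := by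
        simp only [h1]
        rw [← Finset.mul_sum]
        field_simp

theorem charForm_comm [Finite G] (x y : K0 G) : charForm x y = charForm y x := by
  let := Fintype.ofFinite G
  rw [charForm_apply, charForm_apply, charPair_eq_sum, charPair_eq_sum]
  congr 1
  exact Fintype.sum_equiv (Equiv.inv G) _ _ fun g => by simp [mul_comm]

/-- The pairing of the classes of two representations is the dimension of a space of equivariant
maps. -/
theorem exists_charForm_mk_eq_natCast [Finite G] (A B : FinRep G) :
    ∃ n : ℕ, charForm (mk A) (mk B) = n := by
  let := Fintype.ofFinite G
  let : Invertible (Nat.card G : ℂ) := invertibleOfNonzero (by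
    rw [Nat.cast_ne_zero]; exact Nat.card_pos.ne')
  have h := Representation.card_inv_mul_sum_char_mul_char_eq_finrank B.ρ A.ρ
  refine ⟨_, Eq.trans ?_ h⟩
  rw [charForm_apply, charPair_eq_sum]
  simp only [char_mk]

/-- The coefficient at an irreducible class is the pairing with it, hence the dimension of a space
of equivariant maps. -/
theorem basis_repr_mk_nonneg [Finite G] (A : FinRep G) (i : Irr G) :
    0 ≤ (basis G).repr (mk A) i := by
  have h := charForm_basis_left i (mk A)
  obtain ⟨x, B, hB, rfl⟩ := i
  obtain ⟨n, hn⟩ := exists_charForm_mk_eq_natCast B A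
  rw [hn] at h
  have : (n : ℤ) = (basis G).repr (mk A) ⟨mk B, B, hB, rfl⟩ := by exact_mod_cast h
  omega

theorem char_one [Finite G] (x : K0 G) : char x 1 = dim x := by
  refine induction (p := fun x => char x 1 = dim x) (by simp) (fun A => ?_)
    (fun x hx => by simp [hx]) (fun x y hx hy => by simp [hx, hy]) x
  rw [char_mk, Representation.char_one, dim, lift_mk, Int.cast_natCast]

end K0

/-! ### Products of functionals, and adjoint and positive maps of T-groups -/

/-- The functional `m ⊗ n ↦ φ m * ψ n`. -/
def mulMap {A C M N : Type*} [CommRing A] [CommRing C] [Algebra A C] [AddCommGroup M] [Module A M]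
    [AddCommGroup N] [Module A N] (φ : M →ₗ[A] C) (ψ : N →ₗ[A] C) : M ⊗[A] N →ₗ[A] C :=
  LinearMap.mul' A C ∘ₗ TensorProduct.map φ ψ

@[simp]
theorem mulMap_tmul {A C M N : Type*} [CommRing A] [CommRing C] [Algebra A C] [AddCommGroup M]
    [Module A M] [AddCommGroup N] [Module A N] (φ : M →ₗ[A] C) (ψ : N →ₗ[A] C) (m : M) (n : N) :
    mulMap φ ψ (m ⊗ₜ n) = φ m * ψ n := rfl

theorem tensorBasis_repr_tmul {A M N ι κ : Type*} [CommRing A] [AddCommGroup M] [Module A M]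
    [AddCommGroup N] [Module A N] (b : Module.Basis ι A M) (c : Module.Basis κ A N) (x : M) (y : N)
    (i : ι) (j : κ) : (tensorBasis b c).repr (x ⊗ₜ y) (i, j) = b.repr x i * c.repr y j := by
  rw [tensorBasis, Module.Basis.tensorProduct_repr_tmul_apply, smul_eq_mul, mul_comm]

namespace TGroup

section Form

variable {M N P Q : Type*} [AddCommGroup M] [Module ℤ M] [TGroup M] [AddCommGroup N] [Module ℤ N]
  [TGroup N] [AddCommGroup P] [Module ℤ P] [TGroup P] [AddCommGroup Q] [Module ℤ Q] [TGroup Q]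

theorem form_basis_left (i : Irr M) (y : M) : form (basis i) y = basis.repr y i := by
  simp [form]

theorem form_comm (x y : M) : form x y = form y x := by
  classical
  have : (form (M := M)) = form.flip := basis.ext fun i => basis.ext fun j => by
    rw [LinearMap.flip_apply, form_basis, form_basis]
    simp [eq_comm]
  exact LinearMap.congr_fun (LinearMap.congr_fun this x) y

theorem form_basis_right (x : M) (i : Irr M) : form x (basis i) = basis.repr x i := by
  rw [form_comm, form_basis_left]

theorem isPositive_iff (x : M) : IsPositive x ↔ ∀ i, 0 ≤ basis.repr x i := by
  simp only [IsPositive, form_basis_right]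

theorem ext_form {x y : M} (h : ∀ z, form x z = form y z) : x = y :=
  basis.ext_elem fun i => by rw [← form_basis_right, ← form_basis_right, h]

theorem IsPositive.form_nonneg {x y : M} (hx : IsPositive x) (hy : IsPositive y) :
    0 ≤ form x y := by
  rw [← basis.linearCombination_repr y, Finsupp.linearCombination_apply, Finsupp.sum, map_sum]
  refine Finset.sum_nonneg fun i _ => ?_
  rw [LinearMap.map_smul, smul_eq_mul]
  exact mul_nonneg ((isPositive_iff y).1 hy i) (hx i)

theorem isPositive_basis (i : Irr M) : IsPositive (basis i) := by
  classical
  intro j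
  rw [form_basis]
  split_ifs <;> simp

theorem isPositiveMap_of_basis {f : M →ₗ[ℤ] N} (h : ∀ i, IsPositive (f (basis i))) :
    IsPositiveMap f := by
  intro x hx
  rw [← basis.linearCombination_repr x, Finsupp.linearCombination_apply, Finsupp.sum, map_sum]
  intro j
  rw [map_sum, LinearMap.sum_apply]
  refine Finset.sum_nonneg fun i _ => ?_
  rw [LinearMap.map_smul, LinearMap.map_smul, LinearMap.smul_apply, smul_eq_mul]
  exact mul_nonneg ((isPositive_iff x).1 hx i) (h i j)

theorem isAdjoint_of_basis {f : M →ₗ[ℤ] N} {g : N →ₗ[ℤ] M}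
    (h : ∀ i j, form (f (basis i)) (basis j) = form (basis i) (g (basis j))) : IsAdjoint f g := by
  have : form ∘ₗ f = (form ∘ₗ g).flip := basis.ext fun i => basis.ext fun j => by
    rw [LinearMap.comp_apply, LinearMap.flip_apply, LinearMap.comp_apply, h, form_comm]
  intro m n
  rw [form_comm m]
  exact LinearMap.congr_fun (LinearMap.congr_fun this m) n

theorem IsAdjoint.symm {f : M →ₗ[ℤ] N} {g : N →ₗ[ℤ] M} (h : IsAdjoint f g) : IsAdjoint g f :=
  fun n m => by rw [form_comm, ← h, form_comm]

theorem IsAdjoint.comp {f : M →ₗ[ℤ] N} {g : N →ₗ[ℤ] M} {f' : N →ₗ[ℤ] P} {g' : P →ₗ[ℤ] N}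
    (h' : IsAdjoint f' g') (h : IsAdjoint f g) : IsAdjoint (f' ∘ₗ f) (g ∘ₗ g') :=
  fun m p => by rw [LinearMap.comp_apply, h', h]; rfl

theorem isAdjoint_id : IsAdjoint (.id : M →ₗ[ℤ] M) .id := fun _ _ => rfl

/-- The form is nondegenerate, having an orthonormal basis. This transports identities between
comultiplications to identities between multiplications. -/
theorem IsAdjoint.left_unique {f f' : M →ₗ[ℤ] N} {g : N →ₗ[ℤ] M} (h : IsAdjoint f g)
    (h' : IsAdjoint f' g) : f = f' :=
  LinearMap.ext fun m => ext_form fun n => by rw [h, h']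

/-- The coefficient of g x at an irreducible ω is ⟨f ω, x⟩, a pairing of two positive elements. -/
theorem IsAdjoint.isPositiveMap {f : M →ₗ[ℤ] N} {g : N →ₗ[ℤ] M} (h : IsAdjoint f g)
    (hf : IsPositiveMap f) : IsPositiveMap g := by
  intro x hx i
  rw [form_comm, ← h]
  exact (hf _ (isPositive_basis i)).form_nonneg hx

theorem form_int (a b : ℤ) : form a b = a * b := by
  have h := form_basis_left (M := ℤ) () b
  have h1 : (basis (M := ℤ)) () = (1 : ℤ) := Module.Basis.singleton_apply Unit ℤ ()
  have h2 : (basis (M := ℤ)).repr b () = b := Module.Basis.singleton_repr Unit ℤ b ()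
  rw [h1, h2] at h
  rw [show a = a • (1 : ℤ) by simp, map_smul, LinearMap.smul_apply, h]
  simp

end Form

section Tensor

variable {M N P Q : Type*} [AddCommGroup M] [Module ℤ M] [GradedTGroup M] [AddCommGroup N]
  [Module ℤ N] [GradedTGroup N] [AddCommGroup P] [Module ℤ P] [GradedTGroup P] [AddCommGroup Q]
  [Module ℤ Q] [GradedTGroup Q]

theorem basis_tensor (i : Irr M) (j : Irr N) :
    (basis (M := M ⊗[ℤ] N)) (i, j) = basis i ⊗ₜ basis j :=
  tensorBasis_apply basis basis (i, j)

theorem repr_tmul (x : M) (y : N) (i : Irr M) (j : Irr N) :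
    (basis (M := M ⊗[ℤ] N)).repr (x ⊗ₜ y) (i, j) = basis.repr x i * basis.repr y j :=
  tensorBasis_repr_tmul basis basis x y i j

theorem form_tmul (m m' : M) (n n' : N) :
    form (m ⊗ₜ[ℤ] n) (m' ⊗ₜ n') = form m m' * form n n' := by
  have : form (m ⊗ₜ[ℤ] n) = mulMap (form m) (form n) := (basis (M := M ⊗[ℤ] N)).ext <| by
    rintro ⟨i, j⟩
    rw [form_basis_right, repr_tmul, basis_tensor, mulMap_tmul, form_basis_right, form_basis_right]
  rw [this, mulMap_tmul]

theorem IsAdjoint.map {f : M →ₗ[ℤ] N} {g : N →ₗ[ℤ] M} {f' : P →ₗ[ℤ] Q} {g' : Q →ₗ[ℤ] P}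
    (h : IsAdjoint f g) (h' : IsAdjoint f' g') :
    IsAdjoint (TensorProduct.map f f') (TensorProduct.map g g') :=
  isAdjoint_of_basis fun ⟨i, i'⟩ ⟨j, j'⟩ => by
    rw [basis_tensor, basis_tensor, TensorProduct.map_tmul, TensorProduct.map_tmul, form_tmul,
      form_tmul, h, h']

theorem isAdjoint_assoc : IsAdjoint (TensorProduct.assoc ℤ M N P).toLinearMap
    (TensorProduct.assoc ℤ M N P).symm.toLinearMap :=
  isAdjoint_of_basis <| by
    rintro ⟨⟨i, j⟩, k⟩ ⟨i', ⟨j', k'⟩⟩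
    simp only [basis_tensor, LinearEquiv.coe_coe, TensorProduct.assoc_tmul,
      TensorProduct.assoc_symm_tmul, form_tmul, mul_assoc]

theorem isAdjoint_comm : IsAdjoint (TensorProduct.comm ℤ M N).toLinearMap
    (TensorProduct.comm ℤ N M).toLinearMap :=
  isAdjoint_of_basis fun ⟨i, j⟩ ⟨j', i'⟩ => by
    simp only [basis_tensor, LinearEquiv.coe_coe, TensorProduct.comm_tmul, form_tmul, mul_comm]

theorem isAdjoint_lid : IsAdjoint (TensorProduct.lid ℤ M).toLinearMap
    (TensorProduct.lid ℤ M).symm.toLinearMap :=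
  isAdjoint_of_basis fun ⟨i, j⟩ k => by
    simp only [basis_tensor, LinearEquiv.coe_coe, TensorProduct.lid_tmul,
      TensorProduct.lid_symm_apply, form_tmul, form_int, LinearMap.map_smul, LinearMap.smul_apply,
      smul_eq_mul, mul_one]

/-- The two sides are adjoint to the two sides of coassociativity, rewritten with the inverse of the
associator. -/
theorem IsAdjoint.act_assoc {μ : M ⊗[ℤ] M →ₗ[ℤ] M} {μ' : M →ₗ[ℤ] M ⊗[ℤ] M}
    {α : M ⊗[ℤ] N →ₗ[ℤ] N} {α' : N →ₗ[ℤ] M ⊗[ℤ] N} (hμ : IsAdjoint μ μ') (hα : IsAdjoint α α')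
    (h : (TensorProduct.assoc ℤ M M N).toLinearMap ∘ₗ TensorProduct.map μ' .id ∘ₗ α' =
      TensorProduct.map .id α' ∘ₗ α') :
    α ∘ₗ TensorProduct.map μ .id =
      α ∘ₗ TensorProduct.map .id α ∘ₗ (TensorProduct.assoc ℤ M M N).toLinearMap := by
  have h1 := hα.comp (hμ.map (isAdjoint_id (M := N)))
  have h2 := hα.comp (((isAdjoint_id (M := M)).map hα).comp
    (isAdjoint_assoc (M := M) (N := M) (P := N)))
  have hc : TensorProduct.map μ' .id ∘ₗ α' = ((TensorProduct.assoc ℤ M M N).symm.toLinearMap ∘ₗ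
      TensorProduct.map .id α') ∘ₗ α' := LinearMap.ext fun z =>
    ((TensorProduct.assoc ℤ M M N).symm_apply_apply _).symm.trans
      (congrArg (TensorProduct.assoc ℤ M M N).symm (LinearMap.congr_fun h z))
  rw [hc] at h1
  exact h1.left_unique h2

theorem IsAdjoint.act_unit {e : ℤ →ₗ[ℤ] M} {e' : M →ₗ[ℤ] ℤ}
    {α : M ⊗[ℤ] N →ₗ[ℤ] N} {α' : N →ₗ[ℤ] M ⊗[ℤ] N} (he : IsAdjoint e e') (hα : IsAdjoint α α')
    (h : (TensorProduct.lid ℤ N).toLinearMap ∘ₗ TensorProduct.map e' .id ∘ₗ α' = .id) :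
    α ∘ₗ TensorProduct.map e .id = (TensorProduct.lid ℤ N).toLinearMap := by
  have h1 := hα.comp (he.map (isAdjoint_id (M := N)))
  have hc : TensorProduct.map e' .id ∘ₗ α' = (TensorProduct.lid ℤ N).symm.toLinearMap :=
    LinearMap.ext fun z => (LinearEquiv.eq_symm_apply _).2 (LinearMap.congr_fun h z)
  rw [hc] at h1
  exact h1.left_unique isAdjoint_lid

/-- Dual to the comultiplicativity of the unit: the adjoints are maps out of ℤ, so it is enough to
compare them at 1. -/
theorem IsAdjoint.counit_mul {μ : M ⊗[ℤ] M →ₗ[ℤ] M} {μ' : M →ₗ[ℤ] M ⊗[ℤ] M}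
    {e : ℤ →ₗ[ℤ] M} {e' : M →ₗ[ℤ] ℤ} (hμ : IsAdjoint μ μ') (he : IsAdjoint e e')
    (h : μ' (e 1) = e 1 ⊗ₜ e 1) :
    e' ∘ₗ μ = (TensorProduct.lid ℤ ℤ).toLinearMap ∘ₗ TensorProduct.map e' e' := by
  have h1 := he.symm.comp hμ
  have h2 := (isAdjoint_lid (M := ℤ)).comp (he.symm.map he.symm)
  have hc : μ' ∘ₗ e = TensorProduct.map e e ∘ₗ (TensorProduct.lid ℤ ℤ).symm.toLinearMap :=
    LinearMap.ext_ring h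
  rw [hc] at h1
  exact h1.left_unique h2

end Tensor

end TGroup

/-! ### Adjointness, positivity and gradings for `R G` -/

namespace R

open TGroup Finset

variable {H : Type u} [Group H] {G : Type u} [Group G] [Finite H] [Finite G]

/-- The inclusion of the component of degree `n`. -/
abbrev of (G : Type u) [Group G] (n : ℕ) : K0 (Wreath n G) →ₗ[ℤ] R G :=
  DirectSum.lof ℤ ℕ (fun n => K0 (Wreath n G)) n

theorem repr_apply (z : R G) (n : ℕ) (i : K0.Irr (Wreath n G)) :
    (basis (M := R G)).repr z ⟨n, i⟩ = (K0.basis (Wreath n G)).repr (z n) i := rfl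

theorem basis_mk (n : ℕ) (i : K0.Irr (Wreath n G)) : basis (M := R G) ⟨n, i⟩ = of G n i.1 := by
  classical
  refine Module.Basis.apply_eq_iff.2 (Finsupp.ext ?_)
  rintro ⟨m, j⟩
  rw [repr_apply]
  by_cases h : m = n
  · subst h
    rw [DirectSum.lof_apply, ← K0.basis_apply, Module.Basis.repr_self]
    by_cases hij : i = j
    · subst hij; simp
    · rw [Finsupp.single_eq_of_ne' hij, Finsupp.single_eq_of_ne']
      intro h
      cases h
      exact hij rfl
  · rw [Finsupp.single_eq_of_ne fun h' => h (congrArg Sigma.fst h'), DirectSum.lof_eq_of,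
      DirectSum.of_eq_of_ne _ _ _ h]
    simp

/-- Links the integral form of the T-group with the complex pairing of characters; only the
component of z in degree n matters. -/
theorem form_of (n : ℕ) (x : K0 (Wreath n G)) (z : R G) :
    (form (of G n x) z : ℂ) = K0.charForm x (z n) := by
  have : (Algebra.linearMap ℤ ℂ ∘ₗ form.flip z) ∘ₗ of G n = K0.charForm.flip (z n) :=
    (K0.basis _).ext fun i => by
      rw [K0.basis_apply, LinearMap.flip_apply, K0.charForm_basis_left, LinearMap.comp_apply,
        LinearMap.comp_apply, LinearMap.flip_apply, ← basis_mk, form_basis_left, repr_apply]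
      rfl
  exact LinearMap.congr_fun this x

theorem act_of (ι : H →* G) (k l : ℕ) (x : K0 (Wreath k H)) (y : K0 (Wreath l G)) :
    act ι (of H k x ⊗ₜ of G l y) =
      of G (k + l) (K0.ind (blockHom ι (rfl : k + l = k + l)) (K0.boxtimes _ _ (x ⊗ₜ y))) := by
  simp [act]

theorem coact_of (ι : H →* G) (n : ℕ) (x : K0 (Wreath n G)) :
    coact ι (of G n x) = ∑ p ∈ (HasAntidiagonal.antidiagonal n).attach,
      TensorProduct.map (of H p.1.1) (of G p.1.2) ((K0.boxtimesEquiv _ _).symm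
        (K0.res (blockHom ι (HasAntidiagonal.mem_antidiagonal.1 p.2)) x)) := by
  simp [coact, LinearMap.sum_apply]

/-- External products of irreducibles are orthonormal, so pairing with them reads off tensor
coordinates. This makes the inverse of `boxtimesEquiv`, which enters `coact`, accessible to
characters. -/
theorem charForm_boxtimes_irr {G' G'' : Type u} [Group G'] [Group G''] [Finite G'] [Finite G'']
    (i : K0.Irr G') (j : K0.Irr G'') (t : K0 G' ⊗[ℤ] K0 G'') :
    K0.charForm (K0.boxtimes G' G'' (i.1 ⊗ₜ j.1)) (K0.boxtimes G' G'' t) =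
      ((tensorBasis (K0.basis G') (K0.basis G'')).repr t (i, j) : ℂ) := by
  induction t using TensorProduct.induction_on with
  | zero => simp
  | tmul x y =>
    rw [tensorBasis_repr_tmul, K0.charForm_apply, K0.charPair_boxtimes, ← K0.charForm_apply,
      ← K0.charForm_apply, K0.charForm_basis_left, K0.charForm_basis_left, Int.cast_mul]
  | add x y hx hy => simp only [map_add, hx, hy, Finsupp.add_apply, Int.cast_add]

theorem repr_map_of (k l k' l' : ℕ) (i : K0.Irr (Wreath k H)) (j : K0.Irr (Wreath l G))
    (t : K0 (Wreath k' H) ⊗[ℤ] K0 (Wreath l' G)) :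
    (basis (M := R H ⊗[ℤ] R G)).repr (TensorProduct.map (of H k') (of G l') t) (⟨k, i⟩, ⟨l, j⟩) =
      if h : k' = k ∧ l' = l then (tensorBasis (K0.basis _) (K0.basis _)).repr t
        (h.1 ▸ i, h.2 ▸ j) else 0 := by
  induction t using TensorProduct.induction_on with
  | zero => simp
  | tmul x y =>
    rw [TensorProduct.map_tmul, repr_tmul, repr_apply, repr_apply]
    split_ifs with h
    · obtain ⟨rfl, rfl⟩ := h
      rw [tensorBasis_repr_tmul, DirectSum.lof_apply, DirectSum.lof_apply]
    · rw [not_and_or] at h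
      simp only [DirectSum.lof_eq_of]
      rcases h with h | h <;> simp [DirectSum.of_eq_of_ne _ _ _ (Ne.symm h)]
  | add x y hx hy =>
    simp only [map_add, hx, hy, Finsupp.add_apply]
    split_ifs <;> simp

/-- Frobenius reciprocity in each bidegree (k, l): against a pair of irreducibles of degrees k and
l, only that one summand of the coaction has a nonzero coefficient. -/
theorem isAdjoint_act (ι : H →* G) : IsAdjoint (act ι) (coact ι) := by
  refine isAdjoint_of_basis ?_
  rintro ⟨⟨k, i⟩, ⟨l, j⟩⟩ ⟨n, w⟩
  rw [form_basis_left, basis_tensor, basis_mk, basis_mk, basis_mk, act_of, coact_of]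
  refine Int.cast_injective (α := ℂ) ?_
  rw [form_of]
  simp only [map_sum, Finsupp.coe_finsetSum, Finset.sum_apply, repr_map_of]
  by_cases hn : k + l = n
  · subst hn
    rw [Finset.sum_eq_single ⟨(k, l), by simp⟩]
    · rw [dif_pos ⟨rfl, rfl⟩, ← charForm_boxtimes_irr, DirectSum.lof_apply, K0.charForm_ind]
      congr 1
      exact ((K0.boxtimesEquiv _ _).apply_symm_apply _).symm
    · rintro ⟨⟨k', l'⟩, h'⟩ - hne
      rw [dif_neg]
      rintro ⟨h1, h2⟩
      exact hne (Subtype.ext (Prod.ext h1 h2))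
    · intro h; exact absurd (Finset.mem_attach _ _) h
  · rw [DirectSum.lof_eq_of, DirectSum.of_eq_of_ne _ _ _ hn, map_zero, Finset.sum_eq_zero,
      Int.cast_zero]
    rintro ⟨⟨k', l'⟩, h'⟩ -
    rw [dif_neg]
    rintro ⟨h1, h2⟩
    exact hn (by rw [← h1, ← h2]; exact mem_antidiagonal.1 h')

theorem isPositive_of_mk (n : ℕ) (A : FinRep (Wreath n G)) : IsPositive (of G n (K0.mk A)) := by
  rw [isPositive_iff]
  rintro ⟨m, i⟩
  rw [repr_apply]
  by_cases h : m = n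
  · subst h
    rw [DirectSum.lof_apply]
    exact K0.basis_repr_mk_nonneg A i
  · rw [DirectSum.lof_eq_of, DirectSum.of_eq_of_ne _ _ _ h]
    simp

/-- Two irreducible classes go to the class of an actual representation, whose multiplicities are
nonnegative. -/
theorem isPositiveMap_act (ι : H →* G) : IsPositiveMap (act ι) := by
  refine isPositiveMap_of_basis ?_
  rintro ⟨⟨k, i⟩, ⟨l, j⟩⟩
  rw [basis_tensor, basis_mk, basis_mk, act_of]
  obtain ⟨A, hA, hi⟩ := i.2
  obtain ⟨B, hB, hj⟩ := j.2
  rw [← hi, ← hj, K0.boxtimes_mk, K0.ind, K0.lift_mk]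
  exact isPositive_of_mk _ _

theorem mem_grade {n : ℕ} {x : R G} :
    x ∈ GradedTGroup.grade (M := R G) n ↔ ∃ y, of G n y = x := Iff.rfl

theorem isGradedMap_act (ι : H →* G) : IsGradedMap (act ι) := by
  intro n
  change (⨆ p ∈ antidiagonal n, _) ≤ (GradedTGroup.grade (M := R G) n).comap (act ι)
  refine iSup₂_le fun p hp => Submodule.map₂_le.2 ?_
  rintro _ ⟨x, rfl⟩ _ ⟨y, rfl⟩
  obtain rfl := mem_antidiagonal.1 hp
  exact ⟨_, (act_of ι _ _ x y).symm⟩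

theorem map_of_mem_grade (k l : ℕ) (t : K0 (Wreath k H) ⊗[ℤ] K0 (Wreath l G)) :
    TensorProduct.map (of H k) (of G l) t ∈ GradedTGroup.grade (M := R H ⊗[ℤ] R G) (k + l) := by
  induction t using TensorProduct.induction_on with
  | zero => simp
  | tmul x y =>
    exact Submodule.mem_iSup_of_mem (k, l) (Submodule.mem_iSup_of_mem (by simp)
      (Submodule.apply_mem_map₂ _ ⟨x, rfl⟩ ⟨y, rfl⟩))
  | add x y hx hy => rw [map_add]; exact Submodule.add_mem _ hx hy

theorem isGradedMap_coact (ι : H →* G) : IsGradedMap (coact ι) := by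
  rintro n _ ⟨x, rfl⟩
  rw [coact_of]
  refine Submodule.sum_mem _ fun p _ => ?_
  have h := mem_antidiagonal.1 p.2
  exact (congrArg (_ ∈ GradedTGroup.grade (M := R H ⊗[ℤ] R G) ·) h).mp (map_of_mem_grade _ _ _)

variable (G) in
theorem isGradedTGroup : IsGradedTGroup (R G) := by
  refine ⟨?_, fun ⟨n, i⟩ => ⟨n, mem_grade.2 ⟨_, (basis_mk n i).symm⟩⟩⟩
  have hinj : ∀ n, Function.Injective (of G n) := fun n => DirectSum.of_injective n
  -- Each inclusion is injective, so the components may be replaced by their images; the canonical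
  -- map from the direct sum of the images is then the inverse of e.
  let e : R G ≃ₗ[ℤ] ⨁ n, GradedTGroup.grade (M := R G) n :=
    DFinsupp.mapRange.linearEquiv fun n => LinearEquiv.ofInjective (of G n) (hinj n)
  have h : DirectSum.coeLinearMap (GradedTGroup.grade (M := R G)) ∘ₗ e.toLinearMap = .id :=
    DirectSum.linearMap_ext _ fun n => LinearMap.ext fun x => by
      change DirectSum.coeLinearMap _ (e (of G n x)) = of G n x
      have : e (of G n x) = DirectSum.lof ℤ ℕ (fun n => GradedTGroup.grade (M := R G) n) n
          ⟨of G n x, x, rfl⟩ :=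
        DFinsupp.mapRange_single (hf := fun _ => map_zero _)
      rw [this, DirectSum.coeLinearMap_lof]
  have h' : ⇑(DirectSum.coeLinearMap (GradedTGroup.grade (M := R G))) = e.symm := by
    ext1 x
    obtain ⟨y, rfl⟩ := e.surjective x
    rw [e.symm_apply_apply]
    exact LinearMap.congr_fun h y
  change Function.Bijective (DirectSum.coeLinearMap (GradedTGroup.grade (M := R G)))
  rw [h']
  exact e.symm.bijective

end R

/-! ### Elements of wreath products over unnumbered index sets -/

/-- The element `(a, σ)` of the wreath product, in the numbering `e` of the index set. -/
def wreathMk {X : Type*} {G : Type u} [Group G] {n : ℕ} (e : X ≃ Fin n) (σ : Equiv.Perm X)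
    (a : X → G) : Wreath n G := ⟨a ∘ e.symm, e.permCongr σ⟩

/-- The action of `G^X` by conjugation on the elements `(a, σ)` of the wreath product. -/
def gaugeConj {X G : Type*} [Group G] (σ : Equiv.Perm X) (b a : X → G) : X → G :=
  fun i => b i * a i * (b (σ.symm i))⁻¹

theorem Wreath.ext_iff' {G : Type u} [Group G] {n : ℕ} {x y : Wreath n G} :
    x = y ↔ x.right = y.right ∧ x.left = y.left := by
  constructor
  · rintro rfl; exact ⟨rfl, rfl⟩
  · rintro ⟨h, h'⟩; exact SemidirectProduct.ext h' h

theorem wreathMk_inj {X : Type*} {G : Type u} [Group G] {n : ℕ} (e : X ≃ Fin n)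
    {σ τ : Equiv.Perm X} {a b : X → G} : wreathMk e σ a = wreathMk e τ b ↔ σ = τ ∧ a = b := by
  rw [Wreath.ext_iff']
  refine and_congr (e.permCongr.apply_eq_iff_eq) ⟨fun h => ?_, fun h => by subst h; rfl⟩
  ext i
  have := congrFun h (e i)
  simpa [wreathMk] using this

theorem wreathMk_refl {G : Type u} [Group G] {n : ℕ} (w : Wreath n G) :
    wreathMk (Equiv.refl _) w.right w.left = w := by
  refine Wreath.ext_iff'.2 ⟨?_, rfl⟩
  ext i; simp [wreathMk]

/-- The permutation part of the conjugating element only renumbers the index set, while its G-part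
acts by `gaugeConj`. Class functions thus live on unnumbered pairs (σ, a). -/
theorem wreathMk_conj {X : Type*} {G : Type u} [Group G] {n : ℕ} (e : X ≃ Fin n)
    (σ : Equiv.Perm X) (a : X → G) (z : Wreath n G) :
    z * wreathMk e σ a * z⁻¹ = wreathMk (e.trans z.right) σ
      (gaugeConj σ (fun i => z.left (z.right (e i))) a) := by
  refine Wreath.ext_iff'.2 ⟨?_, ?_⟩
  · ext i; simp [wreathMk, Equiv.Perm.inv_def]
  · ext i
    change z.left i * a (e.symm (z.right⁻¹ i)) *
      (z.left (z.right⁻¹⁻¹ ((z.right * e.permCongr σ)⁻¹ i)))⁻¹ = _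
    simp [wreathMk, gaugeConj, Equiv.Perm.inv_def]
    rfl

theorem blockHom_wreathMk {X Y : Type*} {H G : Type u} [Group H] [Group G] (ι : H →* G)
    {k l : ℕ} (e : X ≃ Fin k) (f : Y ≃ Fin l) (σ : Equiv.Perm X) (τ : Equiv.Perm Y)
    (a : X → H) (b : Y → G) : blockHom ι rfl (wreathMk e σ a, wreathMk f τ b) =
      wreathMk ((e.sumCongr f).trans (splitEquiv rfl)) (σ.sumCongr τ) (Sum.elim (ι ∘ a) b) := by
  refine Wreath.ext_iff'.2 ⟨?_, ?_⟩
  · ext i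
    obtain ⟨j, rfl⟩ := (splitEquiv rfl).surjective i
    rcases j with j | j <;> simp [wreathMk, blockHom]
  · ext i
    obtain ⟨j, rfl⟩ := (splitEquiv rfl).surjective i
    rcases j with j | j <;> simp [wreathMk, blockHom]

/-! ### Character values as functionals on `R G` -/

namespace R

open TGroup Finset

variable {H : Type u} [Group H] {G : Type u} [Group G] [Finite H] [Finite G]
  {X Y : Type} [Finite X] [Finite Y]

/-- The value of the character of an element of `R(G)` at `(a, σ)`, where `σ` is a permutation of
a finite set `X` and `a : X → G`. -/
def ev (σ : Equiv.Perm X) (a : X → G) : R G →ₗ[ℤ] ℂ :=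
  LinearMap.proj (wreathMk (Finite.equivFin X) σ a) ∘ₗ K0.char ∘ₗ
    DirectSum.component ℤ ℕ (fun n => K0 (Wreath n G)) (Nat.card X)

/-- Two numberings of X differ by a permutation of Fin n, which conjugates one element of the wreath
product into the other; so any numbering may be used. -/
theorem ev_apply {n : ℕ} (e : X ≃ Fin n) (σ : Equiv.Perm X) (a : X → G) (z : R G) :
    ev σ a z = K0.char (z n) (wreathMk e σ a) := by
  obtain rfl : n = Nat.card X := by rw [Nat.card_congr e, Nat.card_fin]
  rw [← K0.char_conj _ (wreathMk e σ a) ⟨1, e.symm.trans (Finite.equivFin X)⟩, wreathMk_conj,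
    ← Equiv.trans_assoc, Equiv.self_trans_symm, Equiv.refl_trans]
  refine congrArg (K0.char _) ((wreathMk_inj _).2 ⟨rfl, ?_⟩)
  ext i
  simp [gaugeConj]

theorem ev_of {n : ℕ} (e : X ≃ Fin n) (σ : Equiv.Perm X) (a : X → G) (x : K0 (Wreath n G)) :
    ev σ a (of G n x) = K0.char x (wreathMk e σ a) := by
  rw [ev_apply e, DirectSum.lof_apply]

theorem ev_of_ne {n : ℕ} (h : Nat.card X ≠ n) (σ : Equiv.Perm X) (a : X → G)
    (x : K0 (Wreath n G)) : ev σ a (of G n x) = 0 := by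
  rw [ev_apply (Finite.equivFin X), DirectSum.lof_eq_of, DirectSum.of_eq_of_ne _ _ _ h]
  simp

theorem ev_congr (e : X ≃ Y) (σ : Equiv.Perm X) (a : X → G) :
    ev (e.permCongr σ) (a ∘ e.symm) = ev σ a := by
  refine LinearMap.ext fun z => ?_
  rw [ev_apply (Finite.equivFin Y), ev_apply (e.trans (Finite.equivFin Y))]
  rfl

/-- This is conjugation by an element of the wreath product with trivial permutation part. -/
theorem ev_gauge (σ : Equiv.Perm X) (b a : X → G) : ev σ (gaugeConj σ b a) = ev σ a := by
  refine LinearMap.ext fun z => ?_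
  let e := Finite.equivFin X
  let w : Wreath (Nat.card X) G := ⟨b ∘ e.symm, 1⟩
  have hw : (fun i => w.left (w.right (e i))) = b := by
    ext i
    simp [w]
  rw [ev_apply e, ev_apply e, ← K0.char_conj _ (wreathMk e σ a) w, wreathMk_conj, hw]
  rfl

/-- A family of functionals whose complex linear combinations include the coordinates. -/
def Separates {M I : Type*} [AddCommGroup M] [Module ℤ M] [TGroup M] (φ : I → M →ₗ[ℤ] ℂ) : Prop :=
  ∀ i : Irr M, Algebra.linearMap ℤ ℂ ∘ₗ basis.coord i ∈ Submodule.span ℂ (Set.range φ)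

theorem Separates.ext {M I : Type*} [AddCommGroup M] [Module ℤ M] [TGroup M]
    {φ : I → M →ₗ[ℤ] ℂ} (h : Separates φ) {x y : M} (hxy : ∀ i, φ i x = φ i y) : x = y := by
  refine basis.ext_elem fun i => Int.cast_injective (α := ℂ) ?_
  refine Submodule.span_induction (p := fun f _ => f x = f y) ?_ (by simp) ?_ ?_ (h i)
  · rintro _ ⟨i, rfl⟩; exact hxy i
  · intro f g _ _ hf hg; simp [hf, hg]
  · intro c f _ hf; simp [hf]

/-- Coordinates on the tensor product are products of coordinates, and the product of functionals is
bilinear. It is the formulation by spans, rather than joint injectivity, that passes so directly to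
tensor products. -/
theorem Separates.mulMap {M N I J : Type*} [AddCommGroup M] [Module ℤ M] [GradedTGroup M]
    [AddCommGroup N] [Module ℤ N] [GradedTGroup N] {φ : I → M →ₗ[ℤ] ℂ} {ψ : J → N →ₗ[ℤ] ℂ}
    (hφ : Separates φ) (hψ : Separates ψ) :
    Separates fun p : I × J => mulMap (φ p.1) (ψ p.2) := by
  rintro ⟨i, j⟩
  have h : Algebra.linearMap ℤ ℂ ∘ₗ (basis (M := M ⊗[ℤ] N)).coord (i, j) =
      _root_.mulMap (Algebra.linearMap ℤ ℂ ∘ₗ basis.coord i)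
        (Algebra.linearMap ℤ ℂ ∘ₗ basis.coord j) :=
    TensorProduct.ext' fun x y => by
      simp [repr_tmul]
  rw [h]
  refine Submodule.span_induction₂ (p := fun f g _ _ => _root_.mulMap f g ∈ _) ?_ ?_ ?_ ?_ ?_ ?_ ?_
    (hφ i) (hψ j)
  · rintro _ _ ⟨i, rfl⟩ ⟨j, rfl⟩
    exact Submodule.subset_span ⟨(i, j), rfl⟩
  · intro g _
    rw [show _root_.mulMap (0 : M →ₗ[ℤ] ℂ) g = 0 from TensorProduct.ext' fun x y => by simp]
    exact Submodule.zero_mem _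
  · intro f _
    rw [show _root_.mulMap f (0 : N →ₗ[ℤ] ℂ) = 0 from TensorProduct.ext' fun x y => by simp]
    exact Submodule.zero_mem _
  · intro f f' g _ _ _ h h'
    rw [show _root_.mulMap (f + f') g = _root_.mulMap f g + _root_.mulMap f' g from
      TensorProduct.ext' fun x y => by simp [add_mul]]
    exact Submodule.add_mem _ h h'
  · intro f g g' _ _ _ h h'
    rw [show _root_.mulMap f (g + g') = _root_.mulMap f g + _root_.mulMap f g' from
      TensorProduct.ext' fun x y => by simp [mul_add]]
    exact Submodule.add_mem _ h h'
  · intro c f g _ _ h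
    rw [show _root_.mulMap (c • f) g = c • _root_.mulMap f g from
      TensorProduct.ext' fun x y => by simp [mul_assoc]]
    exact Submodule.smul_mem _ _ h
  · intro c f g _ _ h
    rw [show _root_.mulMap f (c • g) = c • _root_.mulMap f g from
      TensorProduct.ext' fun x y => by simp [mul_left_comm]]
    exact Submodule.smul_mem _ _ h

-- By orthonormality of irreducible characters, the coefficient at an irreducible is a complex
-- linear combination of character values.
variable (G) in
theorem separates_ev :
    Separates fun p : Σ n, Equiv.Perm (Fin n) × (Fin n → G) => ev p.2.1 p.2.2 := by
  rintro ⟨n, i⟩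
  let := Fintype.ofFinite (Wreath n G)
  have h : Algebra.linearMap ℤ ℂ ∘ₗ (basis (M := R G)).coord ⟨n, i⟩ =
      (Nat.card (Wreath n G) : ℂ)⁻¹ • ∑ g : Wreath n G, K0.char i.1 g⁻¹ • ev g.right g.left := by
    refine LinearMap.ext fun z => ?_
    change (((K0.basis (Wreath n G)).repr (z n) i : ℤ) : ℂ) = _
    rw [← K0.charForm_basis_left, K0.charForm_comm, K0.charForm_apply, K0.charPair_eq_sum,
      LinearMap.smul_apply, LinearMap.sum_apply, smul_eq_mul]
    congr 1
    refine Finset.sum_congr rfl fun g _ => ?_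
    rw [LinearMap.smul_apply, ev_apply (Equiv.refl _), wreathMk_refl, smul_eq_mul, mul_comm]
  rw [h]
  exact Submodule.smul_mem _ _ (Submodule.sum_mem _ fun g _ => Submodule.smul_mem _ _
    (Submodule.subset_span ⟨⟨n, g.right, g.left⟩, rfl⟩))

/-- A restricted character is evaluated at a block diagonal element. Only the summand of bidegree
(|X|, |Y|) contributes; the others vanish at (σ, a) or at (τ, b) for reasons of degree. -/
theorem mulMap_ev_coact (ι : H →* G) (σ : Equiv.Perm X) (a : X → H) (τ : Equiv.Perm Y)
    (b : Y → G) : mulMap (ev σ a) (ev τ b) ∘ₗ coact ι =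
      ev (σ.sumCongr τ) (Sum.elim (ι ∘ a) b) := by
  let e := Finite.equivFin X
  let f := Finite.equivFin Y
  refine DirectSum.linearMap_ext _ fun n => LinearMap.ext fun x => ?_
  change mulMap (ev σ a) (ev τ b) (coact ι (of G n x)) = ev _ _ (of G n x)
  rw [coact_of, map_sum]
  have h0 : ∀ k l (t : K0 (Wreath k H) ⊗[ℤ] K0 (Wreath l G)), ¬ (Nat.card X = k ∧ Nat.card Y = l) →
      mulMap (ev σ a) (ev τ b) (TensorProduct.map (of H k) (of G l) t) = 0 := by
    intro k l t h
    induction t using TensorProduct.induction_on with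
    | zero => simp
    | tmul x y =>
      rw [TensorProduct.map_tmul, mulMap_tmul]
      rw [not_and_or] at h
      rcases h with h | h
      · rw [ev_of_ne h, zero_mul]
      · rw [ev_of_ne h, mul_zero]
    | add x y hx hy => rw [map_add, map_add, hx, hy, add_zero]
  have h1 : ∀ (t : K0 (Wreath (Nat.card X) H) ⊗[ℤ] K0 (Wreath (Nat.card Y) G)),
      mulMap (ev σ a) (ev τ b) (TensorProduct.map (of H _) (of G _) t) =
        K0.char (K0.boxtimes _ _ t) (wreathMk e σ a, wreathMk f τ b) := by
    intro t
    induction t using TensorProduct.induction_on with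
    | zero => simp
    | tmul x y =>
      rw [TensorProduct.map_tmul, mulMap_tmul, K0.char_boxtimes, ev_of e, ev_of f]
    | add x y hx hy => rw [map_add, map_add, hx, hy, map_add, map_add]; rfl
  by_cases hn : Nat.card X + Nat.card Y = n
  · subst hn
    rw [Finset.sum_eq_single ⟨(Nat.card X, Nat.card Y), by simp⟩]
    · rw [h1]
      rw [ev_of ((e.sumCongr f).trans (splitEquiv rfl)), ← blockHom_wreathMk, ← K0.char_res]
      exact congrArg (fun t => K0.char t _) ((K0.boxtimesEquiv _ _).apply_symm_apply _)
    · rintro ⟨⟨k', l'⟩, h'⟩ - hne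
      refine h0 _ _ _ ?_
      rintro ⟨h1, h2⟩
      exact hne (Subtype.ext (Prod.ext h1.symm h2.symm))
    · intro h; exact absurd (Finset.mem_attach _ _) h
  · rw [ev_of_ne (by rw [Nat.card_sum]; exact hn), Finset.sum_eq_zero]
    rintro ⟨⟨k', l'⟩, h'⟩ -
    refine h0 _ _ _ ?_
    rintro ⟨h1, h2⟩
    exact hn (by rw [h1, h2]; exact mem_antidiagonal.1 h')

end R

/-! ### Invariant subsets and the character of an induction product -/

/-- The invariant subsets of a permutation. -/
abbrev InvSet {X : Type*} (σ : Equiv.Perm X) : Type _ := {s : Set X // ∀ i, σ i ∈ s ↔ i ∈ s}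

namespace InvSet

variable {X : Type*} {σ : Equiv.Perm X}

-- One instance is fixed for all sums over invariant subsets, ahead of those derived from
-- decidability.
instance (priority := high) [Finite X] : Fintype (InvSet σ) := Fintype.ofFinite _

/-- The restriction of the permutation to an invariant subset. -/
def perm (s : InvSet σ) : Equiv.Perm s.1 := σ.subtypePerm (p := (· ∈ s.1)) s.2

/-- The complement of an invariant subset. -/
abbrev compl (s : InvSet σ) : InvSet σ := ⟨s.1ᶜ, fun i => not_congr (s.2 i)⟩

@[simp]
theorem coe_perm_apply (s : InvSet σ) (i : s.1) : (s.perm i : X) = σ i := rfl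

@[simp]
theorem coe_perm_symm_apply (s : InvSet σ) (i : s.1) : (s.perm.symm i : X) = σ.symm i := rfl

end InvSet

/-- The elements of a wreath product, in a numbering of the index set. -/
def wreathEquiv {X : Type*} {G : Type u} [Group G] {n : ℕ} (e : X ≃ Fin n) :
    Equiv.Perm X × (X → G) ≃ Wreath n G where
  toFun p := wreathMk e p.1 p.2
  invFun w := (e.symm.permCongr w.right, w.left ∘ e)
  left_inv p := by
    refine Prod.ext ?_ ?_
    · ext i; simp [wreathMk]
    · ext i; simp [wreathMk]
  right_inv w := by
    refine Wreath.ext_iff'.2 ⟨?_, ?_⟩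
    · ext i; simp [wreathMk]
    · ext i; simp [wreathMk]

theorem card_wreath {G : Type u} [Group G] (n : ℕ) :
    Nat.card (Wreath n G) = n.factorial * Nat.card G ^ n := by
  rw [← Nat.card_congr (wreathEquiv (Equiv.refl (Fin n))), Nat.card_prod, Nat.card_perm,
    Nat.card_fun, Nat.card_fin]

/-- A conjugating element is a renumbering together with a family of elements of `G`. -/
def conjugatorEquiv {X : Type*} {G : Type u} [Group G] {k l : ℕ} (e : X ≃ Fin (k + l)) :
    Wreath (k + l) G ≃ (X ≃ Fin k ⊕ Fin l) × (X → G) where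
  toFun z := ((e.trans z.right).trans (splitEquiv rfl).symm, fun i => z.left (z.right (e i)))
  invFun p := ⟨fun j => p.2 (p.1.symm ((splitEquiv rfl).symm j)),
    e.symm.trans (p.1.trans (splitEquiv rfl))⟩
  left_inv z := by
    refine Wreath.ext_iff'.2 ⟨?_, ?_⟩
    · ext i; simp
    · ext i; simp
  right_inv p := by
    refine Prod.ext ?_ ?_
    · ext i; simp
    · ext i; simp

open scoped Classical in
/-- A bijection to a disjoint union is a subset with bijections from it and from its complement. -/
def splittingEquiv {X A B : Type*} :
    (Σ s : Set X, (s ≃ A) × ((sᶜ : Set X) ≃ B)) ≃ (X ≃ A ⊕ B) := by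
  refine Equiv.ofBijective
    (fun t => (Equiv.Set.sumCompl t.1).symm.trans (t.2.1.sumCongr t.2.2)) ⟨?_, ?_⟩
  · rintro ⟨s, p, q⟩ ⟨s', p', q'⟩ h
    simp only at h
    have hs : ∀ (s : Set X) (p : s ≃ A) (q : (sᶜ : Set X) ≃ B) (i : X), i ∈ s ↔
        (((Equiv.Set.sumCompl s).symm.trans (p.sumCongr q)) i).isLeft := by
      intro s p q i
      by_cases hi : i ∈ s
      · simp [hi, Equiv.Set.sumCompl_symm_apply_of_mem hi]
      · simp [hi, Equiv.Set.sumCompl_symm_apply_of_notMem hi]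
    obtain rfl : s = s' := by
      ext i
      rw [hs s p q, hs s' p' q', h]
    have h' : p.sumCongr q = p'.sumCongr q' := by
      have := congrArg (fun f => (Equiv.Set.sumCompl s).trans f) h
      simpa [← Equiv.trans_assoc] using this
    congr 2
    · ext i
      simpa using Equiv.congr_fun h' (Sum.inl i)
    · ext i
      simpa using Equiv.congr_fun h' (Sum.inr i)
  · intro f
    let s : Set X := {i | (f i).isLeft}
    have hs : ∀ i, i ∈ sᶜ → (f i).isRight := fun i hi => by
      simpa [s] using hi
    let p : s ≃ A :=
      { toFun := fun i => (f i).getLeft i.2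
        invFun := fun i => ⟨f.symm (Sum.inl i), by simp [s]⟩
        left_inv := fun i => by simp
        right_inv := fun i => by simp }
    let q : (sᶜ : Set X) ≃ B :=
      { toFun := fun i => (f i).getRight (hs i i.2)
        invFun := fun i => ⟨f.symm (Sum.inr i), by simp [s]⟩
        left_inv := fun i => by simp
        right_inv := fun i => by simp }
    refine ⟨⟨s, p, q⟩, ?_⟩
    ext i
    obtain ⟨i | i, rfl⟩ := (Equiv.Set.sumCompl s).surjective i <;> simp [p, q]

open scoped Classical in
theorem splittingEquiv_apply {X A B : Type*} (t : Σ s : Set X, (s ≃ A) × ((sᶜ : Set X) ≃ B)) :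
    splittingEquiv t = (Equiv.Set.sumCompl t.1).symm.trans (t.2.1.sumCongr t.2.2) := rfl

open scoped Classical in
theorem sumCongr_eq_permCongr_sumCompl {X : Type*} {σ : Equiv.Perm X} (s : InvSet σ) :
    (Equiv.Set.sumCompl s.1).symm.permCongr σ = s.perm.sumCongr s.compl.perm := by
  ext i
  apply (Equiv.Set.sumCompl s.1).injective
  rcases i with i | i
  · simp
  · simp
    rfl

-- Only invariant subsets can contribute to the Frobenius formula: a permutation in block form
-- preserves its blocks.
open scoped Classical in
theorem invariant_of_sumCongr_eq {X : Type*} {σ : Equiv.Perm X} {s : Set X} {τ : Equiv.Perm s}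
    {τ' : Equiv.Perm (sᶜ : Set X)}
    (h : τ.sumCongr τ' = (Equiv.Set.sumCompl s).symm.permCongr σ) (i : X) : σ i ∈ s ↔ i ∈ s := by
  obtain ⟨j, rfl⟩ := (Equiv.Set.sumCompl s).surjective i
  have h1 : σ (Equiv.Set.sumCompl s j) = Equiv.Set.sumCompl s (τ.sumCongr τ' j) := by
    rw [h]; simp
  rw [h1]
  rcases j with j | j
  · simp
  · have h2 := (τ' j).2
    have h3 := j.2
    simp only [Set.mem_compl_iff] at h2 h3
    simp [h2, h3]

namespace R

open TGroup Finset

variable {H : Type u} [Group H] {G : Type u} [Group G] [Finite H] [Finite G]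
  {X Y : Type} [Finite X] [Finite Y]

open scoped Classical in
/-- The value at `(a, σ)` of the character of a representation induced along `ι : H → G`. -/
def evInd (ι : H →* G) (σ : Equiv.Perm X) (a : X → G) : R H →ₗ[ℤ] ℂ :=
  letI := Fintype.ofFinite (X → G)
  letI := Fintype.ofFinite (X → H)
  -- The order of the symmetric group does not appear: S_n[H] and S_n[G] contain the same
  -- permutations, and conjugating by these only renumbers.
  ((Nat.card H : ℂ) ^ Nat.card X)⁻¹ • ∑ b : X → G, ∑ c : X → H,
    if ι ∘ c = gaugeConj σ b a then ev σ c else 0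

theorem evInd_apply [i : Fintype (X → G)] [j : Fintype (X → H)] (ι : H →* G) (σ : Equiv.Perm X)
    (a : X → G) [∀ (b : X → G) (c : X → H), Decidable (ι ∘ c = gaugeConj σ b a)] (z : R H) :
    evInd ι σ a z = ((Nat.card H : ℂ) ^ Nat.card X)⁻¹ *
      ∑ b : X → G, ∑ c : X → H, if ι ∘ c = gaugeConj σ b a then ev σ c z else 0 := by
  obtain rfl : i = Fintype.ofFinite _ := Subsingleton.elim _ _
  obtain rfl : j = Fintype.ofFinite _ := Subsingleton.elim _ _
  rw [evInd, LinearMap.smul_apply, LinearMap.sum_apply, smul_eq_mul]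
  congr 1
  refine Finset.sum_congr rfl fun b _ => ?_
  rw [LinearMap.sum_apply]
  refine Finset.sum_congr rfl fun c _ => ?_
  split_ifs <;> rfl

-- The Frobenius formula, with its sum over conjugators reorganized. A conjugator is a bijection
-- from X to Fin k ⊕ Fin l together with a family b in G; the bijection amounts to a subset s with
-- numberings of s and of its complement. Block elements are pulled back along these numberings,
-- after which no summand depends on them any more.
open scoped Classical in
theorem ev_act_of_eq_sum [Fintype X] [Fintype G] [Fintype H] (ι : H →* G) {k l : ℕ}
    (e : X ≃ Fin (k + l)) (x : K0 (Wreath k H)) (y : K0 (Wreath l G)) (σ : Equiv.Perm X)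
    (a : X → G) :
    ev σ a (act ι (of H k x ⊗ₜ of G l y)) = (Nat.card (Wreath k H × Wreath l G) : ℂ)⁻¹ *
      ∑ t : Σ s : Set X, (s ≃ Fin k) × ((sᶜ : Set X) ≃ Fin l), ∑ b : X → G,
        ∑ w : (Equiv.Perm t.1 × (t.1 → H)) × (Equiv.Perm (t.1ᶜ : Set X) × ((t.1ᶜ : Set X) → G)),
        if w.1.1.sumCongr w.2.1 = (Equiv.Set.sumCompl t.1).symm.permCongr σ ∧
          Sum.elim (ι ∘ w.1.2) w.2.2 = gaugeConj σ b a ∘ Equiv.Set.sumCompl t.1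
        then ev w.1.1 w.1.2 (of H k x) * ev w.2.1 w.2.2 (of G l y) else 0 := by
  let := Fintype.ofFinite (Wreath (k + l) G)
  let := Fintype.ofFinite (Wreath k H)
  let := Fintype.ofFinite (Wreath l G)
  rw [act_of, ev_of e, K0.char_ind]
  congr 1
  rw [Finset.sum_comm, ← (conjugatorEquiv e).symm.sum_comp, Fintype.sum_prod_type,
    ← splittingEquiv.sum_comp]
  refine Finset.sum_congr rfl fun ⟨s, p, q⟩ _ => Finset.sum_congr rfl fun b _ => ?_
  rw [← ((wreathEquiv p).prodCongr (wreathEquiv q)).sum_comp]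
  refine Finset.sum_congr rfl fun ⟨⟨τ, c⟩, ⟨τ', d⟩⟩ _ => ?_
  rw [K0.char_boxtimes, ev_of p, ev_of q]
  refine if_congr ?_ rfl rfl
  rw [wreathMk_conj]
  change blockHom ι rfl (wreathMk p τ c, wreathMk q τ' d) = _ ↔ _
  rw [blockHom_wreathMk]
  -- The conjugate of (σ, a) by the element belonging to (s, p, q, b) is rewritten in the numbering
  -- of the two blocks, where it can be compared with a block element.
  have h1 : wreathMk (e.trans ((conjugatorEquiv e).symm (splittingEquiv ⟨s, p, q⟩, b)).right) σ
      (gaugeConj σ (fun i => ((conjugatorEquiv e).symm (splittingEquiv ⟨s, p, q⟩, b)).left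
        (((conjugatorEquiv e).symm (splittingEquiv ⟨s, p, q⟩, b)).right (e i))) a) =
      wreathMk ((p.sumCongr q).trans (splitEquiv rfl)) ((Equiv.Set.sumCompl s).symm.permCongr σ)
        (gaugeConj σ b a ∘ Equiv.Set.sumCompl s) := by
    have h2 : e.trans ((conjugatorEquiv e).symm (splittingEquiv ⟨s, p, q⟩, b)).right =
        (splittingEquiv ⟨s, p, q⟩).trans (splitEquiv rfl) := by
      ext i
      simp [conjugatorEquiv]
    have h3 : (fun i => ((conjugatorEquiv e).symm (splittingEquiv ⟨s, p, q⟩, b)).left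
        (((conjugatorEquiv e).symm (splittingEquiv ⟨s, p, q⟩, b)).right (e i))) = b := by
      ext i
      simp [conjugatorEquiv]
    rw [h2, h3, splittingEquiv_apply]
    rfl
  rw [h1, wreathMk_inj]

-- Since s is invariant, b and the matching condition split into parts on s and on its complement.
-- On the complement the family in G is determined by b, and its character value is independent of b
-- by conjugation invariance; this yields a power of |G|. On s there remains the sum that defines
-- `evInd`, without its normalization.
open scoped Classical in
theorem sum_conjugators_eq [Fintype X] [Fintype G] [Fintype H] (ι : H →* G) (σ : Equiv.Perm X)
    (a : X → G) (s : InvSet σ) (x : R H) (y : R G) :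
    (∑ b : X → G,
        ∑ w : (Equiv.Perm s.1 × (s.1 → H)) × (Equiv.Perm (s.1ᶜ : Set X) × ((s.1ᶜ : Set X) → G)),
        if w.1.1.sumCongr w.2.1 = (Equiv.Set.sumCompl s.1).symm.permCongr σ ∧
          Sum.elim (ι ∘ w.1.2) w.2.2 = gaugeConj σ b a ∘ Equiv.Set.sumCompl s.1
        then ev w.1.1 w.1.2 x * ev w.2.1 w.2.2 y else 0) =
      (Nat.card G : ℂ) ^ Nat.card s.compl.1 * ((∑ b : s.1 → G, ∑ c : s.1 → H,
        if ι ∘ c = gaugeConj s.perm b (fun i => a i) then ev s.perm c x else 0) *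
        ev s.compl.perm (fun i => a i) y) := by
  let E : (s.1 → G) × ((s.1ᶜ : Set X) → G) ≃ (X → G) :=
    (Equiv.sumArrowEquivProdArrow _ _ _).symm.trans
      ((Equiv.Set.sumCompl s.1).arrowCongr (Equiv.refl G))
  have hE : ∀ b, gaugeConj σ (E b) a ∘ Equiv.Set.sumCompl s.1 =
      Sum.elim (gaugeConj s.perm b.1 (fun i => a i))
        (gaugeConj s.compl.perm b.2 (fun i => a i)) := by
    intro b
    have h1 : ∀ i : s.1, E b i = b.1 i := fun i => by
      simp [E, Equiv.sumArrowEquivProdArrow, Equiv.arrowCongr]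
    have h2 : ∀ i : (s.1ᶜ : Set X), E b i = b.2 i := fun i => by
      simp [E, Equiv.sumArrowEquivProdArrow, Equiv.arrowCongr]
    ext i
    rcases i with i | i
    · simp only [Function.comp_apply, Equiv.Set.sumCompl_apply_inl, Sum.elim_inl, gaugeConj]
      rw [h1, ← InvSet.coe_perm_symm_apply, h1]
    · simp only [Function.comp_apply, Equiv.Set.sumCompl_apply_inr, Sum.elim_inr, gaugeConj]
      rw [h2, ← InvSet.coe_perm_symm_apply s.compl i, h2]
  have hcond : ∀ (b) (w : (Equiv.Perm s.1 × (s.1 → H)) ×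
      (Equiv.Perm (s.1ᶜ : Set X) × ((s.1ᶜ : Set X) → G))),
      (w.1.1.sumCongr w.2.1 = (Equiv.Set.sumCompl s.1).symm.permCongr σ ∧
        Sum.elim (ι ∘ w.1.2) w.2.2 = gaugeConj σ (E b) a ∘ Equiv.Set.sumCompl s.1) ↔
      w.2 = (s.compl.perm, gaugeConj s.compl.perm b.2 (fun i => a i)) ∧ w.1.1 = s.perm ∧
        ι ∘ w.1.2 = gaugeConj s.perm b.1 (fun i => a i) := by
    rintro b ⟨⟨τ, c⟩, ⟨τ', d⟩⟩
    rw [hE, sumCongr_eq_permCongr_sumCompl, Sum.elim_eq_iff, Prod.mk.injEq]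
    have : τ.sumCongr τ' = s.perm.sumCongr s.compl.perm ↔ τ = s.perm ∧ τ' = s.compl.perm := by
      constructor
      · intro h
        refine ⟨Equiv.ext fun i => ?_, Equiv.ext fun i => ?_⟩
        · simpa using Equiv.congr_fun h (Sum.inl i)
        · simpa using Equiv.congr_fun h (Sum.inr i)
      · rintro ⟨rfl, rfl⟩; rfl
    rw [this]
    tauto
  rw [← E.sum_comp]
  simp only [hcond]
  have hb : ∀ b : (s.1 → G) × ((s.1ᶜ : Set X) → G),
      (∑ w : (Equiv.Perm s.1 × (s.1 → H)) × (Equiv.Perm (s.1ᶜ : Set X) × ((s.1ᶜ : Set X) → G)),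
        if w.2 = (s.compl.perm, gaugeConj s.compl.perm b.2 (fun i => a i)) ∧ w.1.1 = s.perm ∧
          ι ∘ w.1.2 = gaugeConj s.perm b.1 (fun i => a i)
        then ev w.1.1 w.1.2 x * ev w.2.1 w.2.2 y else 0) =
      (∑ c : s.1 → H, if ι ∘ c = gaugeConj s.perm b.1 (fun i => a i) then ev s.perm c x else 0) *
        ev s.compl.perm (fun i => a i) y := by
    intro b
    simp only [Fintype.sum_prod_type_right (α₂ := Equiv.Perm (s.1ᶜ : Set X) × ((s.1ᶜ : Set X) → G)),
      ite_and, Finset.sum_ite_irrel, Finset.sum_const_zero]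
    -- The matching condition admits a single element over the complement, and below a single
    -- permutation of s; only the family c in H remains free.
    rw [Finset.sum_eq_single (s.compl.perm, gaugeConj s.compl.perm b.2 (fun i => a i))
      (fun _ _ h => if_neg h) (by simp), if_pos rfl, Fintype.sum_prod_type]
    simp only [Finset.sum_ite_irrel, Finset.sum_const_zero]
    rw [Finset.sum_eq_single s.perm (fun _ _ h => if_neg h) (by simp), if_pos rfl, Finset.sum_mul]
    refine Finset.sum_congr rfl fun c _ => ?_
    rw [ite_mul, zero_mul]
    exact if_congr Iff.rfl (by rw [ev_gauge s.compl.perm b.2]) rfl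
  have hsum : ∀ (F : (s.1 → G) → ℂ) (z : ℂ),
      (∑ b : (s.1 → G) × ((s.1ᶜ : Set X) → G), F b.1 * z) =
        (Nat.card G : ℂ) ^ Nat.card s.compl.1 * ((∑ b, F b) * z) := by
    intro F z
    rw [Fintype.sum_prod_type]
    simp only [Finset.sum_const, nsmul_eq_mul]
    rw [← Finset.mul_sum, ← Finset.sum_mul, Finset.card_univ, ← Nat.card_eq_fintype_card,
      Nat.card_fun, Nat.cast_pow]
  exact (Finset.sum_congr rfl fun b _ => hb b).trans (hsum (fun b => ∑ c : s.1 → H,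
    if ι ∘ c = gaugeConj s.perm b (fun i => a i) then ev s.perm c x else 0) _)

theorem evInd_of_ne (ι : H →* G) {n : ℕ} (h : Nat.card X ≠ n) (σ : Equiv.Perm X) (a : X → G)
    (x : K0 (Wreath n H)) : evInd ι σ a (of H n x) = 0 := by
  classical
  let := Fintype.ofFinite (X → G)
  let := Fintype.ofFinite (X → H)
  simp [evInd_apply, ev_of_ne h]

/-- The character of an induction product. -/
theorem ev_comp_act (ι : H →* G) (σ : Equiv.Perm X) (a : X → G) :
    ev σ a ∘ₗ act ι = ∑ s : InvSet σ, mulMap (evInd ι s.perm (fun i => a i))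
      (ev s.compl.perm (fun i => a i)) := by
  classical
  let := Fintype.ofFinite X
  let := Fintype.ofFinite H
  let := Fintype.ofFinite G
  suffices h : ∀ (k l : ℕ) (x : K0 (Wreath k H)) (y : K0 (Wreath l G)),
      ev σ a (act ι (of H k x ⊗ₜ of G l y)) = ∑ s : InvSet σ,
        evInd ι s.perm (fun i => a i) (of H k x) * ev s.compl.perm (fun i => a i) (of G l y) by
    refine TensorProduct.ext (DirectSum.linearMap_ext _ fun k => LinearMap.ext fun x =>
      DirectSum.linearMap_ext _ fun l => LinearMap.ext fun y => ?_)
    refine (h k l x y).trans ?_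
    simp [LinearMap.sum_apply]
  intro k l x y
  have hcard : ∀ s : InvSet σ, Nat.card s.1 + Nat.card s.compl.1 = Nat.card X := fun s => by
    rw [← Nat.card_sum]
    exact Nat.card_congr (Equiv.Set.sumCompl s.1)
  by_cases hn : Nat.card X = k + l
  swap
  · rw [act_of, ev_of_ne hn, Finset.sum_eq_zero]
    intro s _
    by_cases hk : Nat.card s.1 = k
    · rw [ev_of_ne (n := l), mul_zero]
      rintro hl
      exact hn (by rw [← hcard s, hk, hl])
    · rw [evInd_of_ne _ hk, zero_mul]
  let e : X ≃ Fin (k + l) := (Finite.equivFin X).trans (finCongr hn)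
  have hG : (Nat.card G : ℂ) ≠ 0 := Nat.cast_ne_zero.2 Nat.card_pos.ne'
  have hH : (Nat.card H : ℂ) ≠ 0 := Nat.cast_ne_zero.2 Nat.card_pos.ne'
  rw [ev_act_of_eq_sum ι e, Fintype.sum_sigma, Finset.mul_sum]
  -- The sum runs over all subsets, but those that are not invariant contribute nothing.
  refine Eq.symm (Finset.sum_of_injOn (Subtype.val) (Subtype.val_injective.injOn)
    (fun _ _ => Finset.mem_coe.2 (Finset.mem_univ _)) ?_ ?_)
  · intro s _ hs
    rw [Finset.sum_eq_zero, mul_zero]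
    rintro ⟨p, q⟩ _
    refine Finset.sum_eq_zero fun b _ => Finset.sum_eq_zero fun w _ => if_neg ?_
    rintro ⟨h, -⟩
    exact hs ⟨⟨s, invariant_of_sumCongr_eq h⟩, Finset.mem_coe.2 (Finset.mem_univ _), rfl⟩
  · intro s _
    refine Eq.symm ?_
    rw [Finset.sum_congr rfl fun t _ => sum_conjugators_eq ι σ a s (of H k x) (of G l y)]
    rw [Finset.sum_const, nsmul_eq_mul, Finset.card_univ, Fintype.card_prod]
    by_cases hk : Nat.card s.1 = k
    · have hl : Nat.card s.compl.1 = l := by have := hcard s; omega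
      have hp : Fintype.card (s.1 ≃ Fin k) = k.factorial := by
        rw [Fintype.card_equiv ((Finite.equivFin s.1).trans (finCongr hk)),
          ← Nat.card_eq_fintype_card, hk]
      have hq : Fintype.card ((s.1ᶜ : Set X) ≃ Fin l) = l.factorial := by
        rw [Fintype.card_equiv ((Finite.equivFin s.compl.1).trans (finCongr hl)),
          ← Nat.card_eq_fintype_card, hl]
      -- The k! l! numberings of the blocks and the factor |G|^l cancel against the group order k!
      -- |H|^k l! |G|^l, leaving the normalization of `evInd`.
      have arith : ∀ S v : ℂ, (Nat.card (Wreath k H × Wreath l G) : ℂ)⁻¹ *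
          (((k.factorial * l.factorial : ℕ) : ℂ) * ((Nat.card G : ℂ) ^ l * (S * v))) =
          ((Nat.card H : ℂ) ^ k)⁻¹ * S * v := by
        intro S v
        have := k.factorial_ne_zero
        have := l.factorial_ne_zero
        rw [Nat.card_prod, card_wreath, card_wreath]
        push_cast
        field_simp
      rw [hp, hq, hl, arith, evInd_apply, hk]
    · rw [evInd_of_ne _ hk]
      simp [ev_of_ne hk]

end R

/-! ### Rules for products of functionals -/

theorem LinearMap.finset_sum_comp {A M N P I : Type*} [CommSemiring A] [AddCommMonoid M]
    [Module A M] [AddCommMonoid N] [Module A N] [AddCommMonoid P] [Module A P] (s : Finset I)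
    (φ : I → N →ₗ[A] P) (f : M →ₗ[A] N) : (∑ i ∈ s, φ i) ∘ₗ f = ∑ i ∈ s, φ i ∘ₗ f :=
  LinearMap.ext fun x => by simp [LinearMap.sum_apply]

section MulMap

variable {A C M N P Q : Type*} [CommRing A] [CommRing C] [Algebra A C] [AddCommGroup M]
  [Module A M] [AddCommGroup N] [Module A N] [AddCommGroup P] [Module A P] [AddCommGroup Q]
  [Module A Q]

theorem mulMap_comp_map (φ : P →ₗ[A] C) (ψ : Q →ₗ[A] C) (f : M →ₗ[A] P) (g : N →ₗ[A] Q) :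
    mulMap φ ψ ∘ₗ TensorProduct.map f g = mulMap (φ ∘ₗ f) (ψ ∘ₗ g) :=
  TensorProduct.ext' fun _ _ => rfl

theorem mulMap_sum_left {I : Type*} (s : Finset I) (φ : I → M →ₗ[A] C) (ψ : N →ₗ[A] C) :
    mulMap (∑ i ∈ s, φ i) ψ = ∑ i ∈ s, mulMap (φ i) ψ :=
  TensorProduct.ext' fun x y => by simp [LinearMap.sum_apply, Finset.sum_mul]

theorem mulMap_sum_right {I : Type*} (s : Finset I) (φ : M →ₗ[A] C) (ψ : I → N →ₗ[A] C) :
    mulMap φ (∑ i ∈ s, ψ i) = ∑ i ∈ s, mulMap φ (ψ i) :=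
  TensorProduct.ext' fun x y => by simp [LinearMap.sum_apply, Finset.mul_sum]

theorem mulMap_smul_left (c : C) (φ : M →ₗ[A] C) (ψ : N →ₗ[A] C) :
    mulMap (c • φ) ψ = c • mulMap φ ψ :=
  TensorProduct.ext' fun x y => by simp [mul_assoc]

theorem mulMap_smul_right (c : C) (φ : M →ₗ[A] C) (ψ : N →ₗ[A] C) :
    mulMap φ (c • ψ) = c • mulMap φ ψ :=
  TensorProduct.ext' fun x y => by simp [mul_left_comm]

theorem mulMap_comp_tensorTensorTensorComm (φ : M →ₗ[A] C) (ψ : N →ₗ[A] C) (φ' : P →ₗ[A] C)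
    (ψ' : Q →ₗ[A] C) : mulMap (mulMap φ ψ) (mulMap φ' ψ') ∘ₗ
      (TensorProduct.tensorTensorTensorComm A M P N Q).toLinearMap =
      mulMap (mulMap φ φ') (mulMap ψ ψ') := by
  ext
  simp [mul_mul_mul_comm]

end MulMap

/-! ### Hopf powers and invariant functions -/

/-- The functions that are invariant under a permutation. -/
abbrev InvFun {X : Type*} (σ : Equiv.Perm X) (K : Type*) : Type _ := {f : X → K // f ∘ σ = f}

theorem InvFun.card_congr {X K K' : Type*} (σ : Equiv.Perm X) (e : K ≃ K') :
    Nat.card (InvFun σ K) = Nat.card (InvFun σ K') :=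
  Nat.card_congr <| ((Equiv.refl X).arrowCongr e).subtypeEquiv fun f => by
    change _ ↔ (e ∘ f) ∘ σ = e ∘ f
    rw [Function.comp_assoc, e.injective.comp_left.eq_iff]

-- An invariant function to `Option K` is its domain of definition, an invariant subset, with an
-- invariant K-valued function on it. This recursion matches the passage from Ψ^k to Ψ^(k+1).
open scoped Classical in
theorem InvFun.card_option {X K : Type*} [Finite X] [Finite K] (σ : Equiv.Perm X) :
    Nat.card (InvFun σ (Option K)) = ∑ s : InvSet σ, Nat.card (InvFun s.perm K) := by
  rw [← Nat.card_sigma]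
  refine (Nat.card_congr (Equiv.ofBijective (fun t : Σ s : InvSet σ, InvFun s.perm K =>
    (⟨fun i => if h : i ∈ t.1.1 then some (t.2.1 ⟨i, h⟩) else none, ?_⟩ : InvFun σ (Option K)))
      ⟨?_, ?_⟩)).symm
  · ext1 i
    by_cases h : i ∈ t.1.1
    · have h' := (t.1.2 i).2 h
      simp only [Function.comp_apply, h, h', dite_true]
      exact congrArg some (congrFun t.2.2 ⟨i, h⟩)
    · have h' := mt (t.1.2 i).1 h
      simp [h, h']
  · rintro ⟨s, g⟩ ⟨s', g'⟩ h
    have h := fun i => congrFun (congrArg Subtype.val h) i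
    simp only at h
    obtain rfl : s = s' := by
      refine Subtype.ext (Set.ext fun i => ?_)
      have := h i
      by_cases h1 : i ∈ s.1 <;> by_cases h2 : i ∈ s'.1 <;> simp_all
    congr 1
    refine Subtype.ext (funext fun i => ?_)
    have := h i
    simpa using this
  · rintro ⟨f, hf⟩
    let s : InvSet σ := ⟨{i | (f i).isSome}, fun i => by
      rw [Set.mem_ofPred_eq, ← Function.comp_apply (f := f), hf]; rfl⟩
    refine ⟨⟨s, ⟨fun i => (f i).get i.2, ?_⟩⟩, ?_⟩
    · ext1 i
      have := congrFun hf i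
      simp only [Function.comp_apply] at this ⊢
      simp [this]
    · refine Subtype.ext (funext fun i => ?_)
      by_cases h : (f i).isSome
      · simp [s, h]
      · have h' : f i = none := by simpa using h
        simp [s, h']

namespace R

open TGroup Finset

variable {H : Type u} [Group H] {G : Type u} [Group G] [Finite H] [Finite G]
  {X Y : Type} [Finite X] [Finite Y]

/-- When both groups agree, every b admits exactly one c, conjugate to a; the |G|^|X| equal terms
cancel the normalization. -/
theorem evInd_id (σ : Equiv.Perm X) (a : X → G) : evInd (MonoidHom.id G) σ a = ev σ a := by
  classical
  let := Fintype.ofFinite X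
  let := Fintype.ofFinite G
  refine LinearMap.ext fun z => ?_
  have hG : (Nat.card G : ℂ) ≠ 0 := Nat.cast_ne_zero.2 Nat.card_pos.ne'
  rw [evInd_apply]
  have h : ∀ b : X → G, (∑ c : X → G, if MonoidHom.id G ∘ c = gaugeConj σ b a then ev σ c z else 0)
      = ev σ a z := by
    intro b
    rw [← ev_gauge σ b a]
    exact Finset.sum_ite_eq' _ _ _ |>.trans (if_pos (Finset.mem_univ _))
  simp only [h, Finset.sum_const, nsmul_eq_mul, Finset.card_univ, ← Nat.card_eq_fintype_card,
    Nat.card_fun, Nat.cast_pow]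
  field_simp

theorem ev_comp_mul (σ : Equiv.Perm X) (a : X → G) :
    ev σ a ∘ₗ mul G = ∑ s : InvSet σ, mulMap (ev s.perm (fun i => a i))
      (ev s.compl.perm (fun i => a i)) := by
  rw [mul, ev_comp_act]
  simp only [evInd_id]

theorem mulMap_ev_comul (σ : Equiv.Perm X) (a : X → G) (τ : Equiv.Perm Y) (b : Y → G) :
    mulMap (ev σ a) (ev τ b) ∘ₗ comul G = ev (σ.sumCongr τ) (Sum.elim a b) :=
  mulMap_ev_coact (MonoidHom.id G) σ a τ b

theorem ev_sumCompl {σ : Equiv.Perm X} (s : InvSet σ) (a : X → G) :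
    ev (s.perm.sumCongr s.compl.perm) (Sum.elim (fun i => a i) (fun i => a i)) = ev σ a := by
  classical
  rw [← ev_congr (Equiv.Set.sumCompl s.1).symm σ a, sumCongr_eq_permCongr_sumCompl]
  congr 1
  ext i
  rcases i with i | i <;> simp

/-- Convolution with the identity, on characters. -/
theorem ev_convolution {f : R G →ₗ[ℤ] R G} {c : ∀ {Y : Type} [Finite Y], Equiv.Perm Y → ℂ}
    (hf : ∀ {Y : Type} [Finite Y] (τ : Equiv.Perm Y) (b : Y → G), ev τ b ∘ₗ f = c τ • ev τ b)
    (σ : Equiv.Perm X) (a : X → G) :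
    ev σ a ∘ₗ mul G ∘ₗ TensorProduct.map f .id ∘ₗ comul G =
      (∑ s : InvSet σ, c s.perm) • ev σ a := by
  rw [← LinearMap.comp_assoc, ev_comp_mul, ← LinearMap.comp_assoc, LinearMap.finset_sum_comp,
    LinearMap.finset_sum_comp, Finset.sum_smul]
  refine Finset.sum_congr rfl fun s _ => ?_
  -- Cutting X along s and gluing the pieces together again gives back (σ, a), so each s contributes
  -- a multiple of the same functional.
  rw [mulMap_comp_map, hf, LinearMap.comp_id, mulMap_smul_left, LinearMap.smul_comp,
    mulMap_ev_comul, ev_sumCompl]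

instance : Subsingleton (Wreath 0 G) :=
  ⟨fun _ _ => Wreath.ext_iff'.2 ⟨Subsingleton.elim _ _, Subsingleton.elim _ _⟩⟩

theorem ev_of_isEmpty [IsEmpty X] (σ : Equiv.Perm X) (a : X → G) :
    ev σ a = Algebra.linearMap ℤ ℂ ∘ₗ counit G := by
  refine LinearMap.ext fun z => ?_
  rw [ev_apply (Equiv.equivOfIsEmpty X (Fin 0)), Subsingleton.elim (wreathMk _ _ _) 1, K0.char_one]
  rfl

open scoped Classical in
theorem ev_unit (σ : Equiv.Perm X) (a : X → G) :
    ev σ a (unit G 1) = if IsEmpty X then 1 else 0 := by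
  rw [unit, LinearMap.toSpanSingleton_apply, one_smul]
  split_ifs with h
  · refine (ev_of (Equiv.equivOfIsEmpty X (Fin 0)) σ a _).trans ?_
    rw [Subsingleton.elim (wreathMk _ _ _) 1, K0.char_one, K0.dim, K0.lift_mk]
    simp
  · exact ev_of_ne (by rw [Ne, Finite.card_eq_zero_iff]; exact h) σ a _

open scoped Classical in
theorem ev_comp_unit_counit (σ : Equiv.Perm X) (a : X → G) :
    ev σ a ∘ₗ unit G ∘ₗ counit G = (if IsEmpty X then (1 : ℂ) else 0) • ev σ a := by
  refine LinearMap.ext fun z => ?_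
  have h1 : ∀ n : ℤ, ev σ a (unit G n) = n * ev σ a (unit G 1) := fun n => by
    rw [← zsmul_eq_mul, ← map_zsmul, ← map_zsmul]; simp
  rw [LinearMap.comp_apply, LinearMap.comp_apply, h1, ev_unit]
  split_ifs with h
  · rw [ev_of_isEmpty]; simp
  · simp

/-- Ψ^(k+2) is the convolution of Ψ^(k+1) with the identity, so its eigenvalue is the sum of the
earlier eigenvalues over all invariant subsets, which `InvFun.card_option` evaluates. -/
theorem ev_comp_hopfPower (k : ℕ) (σ : Equiv.Perm X) (a : X → G) :
    ev σ a ∘ₗ hopfPower (mul G) (comul G) (unit G) (counit G) k =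
      (Nat.card (InvFun σ (Fin k)) : ℂ) • ev σ a := by
  classical
  -- The recursion for Ψ starts at 1, so 0 and 1 are both base cases; for k = 0 an invariant
  -- function exists only on the empty set.
  induction k using Nat.twoStepInduction generalizing X with
  | zero =>
    rw [hopfPower, ev_comp_unit_counit]
    congr 1
    split_ifs with h
    · have : Unique (InvFun σ (Fin 0)) := ⟨⟨⟨fun i => h.elim i, Subsingleton.elim _ _⟩⟩,
        fun _ => Subtype.ext (Subsingleton.elim _ _)⟩
      simp
    · have : IsEmpty (InvFun σ (Fin 0)) := ⟨fun f => h ⟨fun i => (f.1 i).elim0⟩⟩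
      simp
  | one =>
    have : Unique (InvFun σ (Fin 1)) := ⟨⟨⟨fun i => 0, rfl⟩⟩,
      fun _ => Subtype.ext (Subsingleton.elim _ _)⟩
    rw [hopfPower, LinearMap.comp_id, Nat.card_unique, Nat.cast_one, one_smul]
  | more k _ ih =>
    rw [hopfPower, ev_convolution (c := fun τ => Nat.card (InvFun τ (Fin (k + 1))))
      (fun τ b => ih τ b), InvFun.card_congr σ finSuccEquivLast, InvFun.card_option]
    push_cast
    rfl

end R

/-! ### Conjugating families in H by elements of G -/

/-- A group is a product of the cosets of a subgroup with the subgroup. -/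
def quotientProdEquiv {G : Type*} [Group G] (H : Subgroup G) : G ≃ (G ⧸ H) × H where
  toFun g := (g, ⟨(g : G ⧸ H).out⁻¹ * g, QuotientGroup.eq.1 (QuotientGroup.out_eq' _)⟩)
  invFun p := p.1.out * p.2
  left_inv g := by simp
  right_inv p := by
    have h : ((p.1.out * p.2 : G) : G ⧸ H) = p.1 := by
      rw [QuotientGroup.mk_mul_of_mem _ p.2.2, QuotientGroup.out_eq']
    refine Prod.ext h (Subtype.ext ?_)
    simp [h]

theorem quotientProdEquiv_symm_mk {G : Type*} [Group G] (H : Subgroup G) (p : (G ⧸ H) × H) :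
    (((quotientProdEquiv H).symm p : G) : G ⧸ H) = p.1 := by
  have := congrArg Prod.fst ((quotientProdEquiv H).apply_symm_apply p)
  exact this

/-- By normality b a b⁻¹ lies in H, so what matters is whether b(i) b(σ⁻¹ i)⁻¹ does. -/
theorem gaugeConj_mem_iff {X G : Type*} [Group G] {H : Subgroup G} [H.Normal]
    (σ : Equiv.Perm X) (b : X → G) (a : X → H) (i : X) :
    gaugeConj σ b (H.subtype ∘ a) i ∈ H ↔ (b i : G ⧸ H) = b (σ.symm i) := by
  have h1 : b i * a i * (b i)⁻¹ ∈ H := ‹H.Normal›.conj_mem _ (a i).2 _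
  have h2 : gaugeConj σ b (H.subtype ∘ a) i =
      (b i * a i * (b i)⁻¹) * (b i * (b (σ.symm i))⁻¹) := by simp [gaugeConj, mul_assoc]
  rw [h2, H.mul_mem_cancel_left h1, ← H.inv_mem_iff, mul_inv_rev, inv_inv, eq_comm,
    QuotientGroup.eq, ‹H.Normal›.mem_comm_iff, ← H.inv_mem_iff (x := (b (σ.symm i))⁻¹ * _),
    mul_inv_rev, inv_inv,
    ← H.inv_mem_iff, mul_inv_rev, inv_inv]

open scoped Classical in
/-- The number of ways to conjugate a family in `H` to a family in `H` by elements of `G`. -/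
theorem card_gaugeConj_eq {X G : Type*} [Finite X] [Group G] [Finite G] {H : Subgroup G}
    [H.Normal] (σ : Equiv.Perm X) (a : X → H) :
    Nat.card {p : (X → G) × (X → H) // H.subtype ∘ p.2 = gaugeConj σ p.1 (H.subtype ∘ a)} =
      Nat.card (InvFun σ (Fin H.index)) * Nat.card H ^ Nat.card X := by
  have e : G ⧸ H ≃ Fin H.index := Finite.equivFin (G ⧸ H)
  rw [← InvFun.card_congr σ e, ← Nat.card_fun, ← Nat.card_prod]
  have hmk : ∀ p : {p : (X → G) × (X → H) // H.subtype ∘ p.2 = gaugeConj σ p.1 (H.subtype ∘ a)},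
      (fun i => (p.1.1 i : G ⧸ H)) ∘ σ = fun i => (p.1.1 i : G ⧸ H) := by
    rintro ⟨⟨b, c⟩, h⟩
    ext1 i
    have h1 := (gaugeConj_mem_iff σ b a (σ i)).1 (by rw [← h]; exact (c (σ i)).2)
    simpa using h1
  -- The family c is determined by b, and b amounts to a σ-invariant family of cosets with a free
  -- element of H at each index.
  refine Nat.card_congr (Equiv.ofBijective (fun p =>
    (⟨fun i => (p.1.1 i : G ⧸ H), hmk p⟩, fun i => (quotientProdEquiv H (p.1.1 i)).2)) ⟨?_, ?_⟩)
  · rintro ⟨⟨b, c⟩, h⟩ ⟨⟨b', c'⟩, h'⟩ heq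
    simp only [Prod.mk.injEq, Subtype.mk.injEq] at heq
    obtain rfl : b = b' := funext fun i => (quotientProdEquiv H).injective
      (Prod.ext (congrFun heq.1 i) (congrFun heq.2 i))
    have hc : c = c' := funext fun i => Subtype.ext (congrFun (h.trans h'.symm) i)
    simp [hc]
  · rintro ⟨⟨f, hf⟩, h⟩
    let b : X → G := fun i => (quotientProdEquiv H).symm (f i, h i)
    have hb : ∀ i, gaugeConj σ b (H.subtype ∘ a) i ∈ H := fun i => by
      rw [gaugeConj_mem_iff, quotientProdEquiv_symm_mk, quotientProdEquiv_symm_mk]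
      have := congrFun hf (σ.symm i)
      simpa using this
    refine ⟨⟨(b, fun i => ⟨_, hb i⟩), funext fun i => rfl⟩, ?_⟩
    refine Prod.ext (Subtype.ext (funext fun i => ?_)) (funext fun i => ?_)
    · exact quotientProdEquiv_symm_mk H _
    · simp [b]

theorem gaugeConj_sumElim {X Y G : Type*} [Group G] (σ : Equiv.Perm X) (τ : Equiv.Perm Y)
    (b a : X → G) (b' a' : Y → G) : gaugeConj (σ.sumCongr τ) (Sum.elim b b') (Sum.elim a a') =
      Sum.elim (gaugeConj σ b a) (gaugeConj τ b' a') := by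
  ext i
  rcases i with i | i <;> rfl

/-- If inner automorphisms of `G` restrict to inner automorphisms of `H`, then families in `H`
that are conjugate over `G` are conjugate over `H`. -/
theorem exists_gaugeConj_eq {X G : Type*} [Group G] {H : Subgroup G} [H.Normal]
    (hinn : ∀ g : G, ∃ h : H, ∀ x : H, g * (x : G) * g⁻¹ = h * x * h⁻¹)
    (σ : Equiv.Perm X) (a c : X → H) (b : X → G)
    (h : H.subtype ∘ c = gaugeConj σ b (H.subtype ∘ a)) : ∃ d : X → H, c = gaugeConj σ d a := by
  choose t ht using hinn
  -- A coset representative that centralizes H: conjugation by `q.out` agrees on H with conjugation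
  -- by t, so t⁻¹ undoes it.
  let z : G ⧸ H → G := fun q => (t q.out : G)⁻¹ * q.out
  have hz : ∀ q (x : H), z q * x * (z q)⁻¹ = x := by
    intro q x
    have := ht q.out x
    calc z q * x * (z q)⁻¹ = (t q.out : G)⁻¹ * (q.out * x * q.out⁻¹) * t q.out := by
          simp only [z]; group
      _ = x := by rw [this, H.coe_inv]; group
  have hzmk : ∀ q, (z q : G ⧸ H) = q := by
    intro q
    have h1 : z q = q.out * (q.out⁻¹ * (t q.out : G)⁻¹ * q.out⁻¹⁻¹) := by simp only [z]; group
    rw [h1, QuotientGroup.mk_mul_of_mem, QuotientGroup.out_eq']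
    exact ‹H.Normal›.conj_mem _ (H.inv_mem (t q.out).2) _
  have hd : ∀ i, b i * (z (b i))⁻¹ ∈ H := fun i => by
    have := (QuotientGroup.eq (s := H)).1 (hzmk (b i)) 
    exact ‹H.Normal›.mem_comm this
  refine ⟨fun i => ⟨_, hd i⟩, funext fun i => Subtype.ext ?_⟩
  have hi := congrFun h i
  have hq := (gaugeConj_mem_iff σ b a i).1 (by rw [← h]; exact (c i).2)
  have hzi := hz (b i) (a i)
  -- Replacing b by b z⁻¹, which lies in H, changes nothing: z commutes with a(i), and the indices i
  -- and σ⁻¹ i share a coset and therefore the same z.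
  calc (c i : G) = b i * a i * (b (σ.symm i))⁻¹ := hi
    _ = b i * ((z (b i))⁻¹ * (z (b i) * a i * (z (b i))⁻¹) * z (b i)) * (b (σ.symm i))⁻¹ := by group
    _ = b i * (z (b i))⁻¹ * a i * (b (σ.symm i) * (z (b (σ.symm i)))⁻¹)⁻¹ := by
      rw [hzi, ← hq]; group

/-! ### Induced characters on disjoint unions -/

namespace R

open TGroup Finset

variable {H : Type u} [Group H] {G : Type u} [Group G] [Finite H] [Finite G]
  {X Y : Type} [Finite X] [Finite Y]

theorem evInd_congr (ι : H →* G) (e : X ≃ Y) (σ : Equiv.Perm X) (a : X → G) :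
    evInd ι (e.permCongr σ) (a ∘ e.symm) = evInd ι σ a := by
  classical
  let := Fintype.ofFinite X
  let := Fintype.ofFinite Y
  let := Fintype.ofFinite G
  let := Fintype.ofFinite H
  refine LinearMap.ext fun z => ?_
  rw [evInd_apply, evInd_apply, Nat.card_congr e]
  congr 1
  rw [← (e.arrowCongr (Equiv.refl G)).sum_comp]
  refine Finset.sum_congr rfl fun b _ => ?_
  rw [← (e.arrowCongr (Equiv.refl H)).sum_comp]
  refine Finset.sum_congr rfl fun c _ => ?_
  have h : gaugeConj (e.permCongr σ) ((e.arrowCongr (Equiv.refl G)) b) (a ∘ e.symm) =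
      gaugeConj σ b a ∘ e.symm := by
    ext i
    have hi : (e.permCongr σ).symm i = e (σ.symm (e.symm i)) := rfl
    simp [gaugeConj, hi]
  have h' : ι ∘ ((e.arrowCongr (Equiv.refl H)) c) = (ι ∘ c) ∘ e.symm := rfl
  rw [h, h']
  refine if_congr (e.symm.surjective.injective_comp_right.eq_iff) ?_ rfl
  rw [← ev_congr e σ c]
  rfl

/-- The source of the Hopf power. Conjugators split into parts on X and on Y. Every admissible
conjugate of a is conjugate to a over H and may be replaced by a in the character, so the sum over X
becomes a pure count; its factor |H|^|X| cancels the normalization on X, and the number of invariant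
families of cosets survives. -/
theorem evInd_sumElim {G : Type u} [Group G] [Finite G] {H : Subgroup G} [H.Normal]
    (hinn : ∀ g : G, ∃ h : H, ∀ x : H, g * (x : G) * g⁻¹ = h * x * h⁻¹)
    (σ : Equiv.Perm X) (a : X → H) (τ : Equiv.Perm Y) (b : Y → G) :
    evInd H.subtype (σ.sumCongr τ) (Sum.elim (H.subtype ∘ a) b) =
      (Nat.card (InvFun σ (Fin H.index)) : ℂ) •
        (mulMap (ev σ a) (evInd H.subtype τ b) ∘ₗ comul H) := by
  classical
  let := Fintype.ofFinite X
  let := Fintype.ofFinite Y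
  let := Fintype.ofFinite G
  let := Fintype.ofFinite H
  have hH : (Nat.card H : ℂ) ≠ 0 := Nat.cast_ne_zero.2 Nat.card_pos.ne'
  refine LinearMap.ext fun z => ?_
  have h1 : (mulMap (ev σ a) (evInd H.subtype τ b) ∘ₗ comul H) z =
      ((Nat.card H : ℂ) ^ Nat.card Y)⁻¹ * ∑ b' : Y → G, ∑ c : Y → H,
        if H.subtype ∘ c = gaugeConj τ b' b then ev (σ.sumCongr τ) (Sum.elim a c) z else 0 := by
    have h2 : evInd H.subtype τ b = ((Nat.card H : ℂ) ^ Nat.card Y)⁻¹ • ∑ b' : Y → G,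
        ∑ c : Y → H, (if H.subtype ∘ c = gaugeConj τ b' b then (1 : ℂ) else 0) • ev τ c :=
      LinearMap.ext fun z => by
        rw [evInd_apply]
        simp only [LinearMap.smul_apply, LinearMap.sum_apply, smul_eq_mul]
        refine congrArg _ (Finset.sum_congr rfl fun _ _ => Finset.sum_congr rfl fun _ _ => ?_)
        split_ifs <;> simp
    rw [h2]
    simp only [mulMap_smul_right, mulMap_sum_right, LinearMap.smul_comp, LinearMap.finset_sum_comp,
      mulMap_ev_comul]
    simp only [LinearMap.smul_apply, LinearMap.sum_apply, smul_eq_mul]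
    refine congrArg _ (Finset.sum_congr rfl fun _ _ => Finset.sum_congr rfl fun _ _ => ?_)
    split_ifs <;> simp
  rw [LinearMap.smul_apply, h1, evInd_apply]
  rw [← (Equiv.sumArrowEquivProdArrow X Y G).symm.sum_comp]
  have h3 : ∀ b₁ : (X → G) × (Y → G), (∑ c : X ⊕ Y → H, if H.subtype ∘ c =
      gaugeConj (σ.sumCongr τ) ((Equiv.sumArrowEquivProdArrow X Y G).symm b₁)
        (Sum.elim (H.subtype ∘ a) b) then ev (σ.sumCongr τ) c z else 0) =
      (∑ c : X → H, if H.subtype ∘ c = gaugeConj σ b₁.1 (H.subtype ∘ a) then (1 : ℂ) else 0) *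
      ∑ c : Y → H, if H.subtype ∘ c = gaugeConj τ b₁.2 b then
        ev (σ.sumCongr τ) (Sum.elim a c) z else 0 := by
    intro b₁
    rw [← (Equiv.sumArrowEquivProdArrow X Y H).symm.sum_comp, Finset.sum_mul_sum,
      Fintype.sum_prod_type]
    refine Finset.sum_congr rfl fun c _ => Finset.sum_congr rfl fun c' _ => ?_
    have h4 : (H.subtype ∘ (Equiv.sumArrowEquivProdArrow X Y H).symm (c, c') =
        gaugeConj (σ.sumCongr τ) ((Equiv.sumArrowEquivProdArrow X Y G).symm b₁)
          (Sum.elim (H.subtype ∘ a) b)) ↔ H.subtype ∘ c = gaugeConj σ b₁.1 (H.subtype ∘ a) ∧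
          H.subtype ∘ c' = gaugeConj τ b₁.2 b := by
      change _ ∘ Sum.elim c c' = gaugeConj _ (Sum.elim b₁.1 b₁.2) _ ↔ _
      rw [gaugeConj_sumElim, Sum.comp_elim, Sum.elim_eq_iff]
    by_cases hc : H.subtype ∘ c = gaugeConj σ b₁.1 (H.subtype ∘ a)
    · rw [if_pos hc, one_mul]
      refine if_congr (h4.trans (and_iff_right hc)) ?_ rfl
      -- The conjugating family over H is d on X and 1 on Y, so the entries on Y stay as they are.
      obtain ⟨d, hd⟩ := exists_gaugeConj_eq hinn σ a c b₁.1 hc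
      rw [← ev_gauge (σ.sumCongr τ) (Sum.elim d 1) (Sum.elim a c'), gaugeConj_sumElim, ← hd]
      congr 2
      change Sum.elim c c' = Sum.elim c _
      congr 1
      ext i
      simp [gaugeConj]
    · rw [if_neg hc, zero_mul, if_neg fun h => hc (h4.1 h).1]
  have hsum : ∀ (F : (X → G) → ℂ) (F' : (Y → G) → ℂ),
      (∑ b₁ : (X → G) × (Y → G), F b₁.1 * F' b₁.2) = (∑ b, F b) * ∑ b, F' b := fun F F' => by
    rw [Fintype.sum_prod_type, Finset.sum_mul_sum]
  rw [(Finset.sum_congr rfl fun b₁ _ => h3 b₁).trans (hsum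
    (fun b₁ => ∑ c : X → H, if H.subtype ∘ c = gaugeConj σ b₁ (H.subtype ∘ a) then (1 : ℂ) else 0)
    (fun b₁ => ∑ c : Y → H, if H.subtype ∘ c = gaugeConj τ b₁ b then
        ev (σ.sumCongr τ) (Sum.elim a c) z else 0))]
  have h5 : (∑ b₁ : X → G, ∑ c : X → H,
      if H.subtype ∘ c = gaugeConj σ b₁ (H.subtype ∘ a) then (1 : ℂ) else 0) =
      Nat.card (InvFun σ (Fin H.index)) * (Nat.card H : ℂ) ^ Nat.card X := by
    rw [← Nat.cast_pow, ← Nat.cast_mul, ← card_gaugeConj_eq σ a, Nat.card_eq_fintype_card,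
      Fintype.card_subtype, Finset.card_filter, Fintype.sum_prod_type]
    push_cast
    rfl
  rw [h5, Nat.card_sum, pow_add, smul_eq_mul]
  field_simp

end R

/-! ### Invariant subsets of a disjoint union -/

namespace InvSet

variable {X Y : Type*} {σ : Equiv.Perm X} {τ : Equiv.Perm Y}

/-- The trace of an invariant subset of a disjoint union on the left summand. -/
abbrev inl (s : InvSet (σ.sumCongr τ)) : InvSet σ := ⟨Sum.inl ⁻¹' s.1, fun i => s.2 (Sum.inl i)⟩

/-- The trace of an invariant subset of a disjoint union on the right summand. -/
abbrev inr (s : InvSet (σ.sumCongr τ)) : InvSet τ := ⟨Sum.inr ⁻¹' s.1, fun i => s.2 (Sum.inr i)⟩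

/-- Invariant subsets of a disjoint union are pairs of invariant subsets. -/
def sumEquiv : InvSet (σ.sumCongr τ) ≃ InvSet σ × InvSet τ where
  toFun s := (s.inl, s.inr)
  invFun t := ⟨{i | Sum.elim (· ∈ t.1.1) (· ∈ t.2.1) i}, by
    rintro (i | i)
    · exact t.1.2 i
    · exact t.2.2 i⟩
  left_inv s := by
    refine Subtype.ext (Set.ext ?_)
    rintro (i | i) <;> rfl
  right_inv t := rfl

/-- An invariant subset of a disjoint union is the disjoint union of its traces. -/
def carrierEquiv (s : InvSet (σ.sumCongr τ)) : s.inl.1 ⊕ s.inr.1 ≃ s.1 :=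
  (Equiv.subtypeSum (p := fun i => i ∈ s.1)).symm

theorem carrierEquiv_permCongr (s : InvSet (σ.sumCongr τ)) :
    s.carrierEquiv.permCongr (s.inl.perm.sumCongr s.inr.perm) = s.perm := by
  refine Equiv.ext fun i => ?_
  obtain ⟨i | i, rfl⟩ := s.carrierEquiv.surjective i
  · rw [Equiv.permCongr_apply, Equiv.symm_apply_apply]
    rfl
  · rw [Equiv.permCongr_apply, Equiv.symm_apply_apply]
    rfl

theorem elim_comp_carrierEquiv_symm {K : Type*} (s : InvSet (σ.sumCongr τ)) (a : X → K)
    (b : Y → K) : Sum.elim (fun i : s.inl.1 => a i) (fun i : s.inr.1 => b i) ∘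
      s.carrierEquiv.symm = fun i : s.1 => Sum.elim a b i := by
  ext i
  obtain ⟨i | i, rfl⟩ := s.carrierEquiv.surjective i
  · rw [Function.comp_apply, Equiv.symm_apply_apply]
    rfl
  · rw [Function.comp_apply, Equiv.symm_apply_apply]
    rfl

end InvSet

theorem mulMap_comp_assoc {A C M N P : Type*} [CommRing A] [CommRing C] [Algebra A C]
    [AddCommGroup M] [Module A M] [AddCommGroup N] [Module A N] [AddCommGroup P] [Module A P]
    (φ : M →ₗ[A] C) (ψ : N →ₗ[A] C) (χ : P →ₗ[A] C) :
    mulMap φ (mulMap ψ χ) ∘ₗ (TensorProduct.assoc A M N P).toLinearMap =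
      mulMap (mulMap φ ψ) χ := by
  refine TensorProduct.ext_threefold fun x y z => ?_
  simp [mul_assoc]

theorem comp_lid_eq_mulMap {A C M : Type*} [CommRing A] [CommRing C] [Algebra A C]
    [AddCommGroup M] [Module A M] (φ : M →ₗ[A] C) :
    φ ∘ₗ (TensorProduct.lid A M).toLinearMap = mulMap (Algebra.linearMap A C) φ :=
  TensorProduct.ext' fun x y => by simp [Algebra.smul_def]

/-! ### Bialgebra and module identities, checked on characters -/

namespace R

open TGroup Finset

variable {H : Type u} [Group H] {G : Type u} [Group G] [Finite H] [Finite G]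
  {X Y : Type} [Finite X] [Finite Y]

theorem ev_invSet_sum {σ : Equiv.Perm X} {τ : Equiv.Perm Y} (s : InvSet (σ.sumCongr τ))
    (a : X → G) (b : Y → G) : ev s.perm (fun i => Sum.elim a b i) =
      ev (s.inl.perm.sumCongr s.inr.perm) (Sum.elim (fun i => a i) (fun i => b i)) := by
  rw [← ev_congr s.carrierEquiv, s.carrierEquiv_permCongr, s.elim_comp_carrierEquiv_symm]

theorem evInd_invSet_sum (ι : H →* G) {σ : Equiv.Perm X} {τ : Equiv.Perm Y}
    (s : InvSet (σ.sumCongr τ)) (a : X → G) (b : Y → G) :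
    evInd ι s.perm (fun i => Sum.elim a b i) =
      evInd ι (s.inl.perm.sumCongr s.inr.perm) (Sum.elim (fun i => a i) (fun i => b i)) := by
  rw [← evInd_congr ι s.carrierEquiv, s.carrierEquiv_permCongr, s.elim_comp_carrierEquiv_symm]

/-- Linear maps to `R(H) ⊗ R(G)` are determined by characters. -/
theorem ext_ev_tensor {M : Type*} [AddCommGroup M] [Module ℤ M] {f g : M →ₗ[ℤ] R H ⊗[ℤ] R G}
    (h : ∀ {X Y : Type} [Finite X] [Finite Y] (σ : Equiv.Perm X) (a : X → H) (τ : Equiv.Perm Y)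
      (b : Y → G), mulMap (ev σ a) (ev τ b) ∘ₗ f = mulMap (ev σ a) (ev τ b) ∘ₗ g) : f = g :=
  LinearMap.ext fun x => ((separates_ev H).mulMap (separates_ev G)).ext fun _ =>
    LinearMap.congr_fun (h _ _ _ _) x

/-- Linear maps to `R(G)` are determined by characters. -/
theorem ext_ev {M : Type*} [AddCommGroup M] [Module ℤ M] {f g : M →ₗ[ℤ] R G}
    (h : ∀ {X : Type} [Finite X] (σ : Equiv.Perm X) (a : X → G), ev σ a ∘ₗ f = ev σ a ∘ₗ g) :
    f = g :=
  LinearMap.ext fun x => (separates_ev G).ext fun _ => LinearMap.congr_fun (h _ _) x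

/-- On the left, restriction glues X and Y and the action sums over invariant subsets of X ⊔ Y. On
the right, multiplication sums over invariant s in X and the action over invariant t in Y, while f
contributes the scalar of s. The summands of (s, t) agree by `hι` on s ⊔ t and by plain restriction
on the complements. Abstracting f and c lets one argument serve both the Hopf algebra and the
module. -/
theorem coact_act_of_evInd {ι : H →* G} {f : R H →ₗ[ℤ] R H}
    {c : ∀ {Y : Type} [Finite Y], Equiv.Perm Y → ℂ}
    (hf : ∀ {Y : Type} [Finite Y] (τ : Equiv.Perm Y) (b : Y → H), ev τ b ∘ₗ f = c τ • ev τ b)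
    (hι : ∀ {X Y : Type} [Finite X] [Finite Y] (σ : Equiv.Perm X) (a : X → H) (τ : Equiv.Perm Y)
      (b : Y → G), evInd ι (σ.sumCongr τ) (Sum.elim (ι ∘ a) b) =
        c σ • (mulMap (ev σ a) (evInd ι τ b) ∘ₗ comul H)) :
    coact ι ∘ₗ act ι = TensorProduct.map (mul H) (act ι) ∘ₗ
      TensorProduct.map (TensorProduct.map f .id) .id ∘ₗ
      (TensorProduct.tensorTensorTensorComm ℤ (R H) (R H) (R H) (R G)).toLinearMap ∘ₗ
      TensorProduct.map (comul H) (coact ι) := by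
  refine ext_ev_tensor fun {X Y} _ _ σ a τ b => ?_
  have h1 : mulMap (ev σ a) (ev τ b) ∘ₗ TensorProduct.map (mul H) (act ι) ∘ₗ
      TensorProduct.map (TensorProduct.map f .id) .id ∘ₗ
      (TensorProduct.tensorTensorTensorComm ℤ (R H) (R H) (R H) (R G)).toLinearMap ∘ₗ
      TensorProduct.map (comul H) (coact ι) = ∑ s : InvSet σ, ∑ t : InvSet τ,
        c s.perm • mulMap (mulMap (ev s.perm (fun i => a i)) (evInd ι t.perm (fun i => b i)) ∘ₗ
          comul H) (mulMap (ev s.compl.perm (fun i => a i)) (ev t.compl.perm (fun i => b i)) ∘ₗ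
          coact ι) := by
    simp only [← LinearMap.comp_assoc]
    rw [mulMap_comp_map, mulMap_comp_map, LinearMap.comp_id, ev_comp_mul, ev_comp_act,
      LinearMap.finset_sum_comp, mulMap_sum_left, LinearMap.finset_sum_comp,
      LinearMap.finset_sum_comp]
    refine Finset.sum_congr rfl fun s _ => ?_
    rw [mulMap_sum_right, LinearMap.finset_sum_comp, LinearMap.finset_sum_comp]
    refine Finset.sum_congr rfl fun t _ => ?_
    rw [mulMap_comp_map, hf, LinearMap.comp_id, mulMap_smul_left, mulMap_smul_left,
      LinearMap.smul_comp, mulMap_comp_tensorTensorTensorComm, LinearMap.smul_comp,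
      mulMap_comp_map]
  rw [h1, ← LinearMap.comp_assoc, mulMap_ev_coact, ev_comp_act, ← Fintype.sum_prod_type',
    ← InvSet.sumEquiv.sum_comp]
  refine Finset.sum_congr rfl fun s _ => ?_
  rw [evInd_invSet_sum, ev_invSet_sum s.compl]
  have h2 := hι s.inl.perm (fun i => a i) s.inr.perm (fun i => b i)
  have h3 := mulMap_ev_coact ι s.compl.inl.perm (fun i => a i) s.compl.inr.perm (fun i => b i)
  change mulMap (evInd ι (s.inl.perm.sumCongr s.inr.perm)
    (Sum.elim (ι ∘ fun i => a i) fun i => b i)) (ev (s.compl.inl.perm.sumCongr s.compl.inr.perm)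
    (Sum.elim (ι ∘ fun i => a i) fun i => b i)) = _
  rw [h2, ← h3, mulMap_smul_left]
  rfl

/-- The case H = G: induced values are plain values and the scalar is 1. -/
theorem comul_comp_mul : comul G ∘ₗ mul G = TensorProduct.map (mul G) (mul G) ∘ₗ
      (TensorProduct.tensorTensorTensorComm ℤ (R G) (R G) (R G) (R G)).toLinearMap ∘ₗ
      TensorProduct.map (comul G) (comul G) := by
  have h := coact_act_of_evInd (ι := MonoidHom.id G) (f := .id) (c := fun _ => 1)
    (fun τ b => by rw [one_smul, LinearMap.comp_id]) (fun σ a τ b => by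
      rw [evInd_id, evInd_id, mulMap_ev_comul, one_smul]; rfl)
  rw [TensorProduct.map_id, TensorProduct.map_id, LinearMap.id_comp] at h
  exact h

/-- Both sides evaluate at three blocks glued together, and the two bracketings differ by a
renumbering. -/
theorem coact_coassoc (ι : H →* G) :
    (TensorProduct.assoc ℤ (R H) (R H) (R G)).toLinearMap ∘ₗ
      TensorProduct.map (comul H) .id ∘ₗ coact ι =
      TensorProduct.map .id (coact ι) ∘ₗ coact ι := by
  refine LinearMap.ext fun z =>
    ((separates_ev H).mulMap ((separates_ev H).mulMap (separates_ev G))).ext ?_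
  rintro ⟨⟨_, σ, a⟩, ⟨_, τ, b⟩, ⟨_, π, c⟩⟩
  refine LinearMap.congr_fun (f := mulMap (ev σ a) (mulMap (ev τ b) (ev π c)) ∘ₗ _)
    (g := mulMap (ev σ a) (mulMap (ev τ b) (ev π c)) ∘ₗ _) ?_ z
  simp only [← LinearMap.comp_assoc]
  rw [mulMap_comp_assoc, mulMap_comp_map, mulMap_comp_map, LinearMap.comp_id, LinearMap.comp_id,
    mulMap_ev_coact, mulMap_ev_comul, mulMap_ev_coact, mulMap_ev_coact,
    ← ev_congr (Equiv.sumAssoc _ _ _)]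
  congr 1
  · ext i; rcases i with i | i | i <;> rfl
  · ext i; rcases i with i | i | i <;> rfl

/-- The counit is evaluation on the empty set, and gluing on an empty block is a renumbering. -/
theorem coact_counit (ι : H →* G) : (TensorProduct.lid ℤ (R G)).toLinearMap ∘ₗ
    TensorProduct.map (counit H) .id ∘ₗ coact ι = .id := by
  refine ext_ev fun {X} _ σ a => ?_
  rw [← LinearMap.comp_assoc, comp_lid_eq_mulMap, ← LinearMap.comp_assoc, mulMap_comp_map,
    LinearMap.comp_id, ← ev_of_isEmpty (1 : Equiv.Perm Empty) Empty.elim,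
    mulMap_ev_coact, ← ev_congr (Equiv.emptySum Empty X)]
  congr 1

theorem comul_comm : (TensorProduct.comm ℤ (R G) (R G)).toLinearMap ∘ₗ comul G = comul G := by
  refine ext_ev_tensor fun {X Y} _ _ σ a τ b => ?_
  have h : mulMap (ev σ a) (ev τ b) ∘ₗ (TensorProduct.comm ℤ (R G) (R G)).toLinearMap =
      mulMap (ev τ b) (ev σ a) := TensorProduct.ext' fun x y => by simp [mul_comm]
  rw [← LinearMap.comp_assoc, h, mulMap_ev_comul, mulMap_ev_comul,
    ← ev_congr (Equiv.sumComm _ _)]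
  congr 1
  · ext i; rcases i with i | i <;> rfl
  · ext i; rcases i with i | i <;> rfl

theorem isAdjoint_mul : IsAdjoint (mul G) (comul G) := isAdjoint_act _

theorem act_assoc (ι : H →* G) : act ι ∘ₗ TensorProduct.map (mul H) .id =
    act ι ∘ₗ TensorProduct.map .id (act ι) ∘ₗ
      (TensorProduct.assoc ℤ (R H) (R H) (R G)).toLinearMap :=
  IsAdjoint.act_assoc isAdjoint_mul (isAdjoint_act ι) (coact_coassoc ι)

theorem mul_comm' : mul G ∘ₗ (TensorProduct.comm ℤ (R G) (R G)).toLinearMap = mul G := by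
  have h := isAdjoint_mul.comp (isAdjoint_comm (M := R G) (N := R G))
  rw [comul_comm] at h
  exact h.left_unique isAdjoint_mul

theorem comul_counit : (TensorProduct.rid ℤ (R G)).toLinearMap ∘ₗ
    TensorProduct.map .id (counit G) ∘ₗ comul G = .id := by
  have h : (TensorProduct.rid ℤ (R G)).toLinearMap ∘ₗ TensorProduct.map .id (counit G) =
      (TensorProduct.lid ℤ (R G)).toLinearMap ∘ₗ TensorProduct.map (counit G) .id ∘ₗ
        (TensorProduct.comm ℤ (R G) (R G)).toLinearMap :=
    TensorProduct.ext' fun x y => by simp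
  rw [← LinearMap.comp_assoc, h, LinearMap.comp_assoc, LinearMap.comp_assoc, comul_comm]
  exact coact_counit _

/-- The character of the unit is the indicator of the empty index set, and a disjoint union is empty
exactly when both parts are. -/
theorem comul_unit : comul G (unit G 1) = unit G 1 ⊗ₜ unit G 1 := by
  classical
  refine ((separates_ev G).mulMap (separates_ev G)).ext ?_
  rintro ⟨⟨m, σ, a⟩, ⟨n, τ, b⟩⟩
  have h := LinearMap.congr_fun (mulMap_ev_comul σ a τ b) (unit G 1)
  refine h.trans ?_
  rw [mulMap_tmul, ev_unit, ev_unit, ev_unit, isEmpty_sum]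
  split_ifs <;> simp_all

theorem counit_unit : counit G (unit G 1) = 1 := by
  have h := ev_unit (1 : Equiv.Perm Empty) (Empty.elim : Empty → G)
  rw [ev_of_isEmpty, if_pos (inferInstance : IsEmpty Empty)] at h
  exact Int.cast_injective (α := ℂ) (h.trans Int.cast_one.symm)

/-- Since S_0[G] is trivial, pairing with its trivial representation is the dimension of the degree
0 component. -/
theorem isAdjoint_unit : IsAdjoint (unit G) (counit G) := by
  refine isAdjoint_of_basis ?_
  rintro ⟨⟩ j
  generalize (basis (M := R G)) j = z
  have h1 : (basis (M := ℤ)) () = (1 : ℤ) := Module.Basis.singleton_apply Unit ℤ ()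
  rw [h1, form_int, one_mul, unit, LinearMap.toSpanSingleton_apply, one_smul]
  refine Int.cast_injective (α := ℂ) ?_
  let : Fintype (Wreath 0 G) := Fintype.ofFinite _
  let : Unique (Wreath 0 G) := ⟨⟨1⟩, fun _ => Subsingleton.elim _ _⟩
  rw [form_of, K0.charForm_apply, K0.charPair_eq_sum, Fintype.sum_unique, Nat.card_unique,
    Subsingleton.elim (default : Wreath 0 G) 1, inv_one, K0.char_one, K0.char_one]
  simp [K0.dim, counit]
  rfl

theorem act_unit (ι : H →* G) : act ι ∘ₗ TensorProduct.map (unit H) .id =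
    (TensorProduct.lid ℤ (R G)).toLinearMap :=
  IsAdjoint.act_unit isAdjoint_unit (isAdjoint_act ι) (coact_counit ι)

theorem mul_unit : mul G ∘ₗ TensorProduct.map .id (unit G) =
    (TensorProduct.rid ℤ (R G)).toLinearMap := by
  have h : (TensorProduct.comm ℤ (R G) (R G)).toLinearMap ∘ₗ TensorProduct.map .id (unit G) =
      TensorProduct.map (unit G) .id ∘ₗ (TensorProduct.comm ℤ (R G) ℤ).toLinearMap :=
    TensorProduct.ext' fun x y => by simp
  rw [← mul_comm', LinearMap.comp_assoc, h, ← LinearMap.comp_assoc]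
  exact (congrArg (· ∘ₗ (TensorProduct.comm ℤ (R G) ℤ).toLinearMap)
    (act_unit (MonoidHom.id G))).trans (TensorProduct.ext' fun x y => by simp)

theorem counit_mul : counit G ∘ₗ mul G =
    (TensorProduct.lid ℤ ℤ).toLinearMap ∘ₗ TensorProduct.map (counit G) (counit G) :=
  IsAdjoint.counit_mul isAdjoint_mul isAdjoint_unit comul_unit

theorem isPositiveMap_unit : IsPositiveMap (unit G) := by
  refine isPositiveMap_of_basis ?_
  rintro ⟨⟩
  have h1 : (basis (M := ℤ)) () = (1 : ℤ) := Module.Basis.singleton_apply Unit ℤ ()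
  rw [h1, unit, LinearMap.toSpanSingleton_apply, one_smul]
  exact isPositive_of_mk _ _

theorem isGradedMap_unit : IsGradedMap (unit G) := by
  intro n x hx
  by_cases h : n = 0
  · subst h
    rw [unit, LinearMap.toSpanSingleton_apply]
    exact Submodule.smul_mem _ _ ⟨_, rfl⟩
  · have hx' : x ∈ (if n = 0 then ⊤ else ⊥ : Submodule ℤ ℤ) := hx
    rw [if_neg h, Submodule.mem_bot] at hx'
    rw [hx', map_zero]
    exact Submodule.zero_mem _

theorem isGradedMap_counit : IsGradedMap (counit G) := by
  rintro n _ ⟨x, rfl⟩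
  change _ ∈ (if n = 0 then ⊤ else ⊥ : Submodule ℤ ℤ)
  split_ifs with h
  · trivial
  · rw [Submodule.mem_bot, counit, LinearMap.comp_apply, DirectSum.component.of, dif_neg h,
      map_zero]

theorem unit_counit_of_mem_grade {z : R G} (hz : z ∈ GradedTGroup.grade (M := R G) 0) :
    unit G (counit G z) = z := by
  classical
  obtain ⟨x, rfl⟩ := hz
  refine (separates_ev G).ext ?_
  rintro ⟨n, σ, a⟩
  refine (LinearMap.congr_fun (ev_comp_unit_counit σ a) (of G 0 x)).trans ?_
  split_ifs with h
  · rw [one_smul]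
  · rw [zero_smul]
    exact (ev_of_ne (by rwa [Ne, Finite.card_eq_zero_iff]) σ a x).symm

end R

/-! ### The antipode and sums of signs over invariant subsets -/

/-- The tensor product of a representation with a one-dimensional character. -/
def FinRep.twist {G : Type u} [Group G] (χ : G →* ℂˣ) (A : FinRep G) : FinRep G :=
  ⟨A.V, {
    toFun := fun g => (χ g : ℂ) • A.ρ g
    map_one' := by simp
    map_mul' := fun g h => by simp [smul_smul, mul_comm] }⟩

/-- Tensor product with a one-dimensional character on the Grothendieck group. -/
def K0.twist {G : Type u} [Group G] (χ : G →* ℂˣ) : K0 G →ₗ[ℤ] K0 G :=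
  lift (fun A => mk (A.twist χ)) fun A B C f g h => mk_eq_add
    (f := (⟨f.toLinearMap, fun x => LinearMap.ext fun a =>
      (f.toLinearMap.map_smul (χ x : ℂ) (A.ρ x a)).trans
        (congrArg ((χ x : ℂ) • ·) (LinearMap.congr_fun (f.isIntertwining' x) a))⟩ :
      (A.twist χ).ρ.IntertwiningMap (B.twist χ).ρ))
    (g := (⟨g.toLinearMap, fun x => LinearMap.ext fun a =>
      (g.toLinearMap.map_smul (χ x : ℂ) (B.ρ x a)).trans
        (congrArg ((χ x : ℂ) • ·) (LinearMap.congr_fun (g.isIntertwining' x) a))⟩ :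
      (B.twist χ).ρ.IntertwiningMap (C.twist χ).ρ)) h

theorem K0.char_twist {G : Type u} [Group G] [Finite G] (χ : G →* ℂˣ) (x : K0 G) (g : G) :
    char (twist χ x) g = χ g * char x g := by
  refine induction (p := fun x => char (twist χ x) g = χ g * char x g) (by simp) (fun A => ?_)
    (fun x hx => by simp [hx]) (fun x y hx hy => by simp [hx, hy, mul_add]) x
  rw [twist, lift_mk, char_mk, char_mk]
  exact (LinearMap.map_smul (LinearMap.trace ℂ A.V) (χ g : ℂ) (A.ρ g))

open scoped Classical in
/-- The sign `(-1)^c`, where `c` is the number of cycles. -/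
def cycleSign {X : Type*} [Finite X] (σ : Equiv.Perm X) : ℤ :=
  letI := Fintype.ofFinite X
  -- A cycle of length m contributes (-1)^m here and (-1)^(m-1) to the sign, together -1; fixed
  -- points count as cycles.
  (-1) ^ Nat.card X * (Equiv.Perm.sign σ : ℤ)

theorem cycleSign_eq {X : Type*} [Fintype X] [DecidableEq X] (σ : Equiv.Perm X) :
    cycleSign σ = (-1) ^ Nat.card X * (Equiv.Perm.sign σ : ℤ) := by
  rw [cycleSign]
  congr!

-- A fixed point is treated separately: its `cycleOf` is the identity, with empty support, although
-- its orbit has one element.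
open scoped Classical in
theorem sign_cycleOf_eq {X : Type*} [Fintype X] (σ : Equiv.Perm X) (x : X) :
    (Equiv.Perm.sign (σ.cycleOf x) : ℤ) =
      -(-1) ^ Nat.card ({i | σ.SameCycle x i} : Set X) := by
  by_cases h : σ x = x
  · have hC : {i | σ.SameCycle x i} = {x} := by
      ext i
      simp only [Set.mem_ofPred_eq, Set.mem_singleton_iff]
      refine ⟨fun hi => (Equiv.Perm.SameCycle.eq_of_left hi h).symm, ?_⟩
      rintro rfl; exact Equiv.Perm.SameCycle.refl _ _
    rw [hC, (Equiv.Perm.cycleOf_eq_one_iff σ).2 h]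
    simp
  · rw [(Equiv.Perm.isCycle_cycleOf σ h).sign]
    have hC : Nat.card ({i | σ.SameCycle x i} : Set X) = (σ.cycleOf x).support.card := by
      rw [Nat.card_coe_set_eq, ← Set.ncard_coe_finset]
      congr 1
      ext i
      rw [Set.mem_ofPred_eq, Finset.mem_coe, Equiv.Perm.mem_support_cycleOf_iff,
        Equiv.Perm.mem_support, and_iff_left h]
    rw [hC]
    simp

namespace InvSet

variable {X : Type*} {σ : Equiv.Perm X}

/-- Adding the cycle of `x` to an invariant subset, or removing it. -/
def toggle (x : X) (s : InvSet σ) : InvSet σ :=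
  ⟨symmDiff s.1 {i | σ.SameCycle x i}, fun i => by
    simp only [Set.mem_symmDiff, s.2 i, Set.mem_ofPred_eq, Equiv.Perm.sameCycle_apply_right]⟩

theorem toggle_toggle (x : X) (s : InvSet σ) : (s.toggle x).toggle x = s :=
  Subtype.ext (symmDiff_symmDiff_cancel_right _ _)

theorem mem_toggle (x : X) (s : InvSet σ) : x ∈ (s.toggle x).1 ↔ x ∉ s.1 := by
  have : σ.SameCycle x x := Equiv.Perm.SameCycle.refl _ _
  simp [toggle, Set.mem_symmDiff, this]

/-- Toggling here adds the cycle of x. Extended by the identity to X, the permutation of the larger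
subset is that of s times this cycle, so size and sign together change the value by -1. -/
theorem cycleSign_toggle_of_notMem [Finite X] {x : X} {s : InvSet σ} (h : x ∉ s.1) :
    cycleSign (s.toggle x).perm = -cycleSign s.perm := by
  classical
  let := Fintype.ofFinite X
  -- An invariant subset that misses x misses the whole cycle of x.
  have hdisj : ∀ i, i ∈ s.1 → ¬ σ.SameCycle x i := by
    rintro i hi ⟨n, rfl⟩
    refine h ?_
    have : ∀ n : ℤ, (σ ^ n) x ∈ s.1 ↔ x ∈ s.1 := by
      intro n
      induction n with
      | zero => simp
      | succ n ih => rw [add_comm, zpow_add, zpow_one, Equiv.Perm.mul_apply, s.2, ih]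
      | pred n ih => rw [← s.2, ← Equiv.Perm.mul_apply, ← zpow_one_add, add_sub_cancel, ih]
    exact (this n).1 hi
  have hcard : Nat.card (s.toggle x).1 = Nat.card s.1 +
      Nat.card ({i | σ.SameCycle x i} : Set X) := by
    have hd : Disjoint s.1 {i | σ.SameCycle x i} :=
      Set.disjoint_left.2 fun i hi hi' => hdisj i hi hi'
    rw [Nat.card_coe_set_eq, Nat.card_coe_set_eq, Nat.card_coe_set_eq,
      ← Set.ncard_union_eq hd]
    congr 1
    exact hd.symmDiff_eq_sup
  have hmul : Equiv.Perm.ofSubtype (s.toggle x).perm =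
      Equiv.Perm.ofSubtype s.perm * σ.cycleOf x := by
    ext i
    rw [Equiv.Perm.mul_apply, Equiv.Perm.cycleOf_apply]
    by_cases hi : σ.SameCycle x i
    · have h1 : i ∉ s.1 := fun h => hdisj i h hi
      have h2 : i ∈ (s.toggle x).1 := Or.inr ⟨hi, h1⟩
      have h3 : σ i ∉ s.1 := mt (s.2 i).1 h1
      rw [if_pos hi, Equiv.Perm.ofSubtype_apply_of_mem _ h2,
        Equiv.Perm.ofSubtype_apply_of_not_mem _ h3]
      rfl
    · rw [if_neg hi]
      by_cases h1 : i ∈ s.1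
      · have h2 : i ∈ (s.toggle x).1 := Or.inl ⟨h1, hi⟩
        rw [Equiv.Perm.ofSubtype_apply_of_mem _ h2, Equiv.Perm.ofSubtype_apply_of_mem _ h1]
        rfl
      · have h2 : i ∉ (s.toggle x).1 := by
          rintro (h | h)
          · exact h1 h.1
          · exact hi h.1
        rw [Equiv.Perm.ofSubtype_apply_of_not_mem _ h2, Equiv.Perm.ofSubtype_apply_of_not_mem _ h1]
  rw [cycleSign_eq, cycleSign_eq, ← Equiv.Perm.sign_ofSubtype (s.toggle x).perm, hmul, map_mul,
    Units.val_mul, Equiv.Perm.sign_ofSubtype, sign_cycleOf_eq, hcard, pow_add]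
  have : ((-1 : ℤ) ^ Nat.card ({i | σ.SameCycle x i} : Set X)) *
      (-1 : ℤ) ^ Nat.card ({i | σ.SameCycle x i} : Set X) = 1 := by
    rw [← mul_pow]; simp
  linear_combination (-(-1 : ℤ) ^ Nat.card s.1 * (Equiv.Perm.sign s.perm : ℤ)) * this

-- If some x exists, toggling its cycle is an involution that reverses signs and fixes no subset,
-- since it changes whether x belongs. On the empty set only the empty subset remains.
open scoped Classical in
theorem sum_cycleSign [Finite X] (σ : Equiv.Perm X) :
    ∑ s : InvSet σ, cycleSign s.perm = if IsEmpty X then 1 else 0 := by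
  split_ifs with h
  · let : Unique (InvSet σ) := ⟨⟨⟨∅, fun i => h.elim i⟩⟩, fun s =>
      Subtype.ext (Subsingleton.elim _ _)⟩
    rw [Fintype.sum_unique, cycleSign]
    have : Subsingleton (Equiv.Perm (default : InvSet σ).1) := inferInstance
    rw [Subsingleton.elim (default : InvSet σ).perm 1]
    simp
  · rw [not_isEmpty_iff] at h
    obtain ⟨x⟩ := h
    have key : ∀ s : InvSet σ, cycleSign (s.toggle x).perm = -cycleSign s.perm := by
      intro s
      by_cases hx : x ∈ s.1
      · have := cycleSign_toggle_of_notMem (x := x) (s := s.toggle x)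
          (by rw [mem_toggle]; exact not_not.2 hx)
        rw [toggle_toggle] at this
        rw [this, neg_neg]
      · exact cycleSign_toggle_of_notMem hx
    refine Finset.sum_involution (fun s _ => s.toggle x) (fun s _ => ?_) (fun s _ _ h => ?_)
      (fun _ _ => Finset.mem_univ _) (fun s _ => toggle_toggle x s)
    · rw [key, add_neg_cancel]
    · have := mem_toggle x s
      rw [h] at this
      tauto

end InvSet

/-! ### Hopf and PSH-algebra axioms for `R G` -/

namespace R

open TGroup Finset

variable {G : Type u} [Group G] {X : Type} [Finite X]

/-- The sign character of a wreath product. -/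
def wreathSign (G : Type u) [Group G] (n : ℕ) : Wreath n G →* ℂˣ :=
  (Units.map (Int.castRingHom ℂ).toMonoidHom).comp
    (Equiv.Perm.sign.comp SemidirectProduct.rightHom)

/-- The antipode of `R(G)`: `(-1)^n` times the tensor product with the sign character. -/
def antipode (G : Type u) [Group G] : R G →ₗ[ℤ] R G :=
  DirectSum.toModule ℤ ℕ _ fun n => (-1 : ℤ) ^ n • (of G n ∘ₗ K0.twist (wreathSign G n))

theorem antipode_of (n : ℕ) (x : K0 (Wreath n G)) :
    antipode G (of G n x) = (-1 : ℤ) ^ n • of G n (K0.twist (wreathSign G n) x) := by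
  rw [antipode, of, DirectSum.toModule_lof]
  rfl

variable [Finite G]

/-- The twist multiplies the value by the sign of σ, and (-1)^n completes it to (-1)^c: formally the
eigenvalue k^c of Ψ^k at k = -1. -/
theorem ev_comp_antipode (σ : Equiv.Perm X) (a : X → G) :
    ev σ a ∘ₗ antipode G = (cycleSign σ : ℂ) • ev σ a := by
  classical
  let := Fintype.ofFinite X
  refine DirectSum.linearMap_ext _ fun n => LinearMap.ext fun x => ?_
  change ev σ a (antipode G (of G n x)) = (cycleSign σ : ℂ) • ev σ a (of G n x)
  rw [antipode_of, LinearMap.map_smul]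
  by_cases h : Nat.card X = n
  · let e : X ≃ Fin n := (Finite.equivFin X).trans (finCongr h)
    rw [ev_of e, ev_of e, K0.char_twist, cycleSign_eq, h]
    have : (wreathSign G n (wreathMk e σ a) : ℂ) = ((Equiv.Perm.sign σ : ℤ) : ℂ) := by
      simp [wreathSign, wreathMk]
    rw [this]
    simp
    ring
  · rw [ev_of_ne h, ev_of_ne h, smul_zero, smul_zero]

theorem isGradedMap_antipode : IsGradedMap (antipode G) := by
  rintro n _ ⟨x, rfl⟩
  exact (antipode_of n x).symm ▸ Submodule.smul_mem _ _ ⟨_, rfl⟩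

/-- On `ev σ a` the convolution has as eigenvalue the sum of cycle signs over invariant subsets,
which is the eigenvalue of e ∘ e*. -/
theorem mul_antipode_comul :
    mul G ∘ₗ TensorProduct.map (antipode G) .id ∘ₗ comul G = unit G ∘ₗ counit G := by
  classical
  refine ext_ev fun {X} _ σ a => ?_
  rw [ev_convolution (c := fun τ => (cycleSign τ : ℂ)) (fun τ b => ev_comp_antipode τ b),
    ev_comp_unit_counit, ← Int.cast_sum, InvSet.sum_cycleSign]
  split_ifs <;> simp

theorem mul_comul_antipode :
    mul G ∘ₗ TensorProduct.map .id (antipode G) ∘ₗ comul G = unit G ∘ₗ counit G := by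
  have h : (TensorProduct.comm ℤ (R G) (R G)).toLinearMap ∘ₗ TensorProduct.map .id (antipode G) =
      TensorProduct.map (antipode G) .id ∘ₗ (TensorProduct.comm ℤ (R G) (R G)).toLinearMap :=
    TensorProduct.ext' fun x y => by simp
  rw [← mul_comm', LinearMap.comp_assoc, ← LinearMap.comp_assoc (comul G), h,
    LinearMap.comp_assoc, comul_comm, mul_antipode_comul]

variable (G) in
theorem isHopfAlgebra : IsHopfAlgebra (mul G) (comul G) (unit G) (counit G) (antipode G) where
  mul_assoc := act_assoc (MonoidHom.id G)
  one_mul := act_unit (MonoidHom.id G)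
  mul_one := mul_unit
  coassoc := coact_coassoc (MonoidHom.id G)
  counit_comul := coact_counit (MonoidHom.id G)
  comul_counit := comul_counit
  comul_mul := comul_comp_mul
  comul_one := comul_unit
  counit_mul := counit_mul
  counit_one := counit_unit
  antipode_left := mul_antipode_comul
  antipode_right := mul_comul_antipode

variable (G) in
theorem isPSHAlgebra : IsPSHAlgebra (mul G) (comul G) (unit G) (counit G) where
  hopf := ⟨antipode G, isHopfAlgebra G, isGradedMap_antipode⟩
  graded := isGradedTGroup G
  graded_mul := isGradedMap_act _
  graded_comul := isGradedMap_coact _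
  graded_unit := isGradedMap_unit
  graded_counit := isGradedMap_counit
  connected := ⟨fun a => LinearMap.congr_fun
    (LinearMap.ext_ring counit_unit : counit G ∘ₗ unit G = .id) a,
    fun _ hx => unit_counit_of_mem_grade hx⟩
  positive_mul := isPositiveMap_act _
  positive_comul := isAdjoint_mul.isPositiveMap (isPositiveMap_act _)
  positive_unit := isPositiveMap_unit
  positive_counit := isAdjoint_unit.isPositiveMap isPositiveMap_unit
  adjoint_mul := isAdjoint_mul
  adjoint_unit := isAdjoint_unit

theorem isHopfModule {H : Type u} [Group H] [Finite H] (ι : H →* G) :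
    IsHopfModule (mul H) (comul H) (unit H) (counit H) (act ι) (coact ι) where
  assoc := act_assoc ι
  coassoc := coact_coassoc ι
  unit := act_unit ι
  counit := coact_counit ι

end R

end

theorem theorem16 {G : Type u} [Group G] [Finite G] (H : Subgroup G) [H.Normal]
    (hinn : ∀ g : G, ∃ h : H, ∀ x : H, g * (x : G) * g⁻¹ = h * x * h⁻¹) :
    IsPSHModule H.index (R.mul H) (R.comul H) (R.unit H) (R.counit H)
      (R.act H.subtype) (R.coact H.subtype) where
  pshAlgebra := R.isPSHAlgebra H
  kHopf :=
    { R.isHopfModule H.subtype with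
      -- The scalar that induction produces on a block in H is exactly the eigenvalue of Ψ^[G:H].
      coact_act := R.coact_act_of_evInd
        (c := fun {_} _ τ => (Nat.card (InvFun τ (Fin H.index)) : ℂ))
        (fun τ b => R.ev_comp_hopfPower H.index τ b)
        (fun σ a τ b => R.evInd_sumElim hinn σ a τ b) }
  graded := R.isGradedTGroup G
  graded_act := R.isGradedMap_act _
  graded_coact := R.isGradedMap_coact _
  positive_act := R.isPositiveMap_act _
  positive_coact := (R.isAdjoint_act _).isPositiveMap (R.isPositiveMap_act _)
  adjoint := R.isAdjoint_act _
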